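/- Let $\mathbf k$ be an algebraically closed field of characteristic $\neq 2$. A superalgebra over $\mathbf k$ is an algebra $J=J_{\bar 0}\oplus J_{\bar 1}$ (not necessarily associative) with $J_{\bar i}J_{\bar j}\subseteq J_{\bar i+\bar j}$. It is a Jordan superalgebra if its even part $J_{\bar 0}$ is a Jordan algebra (it is commutative and $a^2(ba)=(a^2b)a$ for all $a,b\in J_{\bar 0}$) and if all homogeneous $a,b,c,d\in J$ satisfy $ab=(-1)^{|a||b|}ba$ and $$(ab)(cd)+(-1)^{|b||c|}(ac)(bd)+(-1)^{|b||d|+|c||d|}(ad)(bc)$$ $$=((ab)c)d+(-1)^{|b||c|+|b||d|+|c||d|}((ad)c)b+(-1)^{|a||b|+|a||c|+|a||d|+|c||d|}((bd)c)a .$$ (If $\operatorname{char}\mathbf k\ne 3$, the Jordan identity on $J_{\bar 0}$ follows from the last identity.) The type of $J$ is $(\dim J_{\bar 0},\dim J_{\bar 1})$. Isomorphisms are bijective algebra homomorphisms that preserve the grading, and $\oplus$ is the direct sum of superalgebras. In the following list, $e_i$ denotes even and $o_i$ odd basis vectors. Products that are not displayed are $0$ or are determined by supercommutativity. Trivially graded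 (purely even) superalgebras. Dimension 1: $\mathcal U_1$: $e_1^2=e_1$; $\mathcal U_2$: $e_1^2=0$. Dimension 2: $\mathcal B_1$: $e_1^2=e_1,\ e_1e_2=e_2$; $\mathcal B_2$: $e_1^2=e_1,\ e_1e_2=\frac12e_2$; $\mathcal B_3$: $e_1^2=e_2$. Dimension 3: $\mathcal T_1$: $e_1^2=e_1,\ e_2^2=e_3,\ e_1e_2=e_2,\ e_1e_3=e_3$; $\mathcal T_2$: $e_1^2=e_1,\ e_1e_2=e_2,\ e_1e_3=e_3$; $\mathcal T_3$: $e_1^2=e_2,\ e_1e_2=e_3$; $\mathcal T_4$: $e_1^2=e_2,\ e_1e_3=e_2$; $\mathcal T_5$: $e_1^2=e_1,\ e_2^2=e_2,\ e_3^2=e_1+e_2,\ e_1e_3=\frac12e_3,\ e_2e_3=\frac12e_3$; $\mathcal T_6$: $e_1^2=e_1,\ e_1e_2=\frac12e_2,\ e_1e_3=e_3$; $\mathcal T_7$: $e_1^2=e_1,\ e_1e_2=\frac12e_2,\ e_1e_3=\frac12e_3$; $\mathcal T_8$: $e_1^2=e_1,\ e_2^2=e_3,\ e_1e_2=\frac12e_2$;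 $\mathcal T_9$: $e_1^2=e_1,\ e_2^2=e_3,\ e_1e_2=\frac12e_2,\ e_1e_3=e_3$; $\mathcal T_{10}$: $e_1^2=e_1,\ e_2^2=e_2,\ e_1e_3=\frac12e_3,\ e_2e_3=\frac12e_3$. Superalgebras with nonzero odd part. $\mathcal S^1_1$ (type $(0,1)$): $o_1^2=0$. Type $(1,1)$: $\mathcal S^2_1$: $e_1^2=e_1,\ e_1o_1=\frac12o_1$; $\mathcal S^2_2$: $e_1^2=e_1,\ e_1o_1=o_1$. Type $(1,2)$: $\mathcal S^3_1$: $e_1o_1=o_2,\ o_1o_2=e_1$; $\mathcal S^3_2$: $o_1o_2=e_1$; $\mathcal S^3_3$: $e_1o_1=o_2$; $\mathcal S^3_4$: $e_1^2=e_1,\ e_1o_1=o_1,\ e_1o_2=\frac12o_2$; $\mathcal S^3_5$: $e_1^2=e_1,\ e_1o_1=\frac12o_1,\ e_1o_2=\frac12o_2$; $\mathcal S^3_6$: $e_1^2=e_1,\ e_1o_1=o_1,\ e_1o_2=o_2$; $\mathcal S^3_7$: $e_1^2=e_1,\ e_1o_1=\frac12o_1,\ e_1o_2=\frac12o_2,\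 o_1o_2=e_1$; $\mathcal S^3_8$: $e_1^2=e_1,\ e_1o_1=o_1,\ e_1o_2=o_2,\ o_1o_2=e_1$. Type $(2,1)$: $\mathcal S^3_9$: $e_1^2=e_1,\ e_1e_2=e_2,\ e_1o_1=\frac12o_1$; $\mathcal S^3_{10}$: $e_1^2=e_1,\ e_1e_2=e_2,\ e_1o_1=o_1$; $\mathcal S^3_{11}$: $e_1^2=e_1,\ e_1e_2=\frac12e_2,\ e_1o_1=\frac12o_1$; $\mathcal S^3_{12}$: $e_1^2=e_1,\ e_1e_2=\frac12e_2,\ e_1o_1=o_1$; $\mathcal S^3_{13}$: $e_1^2=e_1,\ e_2^2=e_2,\ e_1o_1=\frac12o_1,\ e_2o_1=\frac12o_1$. **Theorem.** Every Jordan superalgebra over $\mathbf k$ of type $(n,m)$ with $n+m\le 3$ is isomorphic to one of the superalgebras in the row $(n,m)$ below. Conversely, every superalgebra in the row $(n,m)$ is a Jordan superalgebra of type $(n,m)$. - $(0,0)$: the zero superalgebra. - $(1,0)$: $\mathcal U_1$, $\mathcal U_2$. - $(0,1)$: $\mathcal S^1_1$. - $(2,0)$: $\mathcal B_1$, $\mathcal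 B_2$, $\mathcal B_3$, $\mathcal U_1\oplus\mathcal U_1$, $\mathcal U_1\oplus\mathcal U_2$, $\mathcal U_2\oplus\mathcal U_2$. - $(1,1)$: $\mathcal S^2_1$, $\mathcal S^2_2$, $\mathcal U_1\oplus\mathcal S^1_1$, $\mathcal U_2\oplus\mathcal S^1_1$. - $(0,2)$: $\mathcal S^1_1\oplus\mathcal S^1_1$. - $(3,0)$: $\mathcal T_1,\dots,\mathcal T_{10}$, $\mathcal B_i\oplus\mathcal U_j$ ($i=1,2,3$, $j=1,2$), $\mathcal U_1\oplus\mathcal U_1\oplus\mathcal U_1$, $\mathcal U_1\oplus\mathcal U_1\oplus\mathcal U_2$, $\mathcal U_1\oplus\mathcal U_2\oplus\mathcal U_2$, $\mathcal U_2\oplus\mathcal U_2\oplus\mathcal U_2$. - $(1,2)$: $\mathcal S^3_1,\dots,\mathcal S^3_8$, $\mathcal S^2_1\oplus\mathcal S^1_1$, $\mathcal S^2_2\oplus\mathcal S^1_1$, $\mathcal U_1\oplus\mathcal S^1_1\oplus\mathcal S^1_1$, $\mathcal U_2\oplus\mathcal S^1_1\oplus\mathcal S^1_1$. - $(2,1)$: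 $\mathcal S^3_9,\dots,\mathcal S^3_{13}$, $\mathcal B_i\oplus\mathcal S^1_1$ ($i=1,2,3$), $\mathcal S^2_i\oplus\mathcal U_j$ ($i,j\in\{1,2\}$), $\mathcal U_1\oplus\mathcal U_1\oplus\mathcal S^1_1$, $\mathcal U_1\oplus\mathcal U_2\oplus\mathcal S^1_1$, $\mathcal U_2\oplus\mathcal U_2\oplus\mathcal S^1_1$. - $(0,3)$: $\mathcal S^1_1\oplus\mathcal S^1_1\oplus\mathcal S^1_1$. -/

import Mathlib

universe u v w

/-- A superalgebra over `k`: a (not necessarily associative) algebra with bilinear product `mul`,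
which is the direct sum of subspaces `part 0` (even part) and `part 1` (odd part), such that
`part i · part j ⊆ part (i + j)`. -/
structure Superalgebra (k : Type u) [Field k] where
  carrier : Type v
  [addCommGroup : AddCommGroup carrier]
  [module : Module k carrier]
  mul : carrier →ₗ[k] carrier →ₗ[k] carrier
  part : ZMod 2 → Submodule k carrier
  isCompl : IsCompl (part 0) (part 1)
  mul_mem : ∀ {i j : ZMod 2} {a b : carrier}, a ∈ part i → b ∈ part j → mul a b ∈ part (i + j)

namespace Superalgebra

attribute [instance] Superalgebra.addCommGroup Superalgebra.module

variable {k : Type u} [Field k]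

/-- Jordan superalgebras. The identities are imposed on homogeneous elements, `i.val` being the
parity of an element of `part i`. The condition `even_jordan` says that the even part is an
ordinary Jordan algebra: if `3 ≠ 0` in `k`, it follows from `super_jordan` with three equal
arguments `a = b = d`, but in characteristic `3` it does not. -/
structure IsJordan (J : Superalgebra.{u, v} k) : Prop where
  super_comm : ∀ (i j : ZMod 2), ∀ a ∈ J.part i, ∀ b ∈ J.part j,
    J.mul a b = (-1 : k) ^ (i.val * j.val) • J.mul b a
  super_jordan : ∀ (i j l r : ZMod 2),
    ∀ a ∈ J.part i, ∀ b ∈ J.part j, ∀ c ∈ J.part l, ∀ d ∈ J.part r,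
    J.mul (J.mul a b) (J.mul c d)
      + (-1 : k) ^ (j.val * l.val) • J.mul (J.mul a c) (J.mul b d)
      + (-1 : k) ^ (j.val * r.val + l.val * r.val) • J.mul (J.mul a d) (J.mul b c)
    = J.mul (J.mul (J.mul a b) c) d
      + (-1 : k) ^ (j.val * l.val + j.val * r.val + l.val * r.val) •
          J.mul (J.mul (J.mul a d) c) b
      + (-1 : k) ^ (i.val * j.val + i.val * l.val + i.val * r.val + l.val * r.val) •
          J.mul (J.mul (J.mul b d) c) a
  even_jordan : ∀ a ∈ J.part 0, ∀ b ∈ J.part 0,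
    J.mul (J.mul a a) (J.mul b a) = J.mul (J.mul (J.mul a a) b) a

/-- `J` has type `(n, m)`: its even part has dimension `n` and its odd part dimension `m`. -/
def HasType (J : Superalgebra.{u, v} k) (n m : ℕ) : Prop :=
  Module.Finite k J.carrier ∧ Module.finrank k (J.part 0) = n ∧ Module.finrank k (J.part 1) = m

/-- Isomorphism of superalgebras: a bijective algebra homomorphism preserving the grading. -/
def Isomorphic (A : Superalgebra.{u, v} k) (B : Superalgebra.{u, w} k) : Prop :=
  ∃ f : A.carrier ≃ₗ[k] B.carrier,
    (∀ x y, f (A.mul x y) = B.mul (f x) (f y)) ∧ ∀ i, ∀ x ∈ A.part i, f x ∈ B.part i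

/-- The direct sum of two superalgebras. -/
def dsum (A : Superalgebra.{u, v} k) (B : Superalgebra.{u, w} k) :
    Superalgebra.{u, max v w} k where
  carrier := A.carrier × B.carrier
  mul := LinearMap.mk₂ k (fun x y => (A.mul x.1 y.1, B.mul x.2 y.2))
    (by intros; simp) (by intros; simp) (by intros; simp) (by intros; simp)
  part i := (A.part i).prod (B.part i)
  isCompl := by
    constructor
    · rw [Submodule.disjoint_def]
      rintro ⟨x, y⟩ ⟨h1, h2⟩ ⟨h3, h4⟩
      exact Prod.ext (Submodule.disjoint_def.1 A.isCompl.disjoint x h1 h3)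
        (Submodule.disjoint_def.1 B.isCompl.disjoint y h2 h4)
    · rw [codisjoint_iff, Submodule.prod_sup_prod, A.isCompl.sup_eq_top, B.isCompl.sup_eq_top,
        Submodule.prod_top]
  mul_mem h1 h2 := ⟨A.mul_mem h1.1 h2.1, B.mul_mem h1.2 h2.2⟩

end Superalgebra

/-- The bilinear map with prescribed values `t i j` at the pairs of standard basis vectors. -/
def tableMul {k : Type u} [Field k] {p q r : ℕ} (t : Fin p → Fin q → Fin r → k) :
    (Fin p → k) →ₗ[k] (Fin q → k) →ₗ[k] (Fin r → k) :=
  LinearMap.mk₂ k (fun x y => ∑ i, ∑ j, (x i * y j) • t i j)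
    (by intros; simp [add_mul, add_smul, Finset.sum_add_distrib])
    (by intros; simp [Finset.smul_sum, smul_smul, mul_assoc])
    (by intros; simp [mul_add, add_smul, Finset.sum_add_distrib])
    (by intros; simp [Finset.smul_sum, smul_smul, mul_left_comm])

/-- The superalgebra with basis `e_0, …, e_{n-1}` (even) and `o_0, …, o_{m-1}` (odd), whose
products are `e_i e_j = ee i j`, `e_i o_j = o_j e_i = eo i j` and `o_i o_j = oo i j`. -/
def ofTable {k : Type u} [Field k] (n m : ℕ) (ee : Fin n → Fin n → Fin n → k)
    (eo : Fin n → Fin m → Fin m → k) (oo : Fin m → Fin m → Fin n → k) :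
    Superalgebra.{u, u} k where
  carrier := (Fin n → k) × (Fin m → k)
  mul := LinearMap.mk₂ k
    (fun x y => (tableMul ee x.1 y.1 + tableMul oo x.2 y.2,
      tableMul eo x.1 y.2 + tableMul eo y.1 x.2))
    (by intros; ext <;> simp <;> ring) (by intros; ext <;> simp)
    (by intros; ext <;> simp <;> ring) (by intros; ext <;> simp)
  part i := if i = 0 then LinearMap.ker (LinearMap.snd k (Fin n → k) (Fin m → k))
    else LinearMap.ker (LinearMap.fst k (Fin n → k) (Fin m → k))
  isCompl := by
    simp only [if_true, one_ne_zero, if_false]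
    constructor
    · rw [Submodule.disjoint_def]
      rintro ⟨x, y⟩ h1 h2
      exact Prod.ext h2 h1
    · rw [codisjoint_iff, eq_top_iff]
      rintro ⟨x, y⟩ -
      exact Submodule.mem_sup.2 ⟨(x, 0), by simp, (0, y), by simp, by simp⟩
  mul_mem := by
    intro i j a b ha hb
    have h : ∀ i : ZMod 2, i = 0 ∨ i = 1 := by decide
    have h11 : (1 : ZMod 2) + 1 = 0 := rfl
    rcases h i with rfl | rfl <;> rcases h j with rfl | rfl <;> simp_all

/-- The superalgebra with basis `e_0, …, e_{n-1}`, all even, and `e_i e_j = ee i j`. -/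
def evenTable {k : Type u} [Field k] (n : ℕ) (ee : Fin n → Fin n → Fin n → k) :
    Superalgebra.{u, u} k :=
  ofTable n 0 ee 0 0

/-- Standard basis vectors. They are indexed from `0`, so the vector usually written
`e_i` (or `o_i`) is `bv (i - 1)` below. -/
def bv {k : Type u} [Field k] {n : ℕ} (i : Fin n) : Fin n → k := Pi.single i 1

namespace JordanList

variable (k : Type u) [Field k]

/-! ### Indecomposable Jordan algebras with trivial grading

The entry in row `i`, column `j` is the product of the `i`-th and the `j`-th basis vector. -/

def U1 : Superalgebra.{u, u} k := evenTable 1 ![![bv 0]]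

def U2 : Superalgebra.{u, u} k := evenTable 1 ![![0]]

def B1 : Superalgebra.{u, u} k := evenTable 2
  ![![bv 0, bv 1],
    ![bv 1, 0]]

def B2 : Superalgebra.{u, u} k := evenTable 2
  ![![bv 0, (1 / 2 : k) • bv 1],
    ![(1 / 2 : k) • bv 1, 0]]

def B3 : Superalgebra.{u, u} k := evenTable 2
  ![![bv 1, 0],
    ![0, 0]]

def T1 : Superalgebra.{u, u} k := evenTable 3
  ![![bv 0, bv 1, bv 2],
    ![bv 1, bv 2, 0],
    ![bv 2, 0, 0]]

def T2 : Superalgebra.{u, u} k := evenTable 3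
  ![![bv 0, bv 1, bv 2],
    ![bv 1, 0, 0],
    ![bv 2, 0, 0]]

def T3 : Superalgebra.{u, u} k := evenTable 3
  ![![bv 1, bv 2, 0],
    ![bv 2, 0, 0],
    ![0, 0, 0]]

def T4 : Superalgebra.{u, u} k := evenTable 3
  ![![bv 1, 0, bv 1],
    ![0, 0, 0],
    ![bv 1, 0, 0]]

def T5 : Superalgebra.{u, u} k := evenTable 3
  ![![bv 0, 0, (1 / 2 : k) • bv 2],
    ![0, bv 1, (1 / 2 : k) • bv 2],
    ![(1 / 2 : k) • bv 2, (1 / 2 : k) • bv 2, bv 0 + bv 1]]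

def T6 : Superalgebra.{u, u} k := evenTable 3
  ![![bv 0, (1 / 2 : k) • bv 1, bv 2],
    ![(1 / 2 : k) • bv 1, 0, 0],
    ![bv 2, 0, 0]]

def T7 : Superalgebra.{u, u} k := evenTable 3
  ![![bv 0, (1 / 2 : k) • bv 1, (1 / 2 : k) • bv 2],
    ![(1 / 2 : k) • bv 1, 0, 0],
    ![(1 / 2 : k) • bv 2, 0, 0]]

def T8 : Superalgebra.{u, u} k := evenTable 3
  ![![bv 0, (1 / 2 : k) • bv 1, 0],
    ![(1 / 2 : k) • bv 1, bv 2, 0],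
    ![0, 0, 0]]

def T9 : Superalgebra.{u, u} k := evenTable 3
  ![![bv 0, (1 / 2 : k) • bv 1, bv 2],
    ![(1 / 2 : k) • bv 1, bv 2, 0],
    ![bv 2, 0, 0]]

def T10 : Superalgebra.{u, u} k := evenTable 3
  ![![bv 0, 0, (1 / 2 : k) • bv 2],
    ![0, bv 1, (1 / 2 : k) • bv 2],
    ![(1 / 2 : k) • bv 2, (1 / 2 : k) • bv 2, 0]]

/-! ### Indecomposable superalgebras with nonzero odd part

`Sd_j` has dimension `d`. The three tables are those of the products `e_i e_j`, `e_i o_j` and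
`o_i o_j`; a table equal to `0` means that all these products vanish. -/

def S1_1 : Superalgebra.{u, u} k := ofTable 0 1 0 0 0

def S2_1 : Superalgebra.{u, u} k := ofTable 1 1 ![![bv 0]] ![![(1 / 2 : k) • bv 0]] 0

def S2_2 : Superalgebra.{u, u} k := ofTable 1 1 ![![bv 0]] ![![bv 0]] 0

def S3_1 : Superalgebra.{u, u} k :=
  ofTable 1 2 0 ![![bv 1, 0]] ![![0, bv 0], ![-bv 0, 0]]

def S3_2 : Superalgebra.{u, u} k :=
  ofTable 1 2 0 0 ![![0, bv 0], ![-bv 0, 0]]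

def S3_3 : Superalgebra.{u, u} k :=
  ofTable 1 2 0 ![![bv 1, 0]] 0

def S3_4 : Superalgebra.{u, u} k :=
  ofTable 1 2 ![![bv 0]] ![![bv 0, (1 / 2 : k) • bv 1]] 0

def S3_5 : Superalgebra.{u, u} k :=
  ofTable 1 2 ![![bv 0]] ![![(1 / 2 : k) • bv 0, (1 / 2 : k) • bv 1]] 0

def S3_6 : Superalgebra.{u, u} k :=
  ofTable 1 2 ![![bv 0]] ![![bv 0, bv 1]] 0

def S3_7 : Superalgebra.{u, u} k :=
  ofTable 1 2 ![![bv 0]] ![![(1 / 2 : k) • bv 0, (1 / 2 : k) • bv 1]]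
    ![![0, bv 0], ![-bv 0, 0]]

def S3_8 : Superalgebra.{u, u} k :=
  ofTable 1 2 ![![bv 0]] ![![bv 0, bv 1]] ![![0, bv 0], ![-bv 0, 0]]

def S3_9 : Superalgebra.{u, u} k :=
  ofTable 2 1 ![![bv 0, bv 1], ![bv 1, 0]] ![![(1 / 2 : k) • bv 0], ![0]] 0

def S3_10 : Superalgebra.{u, u} k :=
  ofTable 2 1 ![![bv 0, bv 1], ![bv 1, 0]] ![![bv 0], ![0]] 0

def S3_11 : Superalgebra.{u, u} k :=
  ofTable 2 1 ![![bv 0, (1 / 2 : k) • bv 1], ![(1 / 2 : k) • bv 1, 0]]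
    ![![(1 / 2 : k) • bv 0], ![0]] 0

def S3_12 : Superalgebra.{u, u} k :=
  ofTable 2 1 ![![bv 0, (1 / 2 : k) • bv 1], ![(1 / 2 : k) • bv 1, 0]] ![![bv 0], ![0]] 0

def S3_13 : Superalgebra.{u, u} k :=
  ofTable 2 1 ![![bv 0, 0], ![0, bv 1]] ![![(1 / 2 : k) • bv 0], ![(1 / 2 : k) • bv 0]] 0

local infixr:65 " ⊞ " => Superalgebra.dsum

/-- The list of superalgebras of dimension at most three, organized by type `(n, m)`. -/
inductive Listed : ℕ → ℕ → Superalgebra.{u, u} k → Prop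
  -- dimension zero
  | zero : Listed 0 0 (ofTable 0 0 0 0 0)
  -- dimension one
  | U1 : Listed 1 0 (U1 k)
  | U2 : Listed 1 0 (U2 k)
  | S1_1 : Listed 0 1 (S1_1 k)
  -- type (2,0)
  | B1 : Listed 2 0 (B1 k)
  | B2 : Listed 2 0 (B2 k)
  | B3 : Listed 2 0 (B3 k)
  | U1_U1 : Listed 2 0 (U1 k ⊞ U1 k)
  | U1_U2 : Listed 2 0 (U1 k ⊞ U2 k)
  | U2_U2 : Listed 2 0 (U2 k ⊞ U2 k)
  -- type (1,1)
  | S2_1 : Listed 1 1 (S2_1 k)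
  | S2_2 : Listed 1 1 (S2_2 k)
  | U1_S : Listed 1 1 (U1 k ⊞ S1_1 k)
  | U2_S : Listed 1 1 (U2 k ⊞ S1_1 k)
  -- type (0,2)
  | S_S : Listed 0 2 (S1_1 k ⊞ S1_1 k)
  -- type (3,0)
  | T1 : Listed 3 0 (T1 k)
  | T2 : Listed 3 0 (T2 k)
  | T3 : Listed 3 0 (T3 k)
  | T4 : Listed 3 0 (T4 k)
  | T5 : Listed 3 0 (T5 k)
  | T6 : Listed 3 0 (T6 k)
  | T7 : Listed 3 0 (T7 k)
  | T8 : Listed 3 0 (T8 k)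
  | T9 : Listed 3 0 (T9 k)
  | T10 : Listed 3 0 (T10 k)
  | B1_U1 : Listed 3 0 (B1 k ⊞ U1 k)
  | B1_U2 : Listed 3 0 (B1 k ⊞ U2 k)
  | B2_U1 : Listed 3 0 (B2 k ⊞ U1 k)
  | B2_U2 : Listed 3 0 (B2 k ⊞ U2 k)
  | B3_U1 : Listed 3 0 (B3 k ⊞ U1 k)
  | B3_U2 : Listed 3 0 (B3 k ⊞ U2 k)
  | U1_U1_U1 : Listed 3 0 (U1 k ⊞ U1 k ⊞ U1 k)
  | U1_U1_U2 : Listed 3 0 (U1 k ⊞ U1 k ⊞ U2 k)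
  | U1_U2_U2 : Listed 3 0 (U1 k ⊞ U2 k ⊞ U2 k)
  | U2_U2_U2 : Listed 3 0 (U2 k ⊞ U2 k ⊞ U2 k)
  -- type (1,2)
  | S3_1 : Listed 1 2 (S3_1 k)
  | S3_2 : Listed 1 2 (S3_2 k)
  | S3_3 : Listed 1 2 (S3_3 k)
  | S3_4 : Listed 1 2 (S3_4 k)
  | S3_5 : Listed 1 2 (S3_5 k)
  | S3_6 : Listed 1 2 (S3_6 k)
  | S3_7 : Listed 1 2 (S3_7 k)
  | S3_8 : Listed 1 2 (S3_8 k)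
  | S2_1_S : Listed 1 2 (S2_1 k ⊞ S1_1 k)
  | S2_2_S : Listed 1 2 (S2_2 k ⊞ S1_1 k)
  | U1_S_S : Listed 1 2 (U1 k ⊞ S1_1 k ⊞ S1_1 k)
  | U2_S_S : Listed 1 2 (U2 k ⊞ S1_1 k ⊞ S1_1 k)
  -- type (2,1)
  | S3_9 : Listed 2 1 (S3_9 k)
  | S3_10 : Listed 2 1 (S3_10 k)
  | S3_11 : Listed 2 1 (S3_11 k)
  | S3_12 : Listed 2 1 (S3_12 k)
  | S3_13 : Listed 2 1 (S3_13 k)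
  | B1_S : Listed 2 1 (B1 k ⊞ S1_1 k)
  | B2_S : Listed 2 1 (B2 k ⊞ S1_1 k)
  | B3_S : Listed 2 1 (B3 k ⊞ S1_1 k)
  | S2_1_U1 : Listed 2 1 (S2_1 k ⊞ U1 k)
  | S2_1_U2 : Listed 2 1 (S2_1 k ⊞ U2 k)
  | S2_2_U1 : Listed 2 1 (S2_2 k ⊞ U1 k)
  | S2_2_U2 : Listed 2 1 (S2_2 k ⊞ U2 k)
  | U1_U1_S : Listed 2 1 (U1 k ⊞ U1 k ⊞ S1_1 k)
  | U1_U2_S : Listed 2 1 (U1 k ⊞ U2 k ⊞ S1_1 k)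
  | U2_U2_S : Listed 2 1 (U2 k ⊞ U2 k ⊞ S1_1 k)
  -- type (0,3)
  | S_S_S : Listed 0 3 (S1_1 k ⊞ S1_1 k ⊞ S1_1 k)

end JordanList

/-!
A superalgebra is determined up to isomorphism by its structure constants in a homogeneous basis
(`Superalgebra.HasTable`, `Superalgebra.HasTable.isomorphic`), so the classification amounts to
finding in each Jordan superalgebra a basis that multiplies as one of the listed tables does.

For an algebra with trivial grading, the argument rests on idempotents. An element that is not
nilpotent generates a nonzero idempotent, because its powers span an associative algebra
(`IsJordanProduct.mul_aeval`) in which the Fitting decomposition is given by a polynomial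
(`IsJordanProduct.exists_idempotent_of_pow_ne_zero`). Multiplication by an idempotent `e` is
annihilated by `X (2X - 1) (X - 1)`, so that the space is the sum of the eigenspaces `V_0`, `V_{1/2}`
and `V_1`; the linearized Jordan identity restricts the products of eigenvectors
(`IsJordanProduct.peirce`, `IsJordanProduct.peirce_half`). In dimension three there are few
possibilities for the eigenvalues on a complement of the line through `e`. If some idempotent has
`V_0 ≠ 0`, then the remaining structure constants are computed from a handful of instances of the
Jordan identity. If none has, then no idempotent splits. This settles the eigenvalues `1` and `1/2`
directly, and shows in the unital case that every element is a scalar plus a nilpotent element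
(`IsJordanProduct.exists_sub_smul_pow_eq_zero`). Without nonzero idempotents, every element `x`
satisfies `x⁴ = 0`, and the cases are whether `x³` or `x²` vanishes identically.

In the mixed types, the even part is one of the algebras of dimension at most two, found in the same
way. If the odd part is a line, then odd products vanish and the even part acts by scalars, which
satisfy a cubic equation (`Superalgebra.IsJordan.exists_weight`). In type `(1, 2)`, the action of
the even basis vector on the odd part is either diagonalizable or square-zero, and a Peirce relation
for odd eigenvectors (`Superalgebra.IsJordan.odd_peirce`) decides when their product can be nonzero.

For the converse, the Jordan identities are inherited by direct sums
(`Superalgebra.IsJordan.dsum`) and are polynomial identities in the coordinates for each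
indecomposable table.
-/

/-! ### Jordan products, powers and idempotents -/

section

open Polynomial

/-- A bilinear product `m` on a vector space is a Jordan product if it is commutative and satisfies
the Jordan identity together with its full linearization. The Jordan identity is a separate field
because in characteristic `3` it does not follow from the linearization. -/
structure IsJordanProduct {k : Type*} [Field k] {V : Type*} [AddCommGroup V] [Module k V]
    (m : V →ₗ[k] V →ₗ[k] V) : Prop where
  comm : ∀ a b, m a b = m b a
  jordan : ∀ a b, m (m a a) (m b a) = m (m (m a a) b) a
  linearized : ∀ a b c d,
    m (m a b) (m c d) + m (m a c) (m b d) + m (m a d) (m b c)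
      = m (m (m a b) c) d + m (m (m a d) c) b + m (m (m b d) c) a

/-- The Fitting decomposition of an endomorphism `f` in polynomial form: `f p(f)` is an idempotent
that acts as the identity on the range of `f ^ r`. -/
lemma exists_fitting_polynomial {k : Type*} [Field k] {V : Type*} [AddCommGroup V] [Module k V]
    [FiniteDimensional k V] (f : Module.End k V) :
    ∃ (r : ℕ) (p : k[X]), f ^ r = f ^ r * (f * aeval f p) ∧
      aeval f (X * p * p) = aeval f p := by
  have hint : IsIntegral k f := Algebra.IsIntegral.isIntegral _
  obtain ⟨g, hg, hdvd⟩ := exists_eq_pow_rootMultiplicity_mul_and_not_dvd (minpoly k f)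
    (minpoly.ne_zero hint) 0
  generalize rootMultiplicity 0 (minpoly k f) = r at hg
  simp only [map_zero, sub_zero] at hg hdvd
  have hg0 : g.coeff 0 ≠ 0 := fun h0 => hdvd (X_dvd_iff.2 h0)
  -- `g = g(0) (1 - X u)`, hence `f u(f)` is the identity on the part where `f` is bijective.
  obtain ⟨w, hw⟩ : X ∣ g - C (g.coeff 0) := X_dvd_iff.2 (by simp)
  obtain ⟨u, hgu⟩ : ∃ u, C (g.coeff 0)⁻¹ * g = 1 - X * u := by
    refine ⟨- C (g.coeff 0)⁻¹ * w, ?_⟩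
    have h2 : C (g.coeff 0)⁻¹ * C (g.coeff 0) = 1 := by
      rw [← C_mul, inv_mul_cancel₀ hg0, C_1]
    linear_combination C (g.coeff 0)⁻¹ * hw + h2
  have hzero : aeval f (X ^ r * (1 - X * u)) = 0 := by
    have : X ^ r * (1 - X * u) = C (g.coeff 0)⁻¹ * minpoly k f := by
      rw [← hgu, hg]; ring
    rw [this, map_mul, minpoly.aeval, mul_zero]
  have hvan : ∀ p q : k[X], (∃ t, p - q = X ^ r * (1 - X * u) * t) → aeval f p = aeval f q := by
    rintro p q ⟨t, ht⟩
    rw [← sub_eq_zero, ← map_sub, ht, map_mul, hzero, zero_mul]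
  obtain ⟨s, hs⟩ : (1 - X * u) ∣ 1 - (X * u) ^ (r + 1) := by
    have := sub_dvd_pow_sub_pow 1 (X * u) (r + 1)
    rwa [one_pow] at this
  refine ⟨r, X ^ r * u ^ (r + 1), ?_, ?_⟩
  · have h1 := hvan (X ^ r) (X ^ r * (X * (X ^ r * u ^ (r + 1))))
      ⟨s, by linear_combination X ^ r * hs⟩
    rw [map_mul (aeval f) (X ^ r), map_mul (aeval f) X, map_pow, aeval_X] at h1
    exact h1
  · exact hvan _ _ ⟨-(u ^ (r + 1) * s), by linear_combination -X ^ r * u ^ (r + 1) * hs⟩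

/-- An operator annihilated by `X (2X - 1) (X - 1)` is diagonalizable: outside each proper subspace
it has an eigenvector. -/
lemma exists_eigenvector_notMem_of_cubic {k : Type*} [Field k] {V : Type*} [AddCommGroup V]
    [Module k V] (h2 : (2 : k) ≠ 0) {f : Module.End k V}
    (hf : ∀ x, (2 : k) • f (f (f x)) - (3 : k) • f (f x) + f x = 0) {U : Submodule k V}
    (hU : U ≠ ⊤) : ∃ v ∉ U, f v = 0 ∨ f v = (1 / 2 : k) • v ∨ f v = v := by
  by_contra! hcon
  refine hU (eq_top_iff.2 fun v _ => ?_)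
  have hq := hf v
  set a := f v
  set b := f a
  set c := f b
  have hc : c = (2 : k)⁻¹ • ((3 : k) • b - a) := by
    rw [eq_inv_smul_iff₀ h2]; linear_combination (norm := module) hq
  have w0 : v - (3 : k) • a + (2 : k) • b ∈ U := by
    by_contra hn
    refine (hcon _ hn).1 ?_
    simp only [map_add, map_sub, map_smul]
    change a - (3 : k) • b + (2 : k) • c = 0
    rw [hc, smul_inv_smul₀ h2]; abel
  have w1 : (2 : k) • b - a ∈ U := by
    by_contra hn
    refine (hcon _ hn).2.2 ?_
    simp only [map_sub, map_smul]
    change (2 : k) • c - b = _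
    rw [hc, smul_inv_smul₀ h2]; module
  have w2 : a - b ∈ U := by
    by_contra hn
    refine (hcon _ hn).2.1 ?_
    simp only [map_sub]
    change b - c = _
    rw [hc, one_div, eq_inv_smul_iff₀ h2, smul_sub, smul_inv_smul₀ h2]; module
  have : v = (v - (3 : k) • a + (2 : k) • b) + ((2 : k) • b - a) + (4 : k) • (a - b) := by module
  rw [this]
  exact add_mem (add_mem w0 w1) (U.smul_mem _ w2)

namespace IsJordanProduct

variable {k : Type*} [Field k] {V : Type*} [AddCommGroup V] [Module k V]
  {m : V →ₗ[k] V →ₗ[k] V}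

lemma commute_sq (h : IsJordanProduct m) (x : V) : Commute (m x) (m (m x x)) := by
  ext b
  have := h.jordan x b
  simp only [Module.End.mul_apply]
  rw [h.comm x (m (m x x) b), ← this, h.comm x b]

/-- The linearized Jordan identity, read as an expression of the multiplication operator of
`(zx)x` through those of `z`, `x`, `zx` and `xx`. -/
lemma mul_operator (h : IsJordanProduct m) (z x : V) :
    m (m (m z x) x) = 2 * (m (m z x) * m x) + m (m x x) * m z - m x * m x * m z
      - m z * (m x * m x) := by
  ext d
  have := h.linearized z x x d
  simp only [LinearMap.add_apply, LinearMap.sub_apply, Module.End.mul_apply, two_mul]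
  rw [h.comm (m z d) (m x x), h.comm (m (m z d) x) x, h.comm (m z d) x, h.comm (m (m x d) x) z,
    h.comm (m x d) x] at this
  rw [eq_sub_iff_add_eq, eq_sub_iff_add_eq, this]
  abel

/-- The powers `x, x², x³, …` have commuting multiplication operators; it suffices to compare
with those of `x` and `x²`. -/
lemma commute_pow (h : IsJordanProduct m) (x : V) (n : ℕ) :
    Commute (m ((m x ^ n) x)) (m x) ∧ Commute (m ((m x ^ n) x)) (m (m x x)) := by
  induction n using Nat.twoStepInduction with
  | zero => exact ⟨by simp, by simpa using h.commute_sq x⟩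
  | one => exact ⟨by simpa using (h.commute_sq x).symm, by simp⟩
  | more n ih0 ih1 =>
    have e1 : (m x ^ (n + 1)) x = m ((m x ^ n) x) x := by
      rw [pow_succ', Module.End.mul_apply, h.comm]
    have e2 : (m x ^ (n + 2)) x = m (m ((m x ^ n) x) x) x := by
      rw [pow_succ', Module.End.mul_apply, e1, h.comm]
    rw [e2, h.mul_operator, ← e1]
    have hs := h.commute_sq x
    have h2 : ∀ T : Module.End k V, Commute (2 : Module.End k V) T := fun T => Nat.cast_commute 2 T
    refine ⟨?_, ?_⟩
    · exact ((((h2 _).mul_left (ih1.1.mul_left rfl)).add_left (hs.symm.mul_left ih0.1)).sub_left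
        ((Commute.mul_left rfl rfl).mul_left ih0.1)).sub_left
        (ih0.1.mul_left (Commute.mul_left rfl rfl))
    · exact ((((h2 _).mul_left (ih1.2.mul_left hs)).add_left
        ((Commute.refl _).mul_left ih0.2)).sub_left ((hs.mul_left hs).mul_left ih0.2)).sub_left
        (ih0.2.mul_left (hs.mul_left hs))

lemma commute_aeval (h : IsJordanProduct m) (x : V) (p : k[X]) :
    Commute (m (aeval (m x) p x)) (m x) := by
  induction p using Polynomial.induction_on' with
  | add p q hp hq => simpa using hp.add_left hq
  | monomial n a =>
    simpa [aeval_monomial, Module.algebraMap_end_apply] using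
      ((h.commute_pow x n).1).smul_left a

/-- Power associativity: the span of the powers of `x` is an associative algebra, the product of
`p(x)x` and `q(x)x` being `p(x)q(x)x²`. -/
lemma mul_aeval (h : IsJordanProduct m) (x : V) (p q : k[X]) :
    m (aeval (m x) p x) (aeval (m x) q x) = aeval (m x) (X * p * q) x := by
  have key : ∀ T : Module.End k V, Commute T (m x) → Commute T (aeval (m x) q) := by
    intro T hT
    induction q using Polynomial.induction_on' with
    | add p q hp hq => simpa using hp.add_right hq
    | monomial n a =>
      simpa [aeval_monomial, ← Algebra.smul_def] using (hT.pow_right n).smul_right a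
  have h1 := LinearMap.congr_fun (key _ (h.commute_aeval x p)).eq x
  simp only [Module.End.mul_apply] at h1
  rw [h1, h.comm _ x, mul_comm, map_mul, map_mul, aeval_X]
  rfl

/-- In a finite-dimensional Jordan algebra, an element that is not nilpotent generates a nonzero
idempotent. -/
lemma exists_idempotent_of_pow_ne_zero [FiniteDimensional k V] (h : IsJordanProduct m) (x : V)
    (hx : ∀ n, (m x ^ n) x ≠ 0) :
    ∃ p : k[X], aeval (m x) p x ≠ 0 ∧
      m (aeval (m x) p x) (aeval (m x) p x) = aeval (m x) p x := by
  obtain ⟨r, p, h1, h2⟩ := exists_fitting_polynomial (m x)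
  refine ⟨p, fun h0 => hx r ?_, ?_⟩
  · have h3 := LinearMap.congr_fun h1 x
    rw [Module.End.mul_apply, Module.End.mul_apply, h0, map_zero, map_zero] at h3
    exact h3
  · rw [h.mul_aeval, h2]

/-- A Jordan algebra of dimension `d` without nonzero idempotents satisfies `x ^ (d + 1) = 0`. -/
lemma pow_finrank_eq_zero [FiniteDimensional k V] (h : IsJordanProduct m)
    (hid : ∀ e, m e e = e → e = 0) (x : V) : (m x ^ Module.finrank k V) x = 0 := by
  by_cases hx : ∀ n, (m x ^ n) x ≠ 0
  · obtain ⟨p, h0, h1⟩ := h.exists_idempotent_of_pow_ne_zero x hx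
    exact absurd (hid _ h1) h0
  · push Not at hx
    obtain ⟨n, hn⟩ := hx
    exact Module.End.ker_pow_le_ker_pow_finrank (m x) n hn

/-- The Peirce relation for two eigenvectors of an idempotent. -/
lemma peirce (h : IsJordanProduct m) {e c d : V} (he : m e e = e) {γ δ : k}
    (hc : m e c = γ • c) (hd : m e d = δ • d) :
    (1 - 2 * δ) • m e (m c d) = (γ * (1 - 2 * δ)) • m c d := by
  have := h.linearized e e c d
  simp only [he, hc, hd, map_smul, LinearMap.smul_apply, h.comm d c, h.comm _ e] at this
  linear_combination (norm := module) this

/-- The product of two eigenvectors of an idempotent for the eigenvalue `1/2`. -/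
lemma peirce_half (h : IsJordanProduct m) {e c d : V} (he : m e e = e)
    (hc : m e c = (1 / 2 : k) • c) (hd : m e d = (1 / 2 : k) • d) :
    m e (m e (m c d)) = m e (m c d) := by
  have := h.linearized e c e d
  simp only [he, hc, hd, map_smul, LinearMap.smul_apply, h.comm _ e, h.comm d c] at this
  linear_combination (norm := module) -this

lemma operator_cubic (h : IsJordanProduct m) {e : V} (he : m e e = e) (x : V) :
    (2 : k) • m e (m e (m e x)) - (3 : k) • m e (m e x) + m e x = 0 := by
  have := h.linearized e e e x
  simp only [he, h.comm _ e] at this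
  linear_combination (norm := module) -this

/-- The eigenvectors of an idempotent span: outside each proper subspace there is one. -/
lemma exists_eigenvector_notMem (h : IsJordanProduct m) (h2 : (2 : k) ≠ 0) {e : V}
    (he : m e e = e) {U : Submodule k V} (hU : U ≠ ⊤) :
    ∃ v ∉ U, m e v = 0 ∨ m e v = (1 / 2 : k) • v ∨ m e v = v :=
  exists_eigenvector_notMem_of_cubic h2 (h.operator_cubic he) hU

/-- A Jordan product restricts to a subspace that is closed under it. -/
lemma exists_restrict (h : IsJordanProduct m) (U : Submodule k V)
    (hU : ∀ x ∈ U, ∀ y ∈ U, m x y ∈ U) :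
    ∃ m' : U →ₗ[k] U →ₗ[k] U, (∀ x y, (m' x y : V) = m x y) ∧ IsJordanProduct m' := by
  refine ⟨LinearMap.mk₂ k (fun x y => ⟨m x y, hU x x.2 y y.2⟩) ?_ ?_ ?_ ?_, fun x y => rfl, ?_⟩
  · intros; ext; simp
  · intros; ext; simp
  · intros; ext; simp
  · intros; ext; simp
  · constructor
    · intro a b; ext; exact h.comm _ _
    · intro a b; ext; exact h.jordan _ _
    · intro a b c d; ext; exact h.linearized _ _ _ _

end IsJordanProduct

end

/-! ### Structure constants of superalgebras -/

namespace Superalgebra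

variable {k : Type u} [Field k]

open Module

/-- `J` has a homogeneous basis with structure constants `ee` (products of two even basis vectors),
`eo` (products of an even and an odd basis vector, in both orders) and `oo` (products of two odd
basis vectors). The families `E` and `O` are the even and the odd members of the basis `B`. -/
def HasTable (J : Superalgebra.{u, v} k) (n m : ℕ) (ee : Fin n → Fin n → Fin n → k)
    (eo : Fin n → Fin m → Fin m → k) (oo : Fin m → Fin m → Fin n → k) : Prop :=
  ∃ (E : Fin n → J.carrier) (O : Fin m → J.carrier) (B : Basis (Fin n ⊕ Fin m) k J.carrier),
    ((∀ i, B (.inl i) = E i) ∧ (∀ i, B (.inr i) = O i)) ∧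
    ((∀ i, E i ∈ J.part 0) ∧ (∀ i, O i ∈ J.part 1)) ∧
    (∀ i j, J.mul (E i) (E j) = ∑ l, ee i j l • E l) ∧
    (∀ i j, J.mul (E i) (O j) = ∑ l, eo i j l • O l) ∧
    (∀ i j, J.mul (O j) (E i) = ∑ l, eo i j l • O l) ∧
    (∀ i j, J.mul (O i) (O j) = ∑ l, oo i j l • E l)

/-- The part spanned by a subfamily of a homogeneous basis. -/
lemma part_eq_span {J : Superalgebra.{u, v} k} {n m : ℕ}
    {B : Basis (Fin n ⊕ Fin m) k J.carrier} (h0 : ∀ i, B (.inl i) ∈ J.part 0)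
    (h1 : ∀ i, B (.inr i) ∈ J.part 1) :
    J.part 0 = Submodule.span k (Set.range fun i => B (.inl i)) ∧
    J.part 1 = Submodule.span k (Set.range fun i => B (.inr i)) := by
  have l0 : Submodule.span k (Set.range fun i => B (.inl i)) ≤ J.part 0 :=
    Submodule.span_le.2 (Set.range_subset_iff.2 h0)
  have l1 : Submodule.span k (Set.range fun i => B (.inr i)) ≤ J.part 1 :=
    Submodule.span_le.2 (Set.range_subset_iff.2 h1)
  have key : ∀ x : J.carrier, ∃ y ∈ Submodule.span k (Set.range fun i => B (.inl i)),
      ∃ z ∈ Submodule.span k (Set.range fun i => B (.inr i)), x = y + z := by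
    intro x
    refine ⟨∑ i, B.repr x (.inl i) • B (.inl i), Submodule.sum_mem _ fun i _ =>
      Submodule.smul_mem _ _ (Submodule.subset_span ⟨i, rfl⟩),
      ∑ i, B.repr x (.inr i) • B (.inr i), Submodule.sum_mem _ fun i _ =>
      Submodule.smul_mem _ _ (Submodule.subset_span ⟨i, rfl⟩), ?_⟩
    rw [← Fintype.sum_sum_type (fun i => B.repr x i • B i), B.sum_repr]
  have hd := Submodule.disjoint_def.1 J.isCompl.disjoint
  refine ⟨le_antisymm (fun x hx => ?_) l0, le_antisymm (fun x hx => ?_) l1⟩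
  · obtain ⟨y, hy, z, hz, rfl⟩ := key x
    have : z = 0 := hd z (by simpa using sub_mem hx (l0 hy)) (l1 hz)
    simpa [this] using hy
  · obtain ⟨y, hy, z, hz, rfl⟩ := key x
    have : y = 0 := hd y (l0 hy) (by simpa using sub_mem hx (l1 hz))
    simpa [this] using hz

lemma HasTable.hasType {J : Superalgebra.{u, v} k} {n m : ℕ} {ee eo oo}
    (h : J.HasTable n m ee eo oo) : J.HasType n m := by
  obtain ⟨E, O, B, ⟨hE, hO⟩, ⟨h0, h1⟩, -⟩ := h
  simp only [← hE, ← hO] at h0 h1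
  obtain ⟨e0, e1⟩ := part_eq_span h0 h1
  refine ⟨Module.Finite.of_basis B, ?_, ?_⟩
  · exact e0 ▸ (finrank_span_eq_card (B.linearIndependent.comp _ Sum.inl_injective)).trans
      (Fintype.card_fin _)
  · exact e1 ▸ (finrank_span_eq_card (B.linearIndependent.comp _ Sum.inr_injective)).trans
      (Fintype.card_fin _)

lemma HasTable.isomorphic {J : Superalgebra.{u, v} k} {S : Superalgebra.{u, w} k} {n m : ℕ}
    {ee eo oo} (h : J.HasTable n m ee eo oo) (h' : S.HasTable n m ee eo oo) :
    J.Isomorphic S := by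
  obtain ⟨E, O, B, ⟨hE, hO⟩, ⟨h0, h1⟩, a1, a2, a3, a4⟩ := h
  obtain ⟨E', O', B', ⟨hE', hO'⟩, ⟨h0', h1'⟩, b1, b2, b3, b4⟩ := h'
  have f0 : ∀ i, B.equiv B' (Equiv.refl _) (E i) = E' i := by
    intro i; rw [← hE, Basis.equiv_apply]; simp [hE']
  have f1 : ∀ i, B.equiv B' (Equiv.refl _) (O i) = O' i := by
    intro i; rw [← hO, Basis.equiv_apply]; simp [hO']
  obtain ⟨e0, e1⟩ := part_eq_span (J := J) (B := B) (by simpa [hE]) (by simpa [hO])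
  refine ⟨B.equiv B' (Equiv.refl _), fun x y => ?_, ?_⟩
  · generalize B.equiv B' (Equiv.refl _) = f at f0 f1
    have : J.mul.compr₂ f.toLinearMap = S.mul.compl₁₂ f.toLinearMap f.toLinearMap := by
      refine B.ext fun i => B.ext fun j => ?_
      rcases i with i | i <;> rcases j with j | j <;>
        simp [hE, hO, f0, f1, a1, a2, a3, a4, b1, b2, b3, b4]
    exact LinearMap.congr_fun₂ this x y
  · have hc : ∀ i : ZMod 2, i = 0 ∨ i = 1 := by decide
    generalize B.equiv B' (Equiv.refl _) = f at f0 f1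
    intro i
    rcases hc i with rfl | rfl
    · change J.part 0 ≤ (S.part 0).comap f.toLinearMap
      rw [e0, Submodule.span_le, Set.range_subset_iff]
      intro i
      simpa [hE, f0] using h0' i
    · change J.part 1 ≤ (S.part 1).comap f.toLinearMap
      rw [e1, Submodule.span_le, Set.range_subset_iff]
      intro i
      simpa [hO, f1] using h1' i

/-- A homogeneous basis may be given on any linear model `X` of the underlying space. -/
lemma hasTable_of_equiv {T : Superalgebra.{u, v} k} {X : Type*} [AddCommGroup X] [Module k X]
    (φ : X ≃ₗ[k] T.carrier) (μ : X → X → X) (hμ : ∀ x y, T.mul (φ x) (φ y) = φ (μ x y)) {n m : ℕ}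
    {ee : Fin n → Fin n → Fin n → k} {eo : Fin n → Fin m → Fin m → k}
    {oo : Fin m → Fin m → Fin n → k} (E : Fin n → X) (O : Fin m → X)
    (B : Basis (Fin n ⊕ Fin m) k X) (hE : ∀ i, B (.inl i) = E i) (hO : ∀ i, B (.inr i) = O i)
    (h0 : ∀ i, φ (E i) ∈ T.part 0) (h1 : ∀ i, φ (O i) ∈ T.part 1)
    (a1 : ∀ i j, μ (E i) (E j) = ∑ l, ee i j l • E l)
    (a2 : ∀ i j, μ (E i) (O j) = ∑ l, eo i j l • O l)
    (a3 : ∀ i j, μ (O j) (E i) = ∑ l, eo i j l • O l)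
    (a4 : ∀ i j, μ (O i) (O j) = ∑ l, oo i j l • E l) : T.HasTable n m ee eo oo :=
  ⟨fun i => φ (E i), fun i => φ (O i), B.map φ, ⟨by simp [hE], by simp [hO]⟩, ⟨h0, h1⟩,
    by simp [hμ, a1], by simp [hμ, a2], by simp [hμ, a3], by simp [hμ, a4]⟩

lemma tableMul_single {p q r : ℕ} (t : Fin p → Fin q → Fin r → k) (i : Fin p) (j : Fin q) :
    tableMul t (Pi.single i 1) (Pi.single j 1) = t i j := by
  simp [tableMul, Pi.single_apply, ite_smul]

lemma sum_smul_single {r : ℕ} (v : Fin r → k) : ∑ l, v l • (Pi.single l 1 : Fin r → k) = v := by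
  ext i; simp [Finset.sum_apply, Pi.single_apply]

/-- The space underlying `ofTable`, identified with the space of coordinate vectors. -/
def ofTableEquiv (n m : ℕ) (ee : Fin n → Fin n → Fin n → k)
    (eo : Fin n → Fin m → Fin m → k) (oo : Fin m → Fin m → Fin n → k) :
    ((Fin n → k) × (Fin m → k)) ≃ₗ[k] (ofTable n m ee eo oo).carrier where
  toFun x := x
  invFun x := x
  map_add' _ _ := rfl
  map_smul' _ _ := rfl
  left_inv _ := rfl
  right_inv _ := rfl

/-- The space underlying a direct sum, identified with the product of the two spaces. -/
def dsumEquiv (J : Superalgebra.{u, v} k) (S : Superalgebra.{u, w} k) :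
    (J.carrier × S.carrier) ≃ₗ[k] (J.dsum S).carrier where
  toFun x := x
  invFun x := x
  map_add' _ _ := rfl
  map_smul' _ _ := rfl
  left_inv _ := rfl
  right_inv _ := rfl

lemma hasTable_ofTable (n m : ℕ) (ee : Fin n → Fin n → Fin n → k)
    (eo : Fin n → Fin m → Fin m → k) (oo : Fin m → Fin m → Fin n → k) :
    (ofTable n m ee eo oo).HasTable n m ee eo oo := by
  have s0 : ∀ v : Fin n → k,
      ∑ l, v l • ((Pi.single l 1, 0) : (Fin n → k) × (Fin m → k)) = (v, 0) := by
    intro v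
    conv_rhs => rw [← sum_smul_single v]
    ext <;> simp [Prod.fst_sum, Prod.snd_sum]
  have s1 : ∀ v : Fin m → k,
      ∑ l, v l • ((0, Pi.single l 1) : (Fin n → k) × (Fin m → k)) = (0, v) := by
    intro v
    conv_rhs => rw [← sum_smul_single v]
    ext <;> simp [Prod.fst_sum, Prod.snd_sum]
  refine hasTable_of_equiv (ofTableEquiv n m ee eo oo)
    (fun x y => (tableMul ee x.1 y.1 + tableMul oo x.2 y.2,
      tableMul eo x.1 y.2 + tableMul eo y.1 x.2))
    (fun x y => rfl)
    (fun i => (Pi.single i 1, 0)) (fun i => (0, Pi.single i 1))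
    ((Pi.basisFun k (Fin n)).prod (Pi.basisFun k (Fin m))) ?_ ?_
    (fun i => show (Pi.single i 1, 0) ∈ LinearMap.ker (LinearMap.snd k (Fin n → k) (Fin m → k))
      from rfl)
    (fun i => show (0, Pi.single i 1) ∈ LinearMap.ker (LinearMap.fst k (Fin n → k) (Fin m → k))
      from rfl) ?_ ?_ ?_ ?_
  · intro i; ext <;> simp
  · intro i; ext <;> simp
  · intro i j; rw [s0]; simp [tableMul_single]
  · intro i j; rw [s1]; simp [tableMul_single]
  · intro i j; rw [s1]; simp [tableMul_single]
  · intro i j; rw [s0]; simp [tableMul_single]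

/-- The block-diagonal sum of two arrays of structure constants. -/
def blockTable {p q r p' q' r' : ℕ} (t : Fin p → Fin q → Fin r → k)
    (t' : Fin p' → Fin q' → Fin r' → k) :
    Fin (p + p') → Fin (q + q') → Fin (r + r') → k :=
  fun i j => Fin.addCases
    (fun i => Fin.addCases (fun j => Fin.append (t i j) 0) (fun _ => 0) j)
    (fun i => Fin.addCases (fun _ => 0) (fun j => Fin.append 0 (t' i j)) j) i

lemma HasTable.dsum {J : Superalgebra.{u, v} k} {S : Superalgebra.{u, w} k} {n m n' m' : ℕ}
    {ee eo oo ee' eo' oo'} (h : J.HasTable n m ee eo oo) (h' : S.HasTable n' m' ee' eo' oo') :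
    (J.dsum S).HasTable (n + n') (m + m') (blockTable ee ee') (blockTable eo eo')
      (blockTable oo oo') := by
  obtain ⟨E, O, B, ⟨hE, hO⟩, ⟨h0, h1⟩, a1, a2, a3, a4⟩ := h
  obtain ⟨E', O', B', ⟨hE', hO'⟩, ⟨h0', h1'⟩, b1, b2, b3, b4⟩ := h'
  have fs : ∀ {r : ℕ} (f : Fin r → J.carrier × S.carrier),
      ∑ i, f i = (∑ i, (f i).1, ∑ i, (f i).2) := by
    intro r f; ext <;> simp [Prod.fst_sum, Prod.snd_sum]
  refine hasTable_of_equiv (dsumEquiv J S)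
    (fun x y => (J.mul x.1 y.1, S.mul x.2 y.2)) (fun x y => rfl)
    (Fin.addCases (fun i => (E i, 0)) (fun i => (0, E' i)))
    (Fin.addCases (fun i => (O i, 0)) (fun i => (0, O' i)))
    ((B.prod B').reindex ((Equiv.sumSumSumComm _ _ _ _).trans
      (Equiv.sumCongr finSumFinEquiv finSumFinEquiv))) ?_ ?_ ?_ ?_ ?_ ?_ ?_ ?_
  · refine Fin.addCases (fun i => ?_) (fun i => ?_) <;> ext <;>
      simp [hE, hE', Basis.reindex_apply]
  · refine Fin.addCases (fun i => ?_) (fun i => ?_) <;> ext <;>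
      simp [hO, hO', Basis.reindex_apply]
  · refine Fin.addCases (fun i => ?_) (fun i => ?_)
    · rw [Fin.addCases_left]; exact ⟨h0 i, zero_mem _⟩
    · rw [Fin.addCases_right]; exact ⟨zero_mem _, h0' i⟩
  · refine Fin.addCases (fun i => ?_) (fun i => ?_)
    · rw [Fin.addCases_left]; exact ⟨h1 i, zero_mem _⟩
    · rw [Fin.addCases_right]; exact ⟨zero_mem _, h1' i⟩
  all_goals
    refine Fin.addCases (fun i => ?_) (fun i => ?_) <;>
    refine Fin.addCases (fun j => ?_) (fun j => ?_) <;>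
    rw [fs] <;>
    simp [blockTable, Fin.sum_univ_add, a1, a2, a3, a4, b1, b2, b3, b4]

end Superalgebra

/-! ### Criteria for the Jordan superalgebra identities -/

namespace Superalgebra

variable {k : Type u} [Field k]

lemma mem_part_zero_ofTable {n m : ℕ} {ee : Fin n → Fin n → Fin n → k}
    {eo : Fin n → Fin m → Fin m → k} {oo : Fin m → Fin m → Fin n → k}
    {a : (ofTable n m ee eo oo).carrier} (h : a ∈ (ofTable n m ee eo oo).part 0) :
    ∃ x, a = ofTableEquiv n m ee eo oo (x, 0) :=
  ⟨Prod.fst a, Prod.ext rfl h⟩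

lemma mem_part_one_ofTable {n m : ℕ} {ee : Fin n → Fin n → Fin n → k}
    {eo : Fin n → Fin m → Fin m → k} {oo : Fin m → Fin m → Fin n → k}
    {a : (ofTable n m ee eo oo).carrier} (h : a ∈ (ofTable n m ee eo oo).part 1) :
    ∃ x, a = ofTableEquiv n m ee eo oo (0, x) :=
  ⟨Prod.snd a, Prod.ext h rfl⟩

lemma ofTable_mul {n m : ℕ} {ee : Fin n → Fin n → Fin n → k}
    {eo : Fin n → Fin m → Fin m → k} {oo : Fin m → Fin m → Fin n → k} (x y) :
    (ofTable n m ee eo oo).mul (ofTableEquiv n m ee eo oo x) (ofTableEquiv n m ee eo oo y) =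
    ofTableEquiv n m ee eo oo (tableMul ee x.1 y.1 + tableMul oo x.2 y.2,
      tableMul eo x.1 y.2 + tableMul eo y.1 x.2) := rfl

/-- A superalgebra in which odd elements multiply to zero is a Jordan superalgebra if its even part
is a Jordan algebra that acts on the odd part so that the linearized Jordan identity holds with one
odd argument. By the symmetry of that identity there are only two such conditions, according to
whether the odd argument is the distinguished one. -/
lemma isJordan_of_odd_mul_odd_eq_zero {J : Superalgebra.{u, v} k} {V W : Type*} [AddCommGroup V]
    [Module k V] [AddCommGroup W] [Module k W] (ι₀ : V →ₗ[k] J.carrier) (ι₁ : W →ₗ[k] J.carrier)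
    (h0 : ∀ a ∈ J.part 0, ∃ x, a = ι₀ x) (h1 : ∀ a ∈ J.part 1, ∃ x, a = ι₁ x)
    (A : V →ₗ[k] V →ₗ[k] V) (L : V →ₗ[k] W →ₗ[k] W)
    (m00 : ∀ x y, J.mul (ι₀ x) (ι₀ y) = ι₀ (A x y))
    (m01 : ∀ x y, J.mul (ι₀ x) (ι₁ y) = ι₁ (L x y))
    (m10 : ∀ x y, J.mul (ι₁ y) (ι₀ x) = ι₁ (L x y))
    (m11 : ∀ x y, J.mul (ι₁ x) (ι₁ y) = 0)
    (hA : IsJordanProduct A)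
    (eeeo : ∀ a b c d, L (A a b) (L c d) + L (A a c) (L b d) + L (A b c) (L a d) =
      L (A (A a b) c) d + L b (L c (L a d)) + L a (L c (L b d)))
    (eeoe : ∀ a b c d, L (A a b) (L d c) + L (A b d) (L a c) + L (A a d) (L b c) =
      L d (L (A a b) c) + L b (L (A a d) c) + L a (L (A b d) c)) : J.IsJordan := by
  have hc : ∀ i : ZMod 2, i = 0 ∨ i = 1 := by decide
  constructor
  · intro i j a ha b hb
    rcases hc i with rfl | rfl <;> rcases hc j with rfl | rfl <;>
    (first | obtain ⟨a, rfl⟩ := h0 _ ha | obtain ⟨a, rfl⟩ := h1 _ ha) <;>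
    (first | obtain ⟨b, rfl⟩ := h0 _ hb | obtain ⟨b, rfl⟩ := h1 _ hb) <;>
    simp [m00, m01, m10, m11]
    rw [hA.comm]
  · intro i j l r a ha b hb c hc' d hd
    have e1 := fun a b c d => congrArg ι₁ (eeeo a b c d)
    have e2 := fun a b c d => congrArg ι₁ (eeoe a b c d)
    have e0 := fun a b c d => congrArg ι₀ (hA.linearized a b c d)
    simp only [map_add] at e0 e1 e2
    rcases hc i with rfl | rfl <;> rcases hc j with rfl | rfl <;>
    rcases hc l with rfl | rfl <;> rcases hc r with rfl | rfl <;>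
    (first | obtain ⟨a, rfl⟩ := h0 _ ha | obtain ⟨a, rfl⟩ := h1 _ ha) <;>
    (first | obtain ⟨b, rfl⟩ := h0 _ hb | obtain ⟨b, rfl⟩ := h1 _ hb) <;>
    (first | obtain ⟨c, rfl⟩ := h0 _ hc' | obtain ⟨c, rfl⟩ := h1 _ hc') <;>
    (first | obtain ⟨d, rfl⟩ := h0 _ hd | obtain ⟨d, rfl⟩ := h1 _ hd) <;>
    simp only [m00, m01, m10, m11, map_zero, LinearMap.zero_apply, ZMod.val_zero, mul_zero,
      zero_mul, add_zero, zero_add, pow_zero, one_smul, smul_zero]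
    · exact e0 a b c d
    · exact e1 a b c d
    · exact e2 a b c d
    · rw [hA.comm c d]
      linear_combination (norm := module) e1 a d c b
    · rw [hA.comm c d]
      linear_combination (norm := module) e1 b d c a
  · intro a ha b hb
    obtain ⟨a, rfl⟩ := h0 _ ha
    obtain ⟨b, rfl⟩ := h0 _ hb
    simp only [m00, hA.jordan]

set_option maxHeartbeats 1000000 in
/-- A criterion for superalgebras of type `(1, 2)` in coordinates: `e² = α e`, the product of the
odd basis vectors `o₁`, `o₂` is `ω e`, and the action of `e` is given by `e o₁ = p o₁ + ν o₂` and
`e o₂ = p o₂`. -/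
lemma isJordan_of_coordinates {J : Superalgebra.{u, v} k} (h2 : (2 : k) ≠ 0)
    (φ : k × k × k →ₗ[k] J.carrier) (α p ν ω : k)
    (h0 : ∀ a ∈ J.part 0, ∃ x, a = φ (x, 0, 0)) (h1 : ∀ a ∈ J.part 1, ∃ x y, a = φ (0, x, y))
    (hm : ∀ x y, J.mul (φ x) (φ y) = φ (α * x.1 * y.1 + ω * (x.2.1 * y.2.2 - x.2.2 * y.2.1),
      p * (x.1 * y.2.1 + y.1 * x.2.1),
      ν * (x.1 * y.2.1 + y.1 * x.2.1) + p * (x.1 * y.2.2 + y.1 * x.2.2)))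
    (h : (α = 0 ∧ p = 0) ∨ (α = 1 ∧ ν = 0 ∧ (p = 1 ∨ p = 1 / 2))) :
    J.IsJordan := by
  have hc : ∀ i : ZMod 2, i = 0 ∨ i = 1 := by decide
  constructor
  · intro i j a ha b hb
    rcases hc i with rfl | rfl <;> rcases hc j with rfl | rfl <;>
    (first | obtain ⟨a, rfl⟩ := h0 _ ha | obtain ⟨a, a', rfl⟩ := h1 _ ha) <;>
    (first | obtain ⟨b, rfl⟩ := h0 _ hb | obtain ⟨b, b', rfl⟩ := h1 _ hb) <;>
    rw [hm, hm, ← map_smul] <;> refine congrArg φ (Prod.ext ?_ (Prod.ext ?_ ?_)) <;>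
    simp [ZMod.val_one] <;> ring
  · intro i j l r a ha b hb c hc' d hd
    have hv : (1 : ZMod 2).val = 1 := rfl
    rcases hc i with rfl | rfl <;> rcases hc j with rfl | rfl <;>
    rcases hc l with rfl | rfl <;> rcases hc r with rfl | rfl <;>
    (first | obtain ⟨a, rfl⟩ := h0 _ ha | obtain ⟨a, a', rfl⟩ := h1 _ ha) <;>
    (first | obtain ⟨b, rfl⟩ := h0 _ hb | obtain ⟨b, b', rfl⟩ := h1 _ hb) <;>
    (first | obtain ⟨c, rfl⟩ := h0 _ hc' | obtain ⟨c, c', rfl⟩ := h1 _ hc') <;>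
    (first | obtain ⟨d, rfl⟩ := h0 _ hd | obtain ⟨d, d', rfl⟩ := h1 _ hd) <;>
    simp only [hm, ← map_smul, ← map_add] <;>
    refine congrArg φ (Prod.ext ?_ (Prod.ext ?_ ?_)) <;>
    simp only [ZMod.val_zero, hv, mul_zero, zero_mul, add_zero, zero_add, sub_zero, mul_one,
      pow_zero, pow_one, one_smul, Prod.smul_mk, Prod.mk_add_mk, smul_eq_mul]
    all_goals
      rcases h with ⟨rfl, rfl⟩ | ⟨rfl, rfl, rfl | rfl⟩
      · ring1
      · ring1
      · first | ring1 | (field_simp; ring1)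
  · intro a ha b hb
    obtain ⟨a, rfl⟩ := h0 _ ha
    obtain ⟨b, rfl⟩ := h0 _ hb
    rw [hm, hm, hm, hm, hm]
    refine congrArg φ (Prod.ext ?_ (Prod.ext ?_ ?_))
    · simp; ring
    · simp
    · simp

end Superalgebra

/-! ### The listed superalgebras are Jordan superalgebras -/

namespace Superalgebra

variable {k : Type u} [Field k]

lemma IsJordan.dsum {J : Superalgebra.{u, v} k} {S : Superalgebra.{u, w} k} (hJ : J.IsJordan)
    (hS : S.IsJordan) : (J.dsum S).IsJordan where
  super_comm i j a ha b hb :=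
    Prod.ext (hJ.super_comm i j a.1 ha.1 b.1 hb.1) (hS.super_comm i j a.2 ha.2 b.2 hb.2)
  super_jordan i j l r a ha b hb c hc d hd :=
    Prod.ext (hJ.super_jordan i j l r a.1 ha.1 b.1 hb.1 c.1 hc.1 d.1 hd.1)
      (hS.super_jordan i j l r a.2 ha.2 b.2 hb.2 c.2 hc.2 d.2 hd.2)
  even_jordan a ha b hb :=
    Prod.ext (hJ.even_jordan a.1 ha.1 b.1 hb.1) (hS.even_jordan a.2 ha.2 b.2 hb.2)

/-- To check that a table defines a Jordan product, the product may be replaced by a formula `f` for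
its coordinates. -/
lemma isJordanProduct_tableMul {n : ℕ} {ee : Fin n → Fin n → Fin n → k}
    (f : (Fin n → k) → (Fin n → k) → Fin n → k) (hf : ∀ x y, tableMul ee x y = f x y)
    (comm : ∀ a b, f a b = f b a) (jordan : ∀ a b, f (f a a) (f b a) = f (f (f a a) b) a)
    (linearized : ∀ a b c d, f (f a b) (f c d) + f (f a c) (f b d) + f (f a d) (f b c)
      = f (f (f a b) c) d + f (f (f a d) c) b + f (f (f b d) c) a) :
    IsJordanProduct (tableMul ee) := by
  constructor <;> intros <;> simp only [hf]
  · apply comm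
  · apply jordan
  · apply linearized

/-- The case of `isJordan_of_odd_mul_odd_eq_zero` for an algebra given by a table. -/
lemma isJordan_ofTable_of_oo_eq_zero {n m : ℕ} {ee : Fin n → Fin n → Fin n → k}
    {eo : Fin n → Fin m → Fin m → k} (hA : IsJordanProduct (tableMul ee))
    (eeeo : ∀ a b c d, tableMul eo (tableMul ee a b) (tableMul eo c d)
      + tableMul eo (tableMul ee a c) (tableMul eo b d)
      + tableMul eo (tableMul ee b c) (tableMul eo a d) =
      tableMul eo (tableMul ee (tableMul ee a b) c) d
      + tableMul eo b (tableMul eo c (tableMul eo a d))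
      + tableMul eo a (tableMul eo c (tableMul eo b d)))
    (eeoe : ∀ a b c d, tableMul eo (tableMul ee a b) (tableMul eo d c)
      + tableMul eo (tableMul ee b d) (tableMul eo a c)
      + tableMul eo (tableMul ee a d) (tableMul eo b c) =
      tableMul eo d (tableMul eo (tableMul ee a b) c)
      + tableMul eo b (tableMul eo (tableMul ee a d) c)
      + tableMul eo a (tableMul eo (tableMul ee b d) c)) :
    (ofTable n m ee eo 0).IsJordan := by
  have z : ∀ x y, tableMul (0 : Fin m → Fin m → Fin n → k) x y = 0 := by
    intro x y; simp [tableMul]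
  refine isJordan_of_odd_mul_odd_eq_zero
    ((ofTableEquiv n m ee eo 0).toLinearMap ∘ₗ LinearMap.inl k _ _)
    ((ofTableEquiv n m ee eo 0).toLinearMap ∘ₗ LinearMap.inr k _ _)
    (fun _ h => mem_part_zero_ofTable h) (fun _ h => mem_part_one_ofTable h)
    (tableMul ee) (tableMul eo) ?_ ?_ ?_ ?_ hA eeeo eeoe
  all_goals
    intro x y
    simp only [LinearMap.comp_apply, LinearEquiv.coe_coe, ofTable_mul, LinearMap.inl_apply,
      LinearMap.inr_apply, map_zero, LinearMap.zero_apply, add_zero, zero_add, z]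
  exact map_zero _

lemma isJordan_evenTable {n : ℕ} {ee : Fin n → Fin n → Fin n → k}
    (hA : IsJordanProduct (tableMul ee)) : (evenTable n ee).IsJordan :=
  isJordan_ofTable_of_oo_eq_zero hA (fun _ _ _ _ => Subsingleton.elim _ _)
    (fun _ _ _ _ => Subsingleton.elim _ _)

lemma tableMul_one {q r : ℕ} (t : Fin 1 → Fin q → Fin r → k) (x y) :
    tableMul t x y = x 0 • ∑ j, y j • t 0 j := by
  simp [tableMul, Finset.smul_sum, smul_smul]

lemma tableMul_two (t : Fin 2 → Fin 2 → Fin 2 → k) (x y) :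
    tableMul t x y = (x 0 * y 0) • t 0 0 + (x 0 * y 1) • t 0 1 +
      ((x 1 * y 0) • t 1 0 + (x 1 * y 1) • t 1 1) := by
  simp [tableMul]

lemma tableMul_two_one (t : Fin 2 → Fin 1 → Fin 1 → k) (x y) :
    tableMul t x y = (x 0 * y 0) • t 0 0 + (x 1 * y 0) • t 1 0 := by
  simp [tableMul]

lemma tableMul_three (t : Fin 3 → Fin 3 → Fin 3 → k) (x y) :
    tableMul t x y = (x 0 * y 0) • t 0 0 + (x 0 * y 1) • t 0 1 + (x 0 * y 2) • t 0 2 +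
      ((x 1 * y 0) • t 1 0 + (x 1 * y 1) • t 1 1 + (x 1 * y 2) • t 1 2) +
      ((x 2 * y 0) • t 2 0 + (x 2 * y 1) • t 2 1 + (x 2 * y 2) • t 2 2) := by
  simp [tableMul, Fin.sum_univ_three]

end Superalgebra

namespace JordanList

set_option linter.unusedSimpArgs false
set_option linter.unnecessarySeqFocus false

open Superalgebra

variable {k : Type u} [Field k]

lemma isJordanProduct_U1 :
    IsJordanProduct (tableMul (![![bv 0]] : Fin 1 → Fin 1 → Fin 1 → k)) := by
  refine isJordanProduct_tableMul (fun x y => ![x 0 * y 0]) ?_ ?_ ?_ ?_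
  · intro x y
    ext l
    fin_cases l <;> simp [tableMul_one, bv]
  all_goals
    intros
    ext l
    fin_cases l <;> simp only [Fin.zero_eta, Fin.mk_one, Fin.reduceFinMk, Matrix.cons_val,
      Pi.add_apply] <;> ring

lemma isJordan_U1 : (U1 k).IsJordan :=
  isJordan_evenTable isJordanProduct_U1

lemma isJordanProduct_U2 :
    IsJordanProduct (tableMul (![![0]] : Fin 1 → Fin 1 → Fin 1 → k)) := by
  refine isJordanProduct_tableMul (fun x y => ![0]) ?_ ?_ ?_ ?_
  · intro x y
    ext l
    fin_cases l <;> simp [tableMul_one, bv]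
  all_goals
    intros
    ext l
    fin_cases l <;> simp only [Fin.zero_eta, Fin.mk_one, Fin.reduceFinMk, Matrix.cons_val,
      Pi.add_apply]

lemma isJordan_U2 : (U2 k).IsJordan :=
  isJordan_evenTable isJordanProduct_U2

lemma isJordanProduct_B1 :
    IsJordanProduct (tableMul (![![bv 0, bv 1], ![bv 1, 0]] : Fin 2 → Fin 2 → Fin 2 → k)) := by
  refine isJordanProduct_tableMul (fun x y => ![x 0 * y 0, x 0 * y 1 + x 1 * y 0]) ?_ ?_ ?_ ?_
  · intro x y
    ext l
    fin_cases l <;> simp [tableMul_two, bv]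
  all_goals
    intros
    ext l
    fin_cases l <;> simp only [Fin.zero_eta, Fin.mk_one, Fin.reduceFinMk, Matrix.cons_val,
      Pi.add_apply] <;> ring

lemma isJordan_B1 : (B1 k).IsJordan :=
  isJordan_evenTable isJordanProduct_B1

lemma isJordanProduct_B2 (h2 : (2 : k) ≠ 0) :
    IsJordanProduct (tableMul (![![bv 0, (1 / 2 : k) • bv 1], ![(1 / 2 : k) • bv 1, 0]]
      : Fin 2 → Fin 2 → Fin 2 → k)) := by
  refine isJordanProduct_tableMul
    (fun x y => ![x 0 * y 0, (1 / 2) * (x 0 * y 1 + x 1 * y 0)]) ?_ ?_ ?_ ?_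
  · intro x y
    ext l
    fin_cases l <;> simp [tableMul_two, bv] <;> ring
  all_goals
    intros
    ext l
    fin_cases l <;> simp only [Fin.zero_eta, Fin.mk_one, Fin.reduceFinMk, Matrix.cons_val,
      Pi.add_apply] <;> field_simp <;> ring

lemma isJordan_B2 (h2 : (2 : k) ≠ 0) : (B2 k).IsJordan :=
  isJordan_evenTable (isJordanProduct_B2 h2)

lemma isJordanProduct_B3 :
    IsJordanProduct (tableMul (![![bv 1, 0], ![0, 0]] : Fin 2 → Fin 2 → Fin 2 → k)) := by
  refine isJordanProduct_tableMul (fun x y => ![0, x 0 * y 0]) ?_ ?_ ?_ ?_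
  · intro x y
    ext l
    fin_cases l <;> simp [tableMul_two, bv]
  all_goals
    intros
    ext l
    fin_cases l <;> simp only [Fin.zero_eta, Fin.mk_one, Fin.reduceFinMk, Matrix.cons_val,
      Pi.add_apply] <;> ring

lemma isJordan_B3 : (B3 k).IsJordan :=
  isJordan_evenTable isJordanProduct_B3

lemma isJordanProduct_D :
    IsJordanProduct (tableMul (![![bv 0, 0], ![0, bv 1]] : Fin 2 → Fin 2 → Fin 2 → k)) := by
  refine isJordanProduct_tableMul (fun x y => ![x 0 * y 0, x 1 * y 1]) ?_ ?_ ?_ ?_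
  · intro x y
    ext l
    fin_cases l <;> simp [tableMul_two, bv]
  all_goals
    intros
    ext l
    fin_cases l <;> simp only [Fin.zero_eta, Fin.mk_one, Fin.reduceFinMk, Matrix.cons_val,
      Pi.add_apply] <;> ring

lemma isJordan_T1 : (T1 k).IsJordan := by
  refine isJordan_evenTable ?_
  refine isJordanProduct_tableMul
    (fun x y => ![x 0 * y 0, x 0 * y 1 + x 1 * y 0, x 0 * y 2 + x 2 * y 0 + x 1 * y 1]) ?_ ?_ ?_ ?_
  · intro x y
    ext l
    fin_cases l <;> simp [tableMul_three, bv] <;> ring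
  all_goals
    intros
    ext l
    fin_cases l <;> simp only [Fin.zero_eta, Fin.mk_one, Fin.reduceFinMk, Matrix.cons_val,
      Pi.add_apply] <;> ring

lemma isJordan_T2 : (T2 k).IsJordan := by
  refine isJordan_evenTable ?_
  refine isJordanProduct_tableMul
    (fun x y => ![x 0 * y 0, x 0 * y 1 + x 1 * y 0, x 0 * y 2 + x 2 * y 0]) ?_ ?_ ?_ ?_
  · intro x y
    ext l
    fin_cases l <;> simp [tableMul_three, bv]
  all_goals
    intros
    ext l
    fin_cases l <;> simp only [Fin.zero_eta, Fin.mk_one, Fin.reduceFinMk, Matrix.cons_val,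
      Pi.add_apply] <;> ring

lemma isJordan_T3 : (T3 k).IsJordan := by
  refine isJordan_evenTable ?_
  refine isJordanProduct_tableMul (fun x y => ![0, x 0 * y 0, x 0 * y 1 + x 1 * y 0]) ?_ ?_ ?_ ?_
  · intro x y
    ext l
    fin_cases l <;> simp [tableMul_three, bv]
  all_goals
    intros
    ext l
    fin_cases l <;> simp only [Fin.zero_eta, Fin.mk_one, Fin.reduceFinMk, Matrix.cons_val,
      Pi.add_apply] <;> ring

lemma isJordan_T4 : (T4 k).IsJordan := by
  refine isJordan_evenTable ?_
  refine isJordanProduct_tableMul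
    (fun x y => ![0, x 0 * y 0 + x 0 * y 2 + x 2 * y 0, 0]) ?_ ?_ ?_ ?_
  · intro x y
    ext l
    fin_cases l <;> simp [tableMul_three, bv]
  all_goals
    intros
    ext l
    fin_cases l <;> simp only [Fin.zero_eta, Fin.mk_one, Fin.reduceFinMk, Matrix.cons_val,
      Pi.add_apply] <;> ring

lemma isJordan_T5 (h2 : (2 : k) ≠ 0) : (T5 k).IsJordan := by
  refine isJordan_evenTable ?_
  refine isJordanProduct_tableMul (fun x y =>
    ![x 0 * y 0 + x 2 * y 2,
      x 1 * y 1 + x 2 * y 2,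
      (1 / 2) * (x 0 * y 2 + x 2 * y 0 + x 1 * y 2 + x 2 * y 1)])
    ?_ ?_ ?_ ?_
  · intro x y
    ext l
    fin_cases l <;> simp [tableMul_three, bv] <;> ring
  all_goals
    intros
    ext l
    fin_cases l <;> simp only [Fin.zero_eta, Fin.mk_one, Fin.reduceFinMk, Matrix.cons_val,
      Pi.add_apply] <;> field_simp <;> ring

lemma isJordan_T6 (h2 : (2 : k) ≠ 0) : (T6 k).IsJordan := by
  refine isJordan_evenTable ?_
  refine isJordanProduct_tableMul
    (fun x y => ![x 0 * y 0, (1 / 2) * (x 0 * y 1 + x 1 * y 0), x 0 * y 2 + x 2 * y 0]) ?_ ?_ ?_ ?_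
  · intro x y
    ext l
    fin_cases l <;> simp [tableMul_three, bv] <;> ring
  all_goals
    intros
    ext l
    fin_cases l <;> simp only [Fin.zero_eta, Fin.mk_one, Fin.reduceFinMk, Matrix.cons_val,
      Pi.add_apply] <;> field_simp <;> ring

lemma isJordan_T7 (h2 : (2 : k) ≠ 0) : (T7 k).IsJordan := by
  refine isJordan_evenTable ?_
  refine isJordanProduct_tableMul (fun x y =>
    ![x 0 * y 0,
      (1 / 2) * (x 0 * y 1 + x 1 * y 0),
      (1 / 2) * (x 0 * y 2 + x 2 * y 0)])
    ?_ ?_ ?_ ?_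
  · intro x y
    ext l
    fin_cases l <;> simp [tableMul_three, bv] <;> ring
  all_goals
    intros
    ext l
    fin_cases l <;> simp only [Fin.zero_eta, Fin.mk_one, Fin.reduceFinMk, Matrix.cons_val,
      Pi.add_apply] <;> field_simp <;> ring

lemma isJordan_T8 (h2 : (2 : k) ≠ 0) : (T8 k).IsJordan := by
  refine isJordan_evenTable ?_
  refine isJordanProduct_tableMul
    (fun x y => ![x 0 * y 0, (1 / 2) * (x 0 * y 1 + x 1 * y 0), x 1 * y 1]) ?_ ?_ ?_ ?_
  · intro x y
    ext l
    fin_cases l <;> simp [tableMul_three, bv] <;> ring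
  all_goals
    intros
    ext l
    fin_cases l <;> simp only [Fin.zero_eta, Fin.mk_one, Fin.reduceFinMk, Matrix.cons_val,
      Pi.add_apply] <;> field_simp <;> ring

lemma isJordan_T9 (h2 : (2 : k) ≠ 0) : (T9 k).IsJordan := by
  refine isJordan_evenTable ?_
  refine isJordanProduct_tableMul (fun x y =>
    ![x 0 * y 0,
      (1 / 2) * (x 0 * y 1 + x 1 * y 0),
      x 0 * y 2 + x 2 * y 0 + x 1 * y 1])
    ?_ ?_ ?_ ?_
  · intro x y
    ext l
    fin_cases l <;> simp [tableMul_three, bv] <;> ring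
  all_goals
    intros
    ext l
    fin_cases l <;> simp only [Fin.zero_eta, Fin.mk_one, Fin.reduceFinMk, Matrix.cons_val,
      Pi.add_apply] <;> field_simp <;> ring

lemma isJordan_T10 (h2 : (2 : k) ≠ 0) : (T10 k).IsJordan := by
  refine isJordan_evenTable ?_
  refine isJordanProduct_tableMul (fun x y =>
    ![x 0 * y 0,
      x 1 * y 1,
      (1 / 2) * (x 0 * y 2 + x 2 * y 0 + x 1 * y 2 + x 2 * y 1)])
    ?_ ?_ ?_ ?_
  · intro x y
    ext l
    fin_cases l <;> simp [tableMul_three, bv] <;> ring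
  all_goals
    intros
    ext l
    fin_cases l <;> simp only [Fin.zero_eta, Fin.mk_one, Fin.reduceFinMk, Matrix.cons_val,
      Pi.add_apply] <;> field_simp <;> ring

lemma isJordan_S1_1 : (S1_1 k).IsJordan := by
  refine isJordan_ofTable_of_oo_eq_zero ⟨?_, ?_, ?_⟩ ?_ ?_ <;> intros <;> simp [tableMul]

lemma isJordan_zero : (ofTable (k := k) 0 0 0 0 0).IsJordan := by
  refine isJordan_ofTable_of_oo_eq_zero ⟨?_, ?_, ?_⟩ ?_ ?_ <;> intros <;> simp [tableMul]

lemma isJordan_S2_1 (h2 : (2 : k) ≠ 0) : (S2_1 k).IsJordan := by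
  refine isJordan_ofTable_of_oo_eq_zero isJordanProduct_U1 ?_ ?_ <;> intros <;> ext l <;>
    fin_cases l <;> simp [tableMul_one, bv]
  all_goals first
    | ring1
    | (field_simp; ring1)

lemma isJordan_S2_2 : (S2_2 k).IsJordan := by
  refine isJordan_ofTable_of_oo_eq_zero isJordanProduct_U1 ?_ ?_ <;> intros <;> ext l <;>
    fin_cases l <;> simp [tableMul_one, bv]
  all_goals ring

lemma isJordan_S3_4 (h2 : (2 : k) ≠ 0) : (S3_4 k).IsJordan := by
  refine isJordan_ofTable_of_oo_eq_zero isJordanProduct_U1 ?_ ?_ <;> intros <;> ext l <;>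
    fin_cases l <;> simp [tableMul_one, Fin.sum_univ_two, bv]
  all_goals first
    | ring1
    | (field_simp; ring1)

lemma isJordan_S3_9 (h2 : (2 : k) ≠ 0) : (S3_9 k).IsJordan := by
  refine isJordan_ofTable_of_oo_eq_zero isJordanProduct_B1 ?_ ?_ <;> intros <;> ext l <;>
    fin_cases l <;> simp [tableMul_two, tableMul_two_one, bv]
  all_goals first
    | ring1
    | (field_simp; ring1)

lemma isJordan_S3_10 : (S3_10 k).IsJordan := by
  refine isJordan_ofTable_of_oo_eq_zero isJordanProduct_B1 ?_ ?_ <;> intros <;> ext l <;>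
    fin_cases l <;> simp [tableMul_two, tableMul_two_one, bv]
  all_goals ring

lemma isJordan_S3_11 (h2 : (2 : k) ≠ 0) : (S3_11 k).IsJordan := by
  refine isJordan_ofTable_of_oo_eq_zero (isJordanProduct_B2 h2) ?_ ?_ <;> intros <;> ext l <;>
    fin_cases l <;> simp [tableMul_two, tableMul_two_one, bv]
  all_goals first
    | ring1
    | (field_simp; ring1)

lemma isJordan_S3_12 (h2 : (2 : k) ≠ 0) : (S3_12 k).IsJordan := by
  refine isJordan_ofTable_of_oo_eq_zero (isJordanProduct_B2 h2) ?_ ?_ <;> intros <;> ext l <;>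
    fin_cases l <;> simp [tableMul_two, tableMul_two_one, bv]
  all_goals ring

lemma isJordan_S3_13 (h2 : (2 : k) ≠ 0) : (S3_13 k).IsJordan := by
  refine isJordan_ofTable_of_oo_eq_zero isJordanProduct_D ?_ ?_ <;> intros <;> ext l <;>
    fin_cases l <;> simp [tableMul_two, tableMul_two_one, bv]
  all_goals first
    | ring1
    | (field_simp; ring1)

/-- `isJordan_of_coordinates` for an algebra given by a table. -/
lemma isJordan_of_table_one_two (h2 : (2 : k) ≠ 0) (α p ν ω : k)
    {ee : Fin 1 → Fin 1 → Fin 1 → k} {eo : Fin 1 → Fin 2 → Fin 2 → k}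
    {oo : Fin 2 → Fin 2 → Fin 1 → k}
    (h : (α = 0 ∧ p = 0) ∨ (α = 1 ∧ ν = 0 ∧ (p = 1 ∨ p = 1 / 2)))
    (hee : ee = ![![α • bv 0]]) (heo : eo = ![![p • bv 0 + ν • bv 1, p • bv 1]])
    (hoo : oo = ![![0, ω • bv 0], ![-(ω • bv 0), 0]]) :
    (ofTable 1 2 ee eo oo).IsJordan := by
  refine isJordan_of_coordinates h2 ((ofTableEquiv 1 2 ee eo oo).toLinearMap ∘ₗ
    { toFun := fun x => (![x.1], ![x.2.1, x.2.2])
      map_add' := by intros; simp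
      map_smul' := by intros; simp }) α p ν ω ?_ ?_ ?_ h
  · intro a ha
    obtain ⟨x, rfl⟩ := mem_part_zero_ofTable ha
    have hx : ((x, 0) : (Fin 1 → k) × (Fin 2 → k)) = (![x 0], ![0, 0]) := by
      ext i <;> fin_cases i <;> rfl
    exact ⟨x 0, congrArg (ofTableEquiv 1 2 ee eo oo) hx⟩
  · intro a ha
    obtain ⟨x, rfl⟩ := mem_part_one_ofTable ha
    have hx : ((0, x) : (Fin 1 → k) × (Fin 2 → k)) = (![0], ![x 0, x 1]) := by
      ext i <;> fin_cases i <;> rfl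
    exact ⟨x 0, x 1, congrArg (ofTableEquiv 1 2 ee eo oo) hx⟩
  · intro x y
    simp only [LinearMap.comp_apply, LinearEquiv.coe_coe, ofTable_mul]
    refine congrArg (ofTableEquiv 1 2 ee eo oo) (Prod.ext ?_ ?_) <;> ext i <;>
      fin_cases i <;> simp [hee, heo, hoo, tableMul, bv] <;> ring

lemma isJordan_S3_1 (h2 : (2 : k) ≠ 0) : (S3_1 k).IsJordan :=
  isJordan_of_table_one_two h2 0 0 1 1 (by simp)
    (by ext i j l; fin_cases i; fin_cases j; fin_cases l; simp)
    (by ext i j l; fin_cases i; fin_cases j <;> fin_cases l <;> simp [bv])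
    (by ext i j l; fin_cases i <;> fin_cases j <;> fin_cases l <;> simp)

lemma isJordan_S3_2 (h2 : (2 : k) ≠ 0) : (S3_2 k).IsJordan :=
  isJordan_of_table_one_two h2 0 0 0 1 (by simp)
    (by ext i j l; fin_cases i; fin_cases j; fin_cases l; simp)
    (by ext i j l; fin_cases i; fin_cases j <;> fin_cases l <;> simp [bv])
    (by ext i j l; fin_cases i <;> fin_cases j <;> fin_cases l <;> simp)

lemma isJordan_S3_3 (h2 : (2 : k) ≠ 0) : (S3_3 k).IsJordan :=
  isJordan_of_table_one_two h2 0 0 1 0 (by simp)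
    (by ext i j l; fin_cases i; fin_cases j; fin_cases l; simp)
    (by ext i j l; fin_cases i; fin_cases j <;> fin_cases l <;> simp [bv])
    (by ext i j l; fin_cases i <;> fin_cases j <;> fin_cases l <;> simp)

lemma isJordan_S3_5 (h2 : (2 : k) ≠ 0) : (S3_5 k).IsJordan :=
  isJordan_of_table_one_two h2 1 (1 / 2) 0 0 (by simp)
    (by ext i j l; fin_cases i; fin_cases j; fin_cases l; simp)
    (by ext i j l; fin_cases i; fin_cases j <;> fin_cases l <;> simp [bv])
    (by ext i j l; fin_cases i <;> fin_cases j <;> fin_cases l <;> simp)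

lemma isJordan_S3_6 (h2 : (2 : k) ≠ 0) : (S3_6 k).IsJordan :=
  isJordan_of_table_one_two h2 1 1 0 0 (by simp)
    (by ext i j l; fin_cases i; fin_cases j; fin_cases l; simp)
    (by ext i j l; fin_cases i; fin_cases j <;> fin_cases l <;> simp [bv])
    (by ext i j l; fin_cases i <;> fin_cases j <;> fin_cases l <;> simp)

lemma isJordan_S3_7 (h2 : (2 : k) ≠ 0) : (S3_7 k).IsJordan :=
  isJordan_of_table_one_two h2 1 (1 / 2) 0 1 (by simp)
    (by ext i j l; fin_cases i; fin_cases j; fin_cases l; simp)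
    (by ext i j l; fin_cases i; fin_cases j <;> fin_cases l <;> simp [bv])
    (by ext i j l; fin_cases i <;> fin_cases j <;> fin_cases l <;> simp)

lemma isJordan_S3_8 (h2 : (2 : k) ≠ 0) : (S3_8 k).IsJordan :=
  isJordan_of_table_one_two h2 1 1 0 1 (by simp)
    (by ext i j l; fin_cases i; fin_cases j; fin_cases l; simp)
    (by ext i j l; fin_cases i; fin_cases j <;> fin_cases l <;> simp [bv])
    (by ext i j l; fin_cases i <;> fin_cases j <;> fin_cases l <;> simp)

end JordanList

/-! ### Structure constants of the listed superalgebras -/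

namespace Superalgebra

variable {k : Type u} [Field k]

lemma HasTable.dsum_of_eq {J : Superalgebra.{u, v} k} {S : Superalgebra.{u, w} k}
    {n m n' m' : ℕ} {ee eo oo ee' eo' oo'} (h : J.HasTable n m ee eo oo)
    (h' : S.HasTable n' m' ee' eo' oo') {ee'' eo'' oo''}
    (h1 : ∀ i j l, blockTable ee ee' i j l = ee'' i j l)
    (h2 : ∀ i j l, blockTable eo eo' i j l = eo'' i j l)
    (h3 : ∀ i j l, blockTable oo oo' i j l = oo'' i j l) :
    (J.dsum S).HasTable (n + n') (m + m') ee'' eo'' oo'' := by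
  obtain rfl : blockTable ee ee' = ee'' := by ext; apply h1
  obtain rfl : blockTable eo eo' = eo'' := by ext; apply h2
  obtain rfl : blockTable oo oo' = oo'' := by ext; apply h3
  exact h.dsum h'

open Module

/-- A superalgebra has a given table if homogeneous bases of its two parts multiply accordingly. -/
lemma hasTable_of_bases {J : Superalgebra.{u, v} k} {n m : ℕ} {ee eo oo}
    (b : Basis (Fin n) k (J.part 0)) (c : Basis (Fin m) k (J.part 1))
    (a1 : ∀ i j, J.mul (b i) (b j) = ∑ l, ee i j l • (b l : J.carrier))
    (a2 : ∀ i j, J.mul (b i) (c j) = ∑ l, eo i j l • (c l : J.carrier))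
    (a3 : ∀ i j, J.mul (c j) (b i) = ∑ l, eo i j l • (c l : J.carrier))
    (a4 : ∀ i j, J.mul (c i) (c j) = ∑ l, oo i j l • (b l : J.carrier)) :
    J.HasTable n m ee eo oo :=
  ⟨fun i => b i, fun i => c i,
    (b.prod c).map (Submodule.prodEquivOfIsCompl _ _ J.isCompl),
    ⟨fun i => by simp, fun i => by simp⟩,
    ⟨fun i => (b i).2, fun i => (c i).2⟩, a1, a2, a3, a4⟩

end Superalgebra

namespace JordanList

open Superalgebra

variable {k : Type u} [Field k]

lemma hasTable_U1 : (U1 k).HasTable 1 0 ![![bv 0]] 0 0 :=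
  hasTable_ofTable _ _ _ _ _

lemma hasTable_U2 : (U2 k).HasTable 1 0 ![![0]] 0 0 :=
  hasTable_ofTable _ _ _ _ _

lemma hasTable_S1_1 : (S1_1 k).HasTable 0 1 0 0 0 :=
  hasTable_ofTable _ _ _ _ _

lemma hasTable_B1 : (B1 k).HasTable 2 0 ![![bv 0, bv 1], ![bv 1, 0]] 0 0 :=
  hasTable_ofTable _ _ _ _ _

lemma hasTable_B2 : (B2 k).HasTable 2 0
    ![![bv 0, (1 / 2 : k) • bv 1], ![(1 / 2 : k) • bv 1, 0]] 0 0 :=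
  hasTable_ofTable _ _ _ _ _

lemma hasTable_B3 : (B3 k).HasTable 2 0 ![![bv 1, 0], ![0, 0]] 0 0 :=
  hasTable_ofTable _ _ _ _ _

lemma hasTable_S2_1 : (S2_1 k).HasTable 1 1 ![![bv 0]] ![![(1 / 2 : k) • bv 0]] 0 :=
  hasTable_ofTable _ _ _ _ _

lemma hasTable_S2_2 : (S2_2 k).HasTable 1 1 ![![bv 0]] ![![bv 0]] 0 :=
  hasTable_ofTable _ _ _ _ _

lemma hasTable_U1_U1 : ((U1 k).dsum (U1 k)).HasTable 2 0
    ![![bv 0, 0], ![0, bv 1]] 0 0 := by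
  refine hasTable_U1.dsum_of_eq hasTable_U1 ?_ ?_ ?_ <;> intro i j l <;>
    fin_cases i <;> fin_cases j <;> fin_cases l <;> rfl

lemma hasTable_U1_U2 : ((U1 k).dsum (U2 k)).HasTable 2 0
    ![![bv 0, 0], ![0, 0]] 0 0 := by
  refine hasTable_U1.dsum_of_eq hasTable_U2 ?_ ?_ ?_ <;> intro i j l <;>
    fin_cases i <;> fin_cases j <;> fin_cases l <;> rfl

lemma hasTable_U2_U2 : ((U2 k).dsum (U2 k)).HasTable 2 0
    0 0 0 := by
  refine hasTable_U2.dsum_of_eq hasTable_U2 ?_ ?_ ?_ <;> intro i j l <;>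
    fin_cases i <;> fin_cases j <;> fin_cases l <;> rfl

lemma hasTable_U1_S : ((U1 k).dsum (S1_1 k)).HasTable 1 1
    ![![bv 0]] 0 0 := by
  refine hasTable_U1.dsum_of_eq hasTable_S1_1 ?_ ?_ ?_ <;> intro i j l <;>
    fin_cases i <;> fin_cases j <;> fin_cases l <;> rfl

lemma hasTable_U2_S : ((U2 k).dsum (S1_1 k)).HasTable 1 1
    0 0 0 := by
  refine hasTable_U2.dsum_of_eq hasTable_S1_1 ?_ ?_ ?_ <;> intro i j l <;>
    fin_cases i <;> fin_cases j <;> fin_cases l <;> rfl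

lemma hasTable_S_S : ((S1_1 k).dsum (S1_1 k)).HasTable 0 2
    0 0 0 := by
  refine hasTable_S1_1.dsum_of_eq hasTable_S1_1 ?_ ?_ ?_ <;> intro i j l <;>
    fin_cases i <;> fin_cases j <;> fin_cases l

lemma hasTable_B1_U1 : ((B1 k).dsum (U1 k)).HasTable 3 0
    ![![bv 0, bv 1, 0], ![bv 1, 0, 0], ![0, 0, bv 2]] 0 0 := by
  refine hasTable_B1.dsum_of_eq hasTable_U1 ?_ ?_ ?_ <;> intro i j l <;>
    fin_cases i <;> fin_cases j <;> fin_cases l <;> rfl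

lemma hasTable_B1_U2 : ((B1 k).dsum (U2 k)).HasTable 3 0
    ![![bv 0, bv 1, 0], ![bv 1, 0, 0], ![0, 0, 0]] 0 0 := by
  refine hasTable_B1.dsum_of_eq hasTable_U2 ?_ ?_ ?_ <;> intro i j l <;>
    fin_cases i <;> fin_cases j <;> fin_cases l <;> rfl

lemma hasTable_B2_U1 : ((B2 k).dsum (U1 k)).HasTable 3 0
    ![![bv 0, (1 / 2 : k) • bv 1, 0], ![(1 / 2 : k) • bv 1, 0, 0], ![0, 0, bv 2]] 0 0 := by
  refine hasTable_B2.dsum_of_eq hasTable_U1 ?_ ?_ ?_ <;> intro i j l <;>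
    fin_cases i <;> fin_cases j <;> fin_cases l <;> first | rfl | exact (mul_zero _).symm

lemma hasTable_B2_U2 : ((B2 k).dsum (U2 k)).HasTable 3 0
    ![![bv 0, (1 / 2 : k) • bv 1, 0], ![(1 / 2 : k) • bv 1, 0, 0], ![0, 0, 0]] 0 0 := by
  refine hasTable_B2.dsum_of_eq hasTable_U2 ?_ ?_ ?_ <;> intro i j l <;>
    fin_cases i <;> fin_cases j <;> fin_cases l <;> first | rfl | exact (mul_zero _).symm

lemma hasTable_B3_U1 : ((B3 k).dsum (U1 k)).HasTable 3 0
    ![![bv 1, 0, 0], ![0, 0, 0], ![0, 0, bv 2]] 0 0 := by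
  refine hasTable_B3.dsum_of_eq hasTable_U1 ?_ ?_ ?_ <;> intro i j l <;>
    fin_cases i <;> fin_cases j <;> fin_cases l <;> rfl

lemma hasTable_B3_U2 : ((B3 k).dsum (U2 k)).HasTable 3 0
    ![![bv 1, 0, 0], ![0, 0, 0], ![0, 0, 0]] 0 0 := by
  refine hasTable_B3.dsum_of_eq hasTable_U2 ?_ ?_ ?_ <;> intro i j l <;>
    fin_cases i <;> fin_cases j <;> fin_cases l <;> rfl

lemma hasTable_U1_U1_U1 : ((U1 k).dsum ((U1 k).dsum (U1 k))).HasTable 3 0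
    ![![bv 0, 0, 0], ![0, bv 1, 0], ![0, 0, bv 2]] 0 0 := by
  refine hasTable_U1.dsum_of_eq (hasTable_U1.dsum hasTable_U1) ?_ ?_ ?_ <;> intro i j l <;>
    fin_cases i <;> fin_cases j <;> fin_cases l <;> rfl

lemma hasTable_U1_U1_U2 : ((U1 k).dsum ((U1 k).dsum (U2 k))).HasTable 3 0
    ![![bv 0, 0, 0], ![0, bv 1, 0], ![0, 0, 0]] 0 0 := by
  refine hasTable_U1.dsum_of_eq (hasTable_U1.dsum hasTable_U2) ?_ ?_ ?_ <;> intro i j l <;>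
    fin_cases i <;> fin_cases j <;> fin_cases l <;> rfl

lemma hasTable_U1_U2_U2 : ((U1 k).dsum ((U2 k).dsum (U2 k))).HasTable 3 0
    ![![bv 0, 0, 0], ![0, 0, 0], ![0, 0, 0]] 0 0 := by
  refine hasTable_U1.dsum_of_eq (hasTable_U2.dsum hasTable_U2) ?_ ?_ ?_ <;> intro i j l <;>
    fin_cases i <;> fin_cases j <;> fin_cases l <;> rfl

lemma hasTable_U2_U2_U2 : ((U2 k).dsum ((U2 k).dsum (U2 k))).HasTable 3 0
    0 0 0 := by
  refine hasTable_U2.dsum_of_eq (hasTable_U2.dsum hasTable_U2) ?_ ?_ ?_ <;> intro i j l <;>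
    fin_cases i <;> fin_cases j <;> fin_cases l <;> rfl

lemma hasTable_S2_1_S : ((S2_1 k).dsum (S1_1 k)).HasTable 1 2
    ![![bv 0]] ![![(1 / 2 : k) • bv 0, 0]] 0 := by
  refine hasTable_S2_1.dsum_of_eq hasTable_S1_1 ?_ ?_ ?_ <;> intro i j l <;>
    fin_cases i <;> fin_cases j <;> fin_cases l <;> first | rfl | exact (mul_zero _).symm

lemma hasTable_S2_2_S : ((S2_2 k).dsum (S1_1 k)).HasTable 1 2
    ![![bv 0]] ![![bv 0, 0]] 0 := by
  refine hasTable_S2_2.dsum_of_eq hasTable_S1_1 ?_ ?_ ?_ <;> intro i j l <;>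
    fin_cases i <;> fin_cases j <;> fin_cases l <;> rfl

lemma hasTable_U1_S_S : ((U1 k).dsum ((S1_1 k).dsum (S1_1 k))).HasTable 1 2
    ![![bv 0]] 0 0 := by
  refine hasTable_U1.dsum_of_eq (hasTable_S1_1.dsum hasTable_S1_1) ?_ ?_ ?_ <;> intro i j l <;>
    fin_cases i <;> fin_cases j <;> fin_cases l <;> rfl

lemma hasTable_U2_S_S : ((U2 k).dsum ((S1_1 k).dsum (S1_1 k))).HasTable 1 2
    0 0 0 := by
  refine hasTable_U2.dsum_of_eq (hasTable_S1_1.dsum hasTable_S1_1) ?_ ?_ ?_ <;> intro i j l <;>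
    fin_cases i <;> fin_cases j <;> fin_cases l <;> rfl

lemma hasTable_B1_S : ((B1 k).dsum (S1_1 k)).HasTable 2 1
    ![![bv 0, bv 1], ![bv 1, 0]] 0 0 := by
  refine hasTable_B1.dsum_of_eq hasTable_S1_1 ?_ ?_ ?_ <;> intro i j l <;>
    fin_cases i <;> fin_cases j <;> fin_cases l <;> rfl

lemma hasTable_B2_S : ((B2 k).dsum (S1_1 k)).HasTable 2 1
    ![![bv 0, (1 / 2 : k) • bv 1], ![(1 / 2 : k) • bv 1, 0]] 0 0 := by
  refine hasTable_B2.dsum_of_eq hasTable_S1_1 ?_ ?_ ?_ <;> intro i j l <;>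
    fin_cases i <;> fin_cases j <;> fin_cases l <;> rfl

lemma hasTable_B3_S : ((B3 k).dsum (S1_1 k)).HasTable 2 1
    ![![bv 1, 0], ![0, 0]] 0 0 := by
  refine hasTable_B3.dsum_of_eq hasTable_S1_1 ?_ ?_ ?_ <;> intro i j l <;>
    fin_cases i <;> fin_cases j <;> fin_cases l <;> rfl

lemma hasTable_S2_1_U1 : ((S2_1 k).dsum (U1 k)).HasTable 2 1
    ![![bv 0, 0], ![0, bv 1]] ![![(1 / 2 : k) • bv 0], ![0]] 0 := by
  refine hasTable_S2_1.dsum_of_eq hasTable_U1 ?_ ?_ ?_ <;> intro i j l <;>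
    fin_cases i <;> fin_cases j <;> fin_cases l <;> rfl

lemma hasTable_S2_1_U2 : ((S2_1 k).dsum (U2 k)).HasTable 2 1
    ![![bv 0, 0], ![0, 0]] ![![(1 / 2 : k) • bv 0], ![0]] 0 := by
  refine hasTable_S2_1.dsum_of_eq hasTable_U2 ?_ ?_ ?_ <;> intro i j l <;>
    fin_cases i <;> fin_cases j <;> fin_cases l <;> rfl

lemma hasTable_S2_2_U1 : ((S2_2 k).dsum (U1 k)).HasTable 2 1
    ![![bv 0, 0], ![0, bv 1]] ![![bv 0], ![0]] 0 := by
  refine hasTable_S2_2.dsum_of_eq hasTable_U1 ?_ ?_ ?_ <;> intro i j l <;>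
    fin_cases i <;> fin_cases j <;> fin_cases l <;> rfl

lemma hasTable_S2_2_U2 : ((S2_2 k).dsum (U2 k)).HasTable 2 1
    ![![bv 0, 0], ![0, 0]] ![![bv 0], ![0]] 0 := by
  refine hasTable_S2_2.dsum_of_eq hasTable_U2 ?_ ?_ ?_ <;> intro i j l <;>
    fin_cases i <;> fin_cases j <;> fin_cases l <;> rfl

lemma hasTable_U1_U1_S : ((U1 k).dsum ((U1 k).dsum (S1_1 k))).HasTable 2 1
    ![![bv 0, 0], ![0, bv 1]] 0 0 := by
  refine hasTable_U1.dsum_of_eq (hasTable_U1.dsum hasTable_S1_1) ?_ ?_ ?_ <;> intro i j l <;>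
    fin_cases i <;> fin_cases j <;> fin_cases l <;> rfl

lemma hasTable_U1_U2_S : ((U1 k).dsum ((U2 k).dsum (S1_1 k))).HasTable 2 1
    ![![bv 0, 0], ![0, 0]] 0 0 := by
  refine hasTable_U1.dsum_of_eq (hasTable_U2.dsum hasTable_S1_1) ?_ ?_ ?_ <;> intro i j l <;>
    fin_cases i <;> fin_cases j <;> fin_cases l <;> rfl

lemma hasTable_U2_U2_S : ((U2 k).dsum ((U2 k).dsum (S1_1 k))).HasTable 2 1
    0 0 0 := by
  refine hasTable_U2.dsum_of_eq (hasTable_U2.dsum hasTable_S1_1) ?_ ?_ ?_ <;> intro i j l <;>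
    fin_cases i <;> fin_cases j <;> fin_cases l <;> rfl

lemma hasTable_S_S_S : ((S1_1 k).dsum ((S1_1 k).dsum (S1_1 k))).HasTable 0 3
    0 0 0 := by
  refine hasTable_S1_1.dsum_of_eq (hasTable_S1_1.dsum hasTable_S1_1) ?_ ?_ ?_ <;> intro i j l <;>
    fin_cases i <;> fin_cases j <;> fin_cases l

end JordanList

/-! ### Bases and products in dimensions two and three -/

section Classification

open Module Superalgebra JordanList

variable {k : Type u} [Field k] {V : Type*} [AddCommGroup V] [Module k V]

lemma linearIndependent_triple_iff {x y z : V} : LinearIndependent k ![x, y, z] ↔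
    ∀ a b c : k, a • x + b • y + c • z = 0 → a = 0 ∧ b = 0 ∧ c = 0 := by
  rw [Fintype.linearIndependent_iff]
  constructor
  · intro h a b c habc
    have := h ![a, b, c] (by simpa [Fin.sum_univ_three] using habc)
    exact ⟨this 0, this 1, this 2⟩
  · intro h g hg i
    obtain ⟨h0, h1, h2⟩ := h (g 0) (g 1) (g 2) (by simpa [Fin.sum_univ_three] using hg)
    fin_cases i <;> assumption

/-- Linear independence of three vectors, spelled out in coordinates. -/
def Indep (k : Type*) [Field k] {V : Type*} [AddCommGroup V] [Module k V] (x y z : V) : Prop :=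
  ∀ a b c : k, a • x + b • y + c • z = 0 → a = 0 ∧ b = 0 ∧ c = 0

lemma Indep.exists_eq [FiniteDimensional k V] (hd : finrank k V = 3) {x y z : V}
    (h : Indep k x y z) (v : V) : ∃ a b c : k, v = a • x + b • y + c • z := by
  have hli := linearIndependent_triple_iff.2 h
  have hs := hli.span_eq_top_of_card_eq_finrank (by simp [hd])
  have hv : v ∈ Submodule.span k (Set.range ![x, y, z]) := hs ▸ Submodule.mem_top
  obtain ⟨c, hc⟩ := (Submodule.mem_span_range_iff_exists_fun k).1 hv
  exact ⟨c 0, c 1, c 2, by rw [← hc, Fin.sum_univ_three]; rfl⟩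

lemma Indep.rotate {x y z : V} (h : Indep k x y z) : Indep k y z x := fun a b c habc => by
  obtain ⟨h1, h2, h3⟩ := h c a b (by rw [← habc]; abel)
  exact ⟨h2, h3, h1⟩

lemma Indep.swap {x y z : V} (h : Indep k x y z) : Indep k x z y := fun a b c habc => by
  obtain ⟨h1, h2, h3⟩ := h a c b (by rw [← habc]; abel)
  exact ⟨h1, h3, h2⟩

lemma Indep.smul {x y z : V} (h : Indep k x y z) {t : k} (ht : t ≠ 0) : Indep k x y (t • z) :=
  fun a b c habc => by
    obtain ⟨h1, h2, h3⟩ := h a b (c * t) (by rw [← habc]; module)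
    exact ⟨h1, h2, (mul_eq_zero.1 h3).resolve_right ht⟩

lemma Indep.add_smul {x y z : V} (h : Indep k x y z) (t : k) : Indep k x y (z + t • x) :=
  fun a b c habc => by
    obtain ⟨h1, h2, h3⟩ := h (a + c * t) b c (by rw [← habc]; module)
    subst h3
    exact ⟨by simpa using h1, h2, rfl⟩

lemma Indep.ne_zero {x y z : V} (h : Indep k x y z) : x ≠ 0 ∧ y ≠ 0 ∧ z ≠ 0 := by
  refine ⟨?_, ?_, ?_⟩ <;> rintro rfl
  · simpa using (h 1 0 0 (by simp)).1
  · simpa using (h 0 1 0 (by simp)).2.1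
  · simpa using (h 0 0 1 (by simp)).2.2

lemma indep_of_notMem {x y z : V} (hx : x ≠ 0) (hy : y ∉ Submodule.span k {x})
    (hz : z ∉ Submodule.span k {x, y}) : Indep k x y z := by
  intro a b c h
  have hc : c = 0 := by
    by_contra hc
    refine hz (Submodule.mem_span_pair.2 ⟨-(c⁻¹ * a), -(c⁻¹ * b), ?_⟩)
    have : z = c⁻¹ • (c • z) := by rw [inv_smul_smul₀ hc]
    rw [this, ← sub_eq_zero]
    have h' := congrArg (fun w => -(c⁻¹ • w)) h
    simp only [smul_zero, neg_zero] at h'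
    rw [← h']; module
  subst hc
  have hb : b = 0 := by
    by_contra hb
    refine hy (Submodule.mem_span_singleton.2 ⟨-(b⁻¹ * a), ?_⟩)
    have : y = b⁻¹ • (b • y) := by rw [inv_smul_smul₀ hb]
    rw [this, ← sub_eq_zero]
    have h' := congrArg (fun w => -(b⁻¹ • w)) h
    simp only [smul_zero, neg_zero] at h'
    rw [← h']; module
  subst hb
  simp only [zero_smul, add_zero] at h
  exact ⟨(smul_eq_zero.1 h).resolve_right hx, rfl, rfl⟩

lemma span_singleton_ne_top [FiniteDimensional k V] (hd : 2 ≤ finrank k V) (x : V) :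
    Submodule.span k {x} ≠ ⊤ := by
  intro h
  have h1 := finrank_span_le_card (R := k) ({x} : Set V)
  rw [h, finrank_top] at h1
  simp at h1; omega

lemma span_pair_ne_top [FiniteDimensional k V] (hd : 3 ≤ finrank k V) (x y : V) :
    Submodule.span k {x, y} ≠ ⊤ := by
  classical
  intro h
  have h1 := finrank_span_finset_le_card (R := k) ({x, y} : Finset V)
  have h2 := Finset.card_le_two (a := x) (b := y)
  rw [Set.finrank, Finset.coe_pair, h, finrank_top] at h1
  omega

/-- The product `m` has structure constants `t` in some basis. -/
def HasMulTable (m : V →ₗ[k] V →ₗ[k] V) {n : ℕ} (t : Fin n → Fin n → Fin n → k) : Prop :=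
  ∃ b : Basis (Fin n) k V, ∀ i j, m (b i) (b j) = ∑ l, t i j l • b l

lemma hasMulTable_two [FiniteDimensional k V] {m : V →ₗ[k] V →ₗ[k] V}
    (hm : ∀ a b, m a b = m b a) (hd : finrank k V = 2) {x y : V}
    (hli : LinearIndependent k ![x, y]) {t : Fin 2 → Fin 2 → Fin 2 → k} (h1 : t 1 0 = t 0 1)
    (xx : m x x = t 0 0 0 • x + t 0 0 1 • y) (xy : m x y = t 0 1 0 • x + t 0 1 1 • y)
    (yy : m y y = t 1 1 0 • x + t 1 1 1 • y) : HasMulTable m t := by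
  refine ⟨basisOfLinearIndependentOfCardEqFinrank hli (by simp [hd]), fun i j => ?_⟩
  rw [coe_basisOfLinearIndependentOfCardEqFinrank]
  fin_cases i <;> fin_cases j <;> simp [xx, xy, yy, hm y x, h1]

lemma hasMulTable_three [FiniteDimensional k V] {m : V →ₗ[k] V →ₗ[k] V}
    (hm : ∀ a b, m a b = m b a) (hd : finrank k V = 3) {x y z : V}
    (hli : Indep k x y z) {t : Fin 3 → Fin 3 → Fin 3 → k}
    (h1 : t 1 0 = t 0 1) (h2 : t 2 0 = t 0 2) (h3 : t 2 1 = t 1 2)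
    (xx : m x x = t 0 0 0 • x + t 0 0 1 • y + t 0 0 2 • z)
    (xy : m x y = t 0 1 0 • x + t 0 1 1 • y + t 0 1 2 • z)
    (xz : m x z = t 0 2 0 • x + t 0 2 1 • y + t 0 2 2 • z)
    (yy : m y y = t 1 1 0 • x + t 1 1 1 • y + t 1 1 2 • z)
    (yz : m y z = t 1 2 0 • x + t 1 2 1 • y + t 1 2 2 • z)
    (zz : m z z = t 2 2 0 • x + t 2 2 1 • y + t 2 2 2 • z) : HasMulTable m t := by
  refine ⟨basisOfLinearIndependentOfCardEqFinrank (linearIndependent_triple_iff.2 hli)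
    (by simp [hd]), fun i j => ?_⟩
  rw [coe_basisOfLinearIndependentOfCardEqFinrank]
  fin_cases i <;> fin_cases j <;>
    simp [Fin.sum_univ_three, xx, xy, xz, yy, yz, zz, hm y x, hm z x, hm z y, h1, h2, h3]

namespace IsJordanProduct

variable {m : V →ₗ[k] V →ₗ[k] V}

open Polynomial in
lemma mul_pow (h : IsJordanProduct m) (x : V) (i j : ℕ) :
    m ((m x ^ i) x) ((m x ^ j) x) = (m x ^ (i + j + 1)) x := by
  have := h.mul_aeval x (X ^ i) (X ^ j)
  simp only [map_mul, map_pow, aeval_X] at this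
  rw [this, ← pow_succ', ← pow_add, add_right_comm]

/-- Squares of eigenvectors for the eigenvalue `1/2` have no component along the idempotent. -/
lemma half_sq_eq_zero (h : IsJordanProduct m) (h2 : (2 : k) ≠ 0) {e c : V}
    (hc : m e c = (1 / 2 : k) • c) (he : m e e = e) {α : k} (hcc : m c c = α • e) :
    m c c = 0 := by
  have h1 := h.jordan c e
  simp only [hcc, hc, map_smul, LinearMap.smul_apply, he] at h1
  rw [← sub_eq_zero, smul_smul, smul_smul, smul_smul, ← sub_smul] at h1
  rcases smul_eq_zero.1 h1 with h0 | h0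
  · have : α = -4 * (1 / 2 * α * (1 / 2) - α * (1 / 2)) := by field_simp; ring
    rw [hcc, this, h0, mul_zero, zero_smul]
  · rw [h0, map_zero]

/-- If all squares vanish, then all products vanish. -/
lemma mul_eq_zero_of_sq (h : IsJordanProduct m) (h2 : (2 : k) ≠ 0) (hs : ∀ x, m x x = 0)
    (x y : V) : m x y = 0 := by
  have := hs (x + y)
  simp only [map_add, LinearMap.add_apply, hs, h.comm y x, zero_add, add_zero] at this
  rw [← two_smul k] at this
  exact (smul_eq_zero.1 this).resolve_left h2

/-- If `e` is a unit for `v` and `v²` lies in the span of `e` and `v`, then adding a multiple of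
`e` to `v` makes the square a multiple of `e`. -/
lemma complete_square (h : IsJordanProduct m) (h2 : (2 : k) ≠ 0) {e v : V} (he : m e e = e)
    (hev : m e v = v) {a b : k} (hv : m v v = a • e + b • v) :
    m e (v + (-(b / 2)) • e) = v + (-(b / 2)) • e ∧
    m (v + (-(b / 2)) • e) (v + (-(b / 2)) • e) = (a + b ^ 2 / 4) • e := by
  have h4 : (4 : k) ≠ 0 := by
    have : (4 : k) = 2 * 2 := by norm_num
    rw [this]; exact mul_ne_zero h2 h2
  constructor
  · simp only [map_add, map_smul, he, hev]
  · simp only [map_add, map_smul, LinearMap.add_apply, LinearMap.smul_apply, he, hev, hv,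
      h.comm v e]
    match_scalars <;> field_simp <;> ring

/-- If `e` is a unit for `v` and `v² = s² e`, then `(e ± v/s)/2` are orthogonal idempotents. -/
lemma split_idempotent (h : IsJordanProduct m) (h2 : (2 : k) ≠ 0) {e v : V} (he : m e e = e)
    (hev : m e v = v) {s : k} (hs : s ≠ 0) (hv : m v v = (s * s) • e) :
    let f := (1 / 2 : k) • e + (1 / (2 * s)) • v
    let g := (1 / 2 : k) • e + (-(1 / (2 * s))) • v
    m f f = f ∧ m g g = g ∧ m f g = 0 := by
  intro f g
  have h4 : (4 : k) ≠ 0 := by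
    have : (4 : k) = 2 * 2 := by norm_num
    rw [this]; exact mul_ne_zero h2 h2
  refine ⟨?_, ?_, ?_⟩ <;>
    simp only [f, g, map_add, map_smul, LinearMap.add_apply, LinearMap.smul_apply, he, hev, hv,
      h.comm v e] <;> match_scalars <;> field_simp <;> norm_num

end IsJordanProduct
end Classification

/-! ### Jordan algebras of dimensions one and two -/

section Classification

open Module Superalgebra JordanList

variable {k : Type u} [Field k] {V : Type*} [AddCommGroup V] [Module k V]

namespace IsJordanProduct

variable {m : V →ₗ[k] V →ₗ[k] V}

lemma exists_of_finrank_one (hd : finrank k V = 1) (m : V →ₗ[k] V →ₗ[k] V) :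
    ∃ x : V, x ≠ 0 ∧ (m x x = x ∨ m x x = 0) := by
  obtain ⟨x, hx, hs⟩ := finrank_eq_one_iff'.1 hd
  obtain ⟨c, hc⟩ := hs (m x x)
  by_cases h0 : c = 0
  · exact ⟨x, hx, Or.inr (by rw [← hc, h0, zero_smul])⟩
  · refine ⟨c⁻¹ • x, smul_ne_zero (inv_ne_zero h0) hx, Or.inl ?_⟩
    simp only [map_smul, LinearMap.smul_apply, ← hc, smul_smul]
    congr 1; field_simp

/-- Jordan algebras of dimension two. -/
lemma exists_of_finrank_two [IsAlgClosed k] [FiniteDimensional k V] (h : IsJordanProduct m)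
    (h2 : (2 : k) ≠ 0) (hd : finrank k V = 2) :
    ∃ x y : V, LinearIndependent k ![x, y] ∧
      ((m x x = x ∧ m x y = y ∧ m y y = 0) ∨
      (m x x = x ∧ m x y = (1 / 2 : k) • y ∧ m y y = 0) ∨
      (m x x = y ∧ m x y = 0 ∧ m y y = 0) ∨
      (m x x = x ∧ m x y = 0 ∧ m y y = y) ∨
      (m x x = x ∧ m x y = 0 ∧ m y y = 0) ∨
      (m x x = 0 ∧ m x y = 0 ∧ m y y = 0)) := by
  have pair : ∀ {x y : V}, LinearIndependent k ![x, y] ↔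
      ∀ a b : k, a • x + b • y = 0 → a = 0 ∧ b = 0 := LinearIndependent.pair_iff
  have hspan : ∀ {x y : V}, LinearIndependent k ![x, y] → ∀ v, ∃ a b : k, v = a • x + b • y := by
    intro x y hli v
    have hs := hli.span_eq_top_of_card_eq_finrank (by simp [hd])
    have hv : v ∈ Submodule.span k (Set.range ![x, y]) := hs ▸ Submodule.mem_top
    obtain ⟨c, hc⟩ := (Submodule.mem_span_range_iff_exists_fun k).1 hv
    exact ⟨c 0, c 1, by rw [← hc, Fin.sum_univ_two]; rfl⟩
  by_cases hid : ∃ e, e ≠ 0 ∧ m e e = e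
  · obtain ⟨e, he0, he⟩ := hid
    obtain ⟨v, hv, hev⟩ := h.exists_eigenvector_notMem h2 he (span_singleton_ne_top hd.ge e)
    have hli : LinearIndependent k ![e, v] := by
      rw [LinearIndependent.pair_iff' he0]
      intro a ha
      exact hv (Submodule.mem_span_singleton.2 ⟨a, ha⟩)
    have hp := pair.1 hli
    obtain ⟨a, b, hvv⟩ := hspan hli (m v v)
    rcases hev with hev | hev | hev
    · have h1 := h.peirce he (c := v) (d := v) (γ := 0) (δ := 0) (by simp [hev]) (by simp [hev])
      have ha : a = 0 := by
        simp only [hvv, map_add, map_smul, he, hev, smul_zero, add_zero, mul_zero, sub_zero,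
          one_smul, zero_mul, zero_smul] at h1
        exact (smul_eq_zero.1 h1).resolve_right he0
      rw [ha, zero_smul, zero_add] at hvv
      by_cases hb : b = 0
      · exact ⟨e, v, hli, by simp [he, hev, hvv, hb]⟩
      · refine ⟨e, b⁻¹ • v, pair.2 fun p q hpq => ?_, ?_⟩
        · rw [smul_smul] at hpq
          obtain ⟨h3, h4⟩ := hp _ _ hpq
          exact ⟨h3, (mul_eq_zero.1 h4).resolve_right (inv_ne_zero hb)⟩
        · refine Or.inr (Or.inr (Or.inr (Or.inl ⟨he, by simp [hev], ?_⟩)))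
          simp only [map_smul, LinearMap.smul_apply, hvv, smul_smul]
          congr 1; field_simp
    · have h1 := h.peirce_half he hev hev
      have hb : b = 0 := by
        simp only [hvv, map_add, map_smul, he, hev] at h1
        have h3 := (hp 0 (b * (1 / 2) * (1 / 2) - b * (1 / 2))
          (by linear_combination (norm := module) h1)).2
        have : b = -4 * (b * (1 / 2) * (1 / 2) - b * (1 / 2)) := by field_simp; ring
        rw [this, h3, mul_zero]
      rw [hb, zero_smul, add_zero] at hvv
      exact ⟨e, v, hli, Or.inr (Or.inl ⟨he, hev, h.half_sq_eq_zero h2 hev he hvv⟩)⟩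
    · obtain ⟨hew, hww⟩ := h.complete_square h2 he hev hvv
      have hli' : ∀ p q : k, p • e + q • (v + (-(b / 2)) • e) = 0 → p = 0 ∧ q = 0 := by
        intro p q hpq
        obtain ⟨h3, h4⟩ := hp (p - q * (b / 2)) q (by rw [← hpq]; module)
        subst h4
        exact ⟨by simpa using h3, rfl⟩
      generalize v + (-(b / 2)) • e = w at hew hww hli'
      by_cases hδ : a + b ^ 2 / 4 = 0
      · exact ⟨e, w, pair.2 hli', by simp [he, hew, hww, hδ]⟩
      · obtain ⟨s, hs⟩ := IsAlgClosed.exists_eq_mul_self (a + b ^ 2 / 4)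
        rw [hs] at hww
        have hs0 : s ≠ 0 := by rintro rfl; exact hδ (by rw [hs, mul_zero])
        obtain ⟨hf, hg, hfg⟩ := h.split_idempotent h2 he hew hs0 hww
        refine ⟨_, _, pair.2 fun p q hpq => ?_, Or.inr (Or.inr (Or.inr (Or.inl ⟨hf, hfg, hg⟩)))⟩
        obtain ⟨h3, h4⟩ := hli' ((p + q) / 2) ((p - q) / (2 * s)) (by rw [← hpq]; module)
        have h5 : p + q = 0 := by simpa [h2] using h3
        have h6 : p - q = 0 := by simpa [h2, hs0] using h4
        have h7 : 2 * p = 0 := by linear_combination h5 + h6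
        have h8 : 2 * q = 0 := by linear_combination h5 - h6
        exact ⟨(mul_eq_zero.1 h7).resolve_left h2, (mul_eq_zero.1 h8).resolve_left h2⟩
  · have hid' : ∀ e, m e e = e → e = 0 := fun e he => by
      by_contra h0; exact hid ⟨e, h0, he⟩
    have hnil := h.pow_finrank_eq_zero hid'
    rw [hd] at hnil
    by_cases hsq : ∃ x, m x x ≠ 0
    · obtain ⟨x, hx⟩ := hsq
      have hx3 : m x (m x x) = 0 := by simpa [pow_two] using hnil x
      refine ⟨x, m x x, pair.2 fun a b hab => ?_, Or.inr (Or.inr (Or.inl ⟨rfl, hx3, ?_⟩))⟩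
      · have h3 := congrArg (m x) hab
        simp only [map_add, map_smul, hx3, smul_zero, add_zero, map_zero] at h3
        have ha := (smul_eq_zero.1 h3).resolve_right hx
        rw [ha, zero_smul, zero_add] at hab
        exact ⟨ha, (smul_eq_zero.1 hab).resolve_right hx⟩
      · have := h.mul_pow x 1 1
        simpa [pow_succ, hx3] using this
    · push Not at hsq
      have b := finBasisOfFinrankEq k V hd
      refine ⟨b 0, b 1, ?_, ?_⟩
      · convert b.linearIndependent using 1
        ext i; fin_cases i <;> rfl
      · simp [h.mul_eq_zero_of_sq h2 hsq]

end IsJordanProduct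
end Classification

/-! ### Jordan algebras of dimension three: idempotents with a zero eigenvector -/

section Classification

open Module Superalgebra JordanList

variable {k : Type u} [Field k] {V : Type*} [AddCommGroup V] [Module k V]

/-- The algebra `(V, m)` is isomorphic to one of the algebras of dimension `n` in the list. -/
def IsListedAlgebra (n : ℕ) (m : V →ₗ[k] V →ₗ[k] V) : Prop :=
  ∃ (S : Superalgebra.{u, u} k) (t : Fin n → Fin n → Fin n → k)
    (eo : Fin n → Fin 0 → Fin 0 → k) (oo : Fin 0 → Fin 0 → Fin n → k),
    Listed k n 0 S ∧ S.HasTable n 0 t eo oo ∧ HasMulTable m t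

namespace IsJordanProduct

variable {m : V →ₗ[k] V →ₗ[k] V}

lemma isListedAlgebra_three [FiniteDimensional k V] (h : IsJordanProduct m)
    (hd : finrank k V = 3) {S : Superalgebra.{u, u} k} {t : Fin 3 → Fin 3 → Fin 3 → k}
    {eo : Fin 3 → Fin 0 → Fin 0 → k} {oo : Fin 0 → Fin 0 → Fin 3 → k} (hS : Listed k 3 0 S)
    (hT : S.HasTable 3 0 t eo oo) {x y z : V} (hli : Indep k x y z)
    (xx : m x x = t 0 0 0 • x + t 0 0 1 • y + t 0 0 2 • z)
    (xy : m x y = t 0 1 0 • x + t 0 1 1 • y + t 0 1 2 • z)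
    (xz : m x z = t 0 2 0 • x + t 0 2 1 • y + t 0 2 2 • z)
    (yy : m y y = t 1 1 0 • x + t 1 1 1 • y + t 1 1 2 • z)
    (yz : m y z = t 1 2 0 • x + t 1 2 1 • y + t 1 2 2 • z)
    (zz : m z z = t 2 2 0 • x + t 2 2 1 • y + t 2 2 2 • z)
    (h1 : t 1 0 = t 0 1) (h2 : t 2 0 = t 0 2) (h3 : t 2 1 = t 1 2) : IsListedAlgebra 3 m :=
  ⟨S, t, eo, oo, hS, hT, hasMulTable_three h.comm hd hli h1 h2 h3 xx xy xz yy yz zz⟩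

/-- The equation for the coordinate `b`, along an eigenvector for the eigenvalue `1/2`, of a vector
`c` with `e (e c) = e c`. -/
lemma eq_zero_of_quarter_eq_half (h2 : (2 : k) ≠ 0) {b : k}
    (hb : b * (1 / 2) * (1 / 2) - b * (1 / 2) = 0) : b = 0 := by
  have : b = -4 * (b * (1 / 2) * (1 / 2) - b * (1 / 2)) := by field_simp; ring
  rw [this, hb, mul_zero]

lemma exists_smul_idempotent {v : V} (m : V →ₗ[k] V →ₗ[k] V) {b : k} (hv : m v v = b • v) :
    ∃ c : k, c ≠ 0 ∧ (m (c • v) (c • v) = c • v ∨ m (c • v) (c • v) = 0) := by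
  by_cases hb : b = 0
  · exact ⟨1, one_ne_zero, Or.inr (by simp [hv, hb])⟩
  · refine ⟨b⁻¹, inv_ne_zero hb, Or.inl ?_⟩
    simp only [map_smul, LinearMap.smul_apply, hv, smul_smul]
    congr 1; field_simp

section Peirce

variable [FiniteDimensional k V] (hd : finrank k V = 3) {e v w : V}

include hd in
/-- `V₀` is two-dimensional: the algebra is the direct sum of the line through `e` and of the
two-dimensional subalgebra `V₀`. -/
lemma isListedAlgebra_of_zero_zero [IsAlgClosed k] (h : IsJordanProduct m) (h2 : (2 : k) ≠ 0)
    (he : m e e = e) (hli : Indep k e v w) (hev : m e v = 0) (hew : m e w = 0) :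
    IsListedAlgebra 3 m := by
  have hU : ∀ x ∈ LinearMap.ker (m e), ∀ y ∈ LinearMap.ker (m e), m x y ∈ LinearMap.ker (m e) := by
    intro x hx y hy
    rw [LinearMap.mem_ker] at hx hy ⊢
    simpa using h.peirce he (γ := 0) (δ := 0) (c := x) (d := y) (by simpa) (by simpa)
  obtain ⟨m', hm', h'⟩ := h.exists_restrict _ hU
  have hdim : finrank k (LinearMap.ker (m e)) = 2 := by
    apply le_antisymm
    · have hlt : LinearMap.ker (m e) < ⊤ := by
        refine lt_top_iff_ne_top.2 fun ht => hli.ne_zero.1 ?_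
        have : e ∈ LinearMap.ker (m e) := ht ▸ Submodule.mem_top
        rwa [LinearMap.mem_ker, he] at this
      have := Submodule.finrank_lt hlt.ne
      omega
    · have hl : LinearIndependent k ![(⟨v, hev⟩ : LinearMap.ker (m e)), ⟨w, hew⟩] := by
        rw [LinearIndependent.pair_iff]
        intro a b hab
        have hab' : a • v + b • w = 0 := congrArg Subtype.val hab
        exact (hli 0 a b (by rw [← hab']; module)).2
      simpa using hl.fintype_card_le_finrank
  obtain ⟨x, y, hxy, hcases⟩ := h'.exists_of_finrank_two h2 hdim
  have hex : m e x = 0 := x.2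
  have hey : m e y = 0 := y.2
  have hli' : Indep k e (x : V) y := by
    intro a b c habc
    have h1 := congrArg (m e) habc
    simp only [map_add, map_smul, hex, hey, he, smul_zero, add_zero, map_zero] at h1
    have ha := (smul_eq_zero.1 h1).resolve_right hli.ne_zero.1
    subst ha
    obtain ⟨hb, hc⟩ := LinearIndependent.pair_iff.1 hxy b c (Subtype.ext (by simpa using habc))
    exact ⟨rfl, hb, hc⟩
  have hxe : m x e = 0 := by rw [h.comm, hex]
  have hye : m y e = 0 := by rw [h.comm, hey]
  simp only [Subtype.ext_iff, hm', Submodule.coe_smul, Submodule.coe_zero] at hcases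
  rcases hcases with ⟨p, q, r⟩ | ⟨p, q, r⟩ | ⟨p, q, r⟩ | ⟨p, q, r⟩ | ⟨p, q, r⟩ | ⟨p, q, r⟩
  · apply h.isListedAlgebra_three hd .B1_U1 hasTable_B1_U1 hli'.rotate <;>
      simp [bv, p, q, r, hxe, hye, he]
  · apply h.isListedAlgebra_three hd .B2_U1 hasTable_B2_U1 hli'.rotate <;>
      simp [bv, p, q, r, hxe, hye, he]
  · apply h.isListedAlgebra_three hd .B3_U1 hasTable_B3_U1 hli'.rotate <;>
      simp [bv, p, q, r, hxe, hye, he]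
  · apply h.isListedAlgebra_three hd .U1_U1_U1 hasTable_U1_U1_U1 hli' <;>
      simp [bv, p, q, r, hex, hey, he]
  · apply h.isListedAlgebra_three hd .U1_U1_U2 hasTable_U1_U1_U2 hli' <;>
      simp [bv, p, q, r, hex, hey, he]
  · apply h.isListedAlgebra_three hd .U1_U2_U2 hasTable_U1_U2_U2 hli' <;>
      simp [bv, p, q, r, hex, hey, he]

include hd in
/-- `V₁` is two-dimensional and `V₀` is a line. -/
lemma isListedAlgebra_of_zero_one [IsAlgClosed k] (h : IsJordanProduct m) (h2 : (2 : k) ≠ 0)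
    (he : m e e = e) (hli : Indep k e v w) (hev : m e v = 0) (hew : m e w = w) :
    IsListedAlgebra 3 m := by
  have hev0 : m e v = (0 : k) • v := by simp [hev]
  have hew1 : m e w = (1 : k) • w := by simp [hew]
  -- `V₀` is closed under multiplication, hence spanned by an idempotent or a nilpotent vector.
  obtain ⟨c, hc, hvv⟩ : ∃ c : k, c ≠ 0 ∧
      (m (c • v) (c • v) = c • v ∨ m (c • v) (c • v) = 0) := by
    obtain ⟨a, b, c, hvv⟩ := hli.exists_eq hd (m v v)
    have h1 := h.peirce he hev0 hev0
    simp only [hvv, map_add, map_smul, he, hev, hew, smul_zero, add_zero, mul_zero, sub_zero,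
      one_smul] at h1
    obtain ⟨h3, -, h4⟩ := hli a 0 c (by linear_combination (norm := module) h1)
    exact exists_smul_idempotent m (by rw [hvv, h3, h4]; module)
  have hvw : m v w = 0 := by
    have h1 := h.peirce he hev0 hew1
    have h3 := h.peirce he hew1 hev0
    rw [h.comm w v] at h3
    linear_combination (norm := module) -h1 - h3
  -- `V₁` is closed under multiplication, so the square can be completed there.
  obtain ⟨w', hli', hew', hvw', δ, hww⟩ : ∃ w', Indep k e v w' ∧ m e w' = w' ∧ m v w' = 0 ∧
      ∃ δ : k, m w' w' = δ • e := by
    obtain ⟨a, b, c, hww⟩ := hli.exists_eq hd (m w w)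
    have h1 := h.peirce he hew1 hew1
    simp only [hww, map_add, map_smul, he, hev, hew, smul_zero, add_zero] at h1
    have hb : b = 0 := (hli 0 b 0 (by linear_combination (norm := module) h1)).2.1
    rw [hb, zero_smul, add_zero] at hww
    obtain ⟨p, q⟩ := h.complete_square h2 he hew hww
    exact ⟨_, hli.add_smul _, p, by simp [hvw, h.comm v e, hev], _, q⟩
  have hli₁ := (hli'.swap.smul hc)
  have hwv : m w' (c • v) = 0 := by rw [map_smul, h.comm, hvw', smul_zero]
  have hev' : m e (c • v) = 0 := by rw [map_smul, hev, smul_zero]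
  generalize c • v = u at hli₁ hvv hwv hev'
  by_cases hδ : δ = 0
  · rw [hδ, zero_smul] at hww
    rcases hvv with hvv | hvv
    · apply h.isListedAlgebra_three hd .B1_U1 hasTable_B1_U1 hli₁ <;>
        simp [bv, he, hew', hww, hvv, hev', hwv]
    · apply h.isListedAlgebra_three hd .B1_U2 hasTable_B1_U2 hli₁ <;>
        simp [bv, he, hew', hww, hvv, hev', hwv]
  · obtain ⟨s, hs⟩ := IsAlgClosed.exists_eq_mul_self δ
    rw [hs] at hww
    have hs0 : s ≠ 0 := by rintro rfl; exact hδ (by rw [hs, mul_zero])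
    obtain ⟨hf, hg, hfg⟩ := h.split_idempotent h2 he hew' hs0 hww
    have hfu : m ((1 / 2 : k) • e + (1 / (2 * s)) • w') u = 0 := by
      simp [hev', hwv]
    have hgu : m ((1 / 2 : k) • e + (-(1 / (2 * s))) • w') u = 0 := by
      simp [hev', hwv]
    have hli₂ : Indep k ((1 / 2 : k) • e + (1 / (2 * s)) • w')
        ((1 / 2 : k) • e + (-(1 / (2 * s))) • w') u := by
      intro p q r hpq
      obtain ⟨h3, h4, h5⟩ := hli₁ ((p + q) / 2) ((p - q) / (2 * s)) r (by rw [← hpq]; module)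
      have h5' : p + q = 0 := by simpa [h2] using h3
      have h6 : p - q = 0 := by simpa [h2, hs0] using h4
      have h7 : 2 * p = 0 := by linear_combination h5' + h6
      have h8 : 2 * q = 0 := by linear_combination h5' - h6
      exact ⟨(mul_eq_zero.1 h7).resolve_left h2, (mul_eq_zero.1 h8).resolve_left h2, h5⟩
    generalize (1 / 2 : k) • e + (1 / (2 * s)) • w' = f at *
    generalize (1 / 2 : k) • e + (-(1 / (2 * s))) • w' = g at *
    rcases hvv with hvv | hvv
    · apply h.isListedAlgebra_three hd .U1_U1_U1 hasTable_U1_U1_U1 hli₂ <;>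
        simp [bv, hf, hg, hfg, hfu, hgu, hvv]
    · apply h.isListedAlgebra_three hd .U1_U1_U2 hasTable_U1_U1_U2 hli₂ <;>
        simp [bv, hf, hg, hfg, hfu, hgu, hvv]

include hd in
/-- `V₀` and `V_{1/2}` are lines. -/
lemma isListedAlgebra_of_zero_half [IsAlgClosed k] (h : IsJordanProduct m) (h2 : (2 : k) ≠ 0)
    (he : m e e = e) (hli : Indep k e v w) (hev : m e v = 0) (hew : m e w = (1 / 2 : k) • w) :
    IsListedAlgebra 3 m := by
  obtain ⟨c, hc, hvv⟩ : ∃ c : k, c ≠ 0 ∧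
      (m (c • v) (c • v) = c • v ∨ m (c • v) (c • v) = 0) := by
    have hev0 : m e v = (0 : k) • v := by simp [hev]
    obtain ⟨a, b, c, hvv⟩ := hli.exists_eq hd (m v v)
    have h1 := h.peirce he hev0 hev0
    simp only [hvv, map_add, map_smul, he, hev, hew, smul_zero, add_zero, mul_zero, sub_zero,
      one_smul] at h1
    obtain ⟨h3, -, h4⟩ := hli a 0 (c * (1 / 2)) (by linear_combination (norm := module) h1)
    have h4' : c = 0 := by simpa [h2] using h4
    exact exists_smul_idempotent m (by rw [hvv, h3, h4']; module)
  obtain ⟨a, ha, hvv⟩ : ∃ a : k, (a = 1 ∨ a = 0) ∧ m (c • v) (c • v) = a • (c • v) := by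
    rcases hvv with hvv | hvv
    · exact ⟨1, Or.inl rfl, by rw [hvv, one_smul]⟩
    · exact ⟨0, Or.inr rfl, by rw [hvv, zero_smul]⟩
  replace hli := (hli.swap.smul hc).swap
  replace hev : m e (c • v) = 0 := by rw [map_smul, hev, smul_zero]
  generalize c • v = v at *
  have hve : m v e = 0 := by rw [h.comm, hev]
  have hwe : m w e = (1 / 2 : k) • w := by rw [h.comm, hew]
  obtain ⟨γ, hwv⟩ : ∃ γ : k, m w v = γ • w := by
    obtain ⟨p, q, r, hwv⟩ := hli.exists_eq hd (m w v)
    have h1 := h.peirce he hew (d := v) (δ := 0) (by simp [hev])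
    simp only [hwv, map_add, map_smul, he, hev, hew] at h1
    obtain ⟨h3, h4, -⟩ := hli (p / 2) (-(q / 2)) 0 (by
      linear_combination (norm := skip) h1
      match_scalars <;> field_simp <;> ring)
    have hp : p = 0 := by simpa [h2] using h3
    have hq : q = 0 := by simpa [h2] using h4
    exact ⟨r, by rw [hwv, hp, hq]; module⟩
  have hvw : m v w = γ • w := by rw [h.comm, hwv]
  obtain ⟨β, δ, hww⟩ : ∃ β δ : k, m w w = β • e + δ • v := by
    obtain ⟨p, q, r, hww⟩ := hli.exists_eq hd (m w w)
    have h1 := h.peirce_half he hew hew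
    simp only [hww, map_add, map_smul, he, hev, hew, smul_zero, add_zero] at h1
    have hr := eq_zero_of_quarter_eq_half h2 (hli 0 0 (r * (1 / 2) * (1 / 2) - r * (1 / 2))
      (by linear_combination (norm := module) h1)).2.2
    exact ⟨p, q, by rw [hww, hr]; module⟩
  -- Three relations between the structure constants in `w v = γ w`, `w² = β e + δ v`, `v² = a v`.
  have r1 : δ * γ = β / 2 := by
    have h1 := h.jordan w e
    simp only [hww, hew, hve, hvw, he, map_add, map_smul, LinearMap.add_apply,
      LinearMap.smul_apply, smul_zero, add_zero] at h1
    have h3 := (hli 0 0 (1 / 2 * (β * (1 / 2) + δ * γ) - β * (1 / 2))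
      (by linear_combination (norm := module) h1)).2.2
    have : δ * γ - β / 2 = 2 * (1 / 2 * (β * (1 / 2) + δ * γ) - β * (1 / 2)) := by
      field_simp; ring
    rw [h3, mul_zero] at this
    exact sub_eq_zero.1 this
  have r2 : γ * γ = a * γ / 2 := by
    have h1 := h.linearized v v e w
    simp only [hvv, hew, hve, hvw, hwe, hwv, map_smul, LinearMap.smul_apply, map_zero,
      LinearMap.zero_apply, smul_zero, add_zero, zero_add] at h1
    have h3 := (hli 0 0 (a * γ / 2 - γ * γ) (by
      linear_combination (norm := skip) h1
      match_scalars <;> field_simp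
      ring)).2.2
    exact (sub_eq_zero.1 h3).symm
  have r3 : δ ^ 2 * a = β * δ := by
    have h1 := h.jordan w w
    simp only [hww, hew, hev, hve, hvw, hvv, he, map_add, map_smul, LinearMap.add_apply,
      LinearMap.smul_apply, smul_zero, add_zero] at h1
    have h3 := (hli (β * β - (β * (1 / 2) + δ * γ) * β)
      (δ * δ * a - (β * (1 / 2) + δ * γ) * δ) 0
      (by linear_combination (norm := module) h1)).2.1
    have : β * (1 / 2) + δ * γ = β := by rw [r1]; field_simp; ring
    rw [this] at h3
    linear_combination h3
  rcases ha with rfl | rfl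
  · rw [one_smul] at hvv
    by_cases hγ : γ = 0
    · subst hγ
      have hβ : β = 0 := by
        rw [mul_zero] at r1
        simpa [h2] using r1.symm
      subst hβ
      have hδ : δ = 0 := by simpa using r3
      subst hδ
      apply h.isListedAlgebra_three hd .B2_U1 hasTable_B2_U1 hli.swap <;>
        simp [bv, he, hew, hev, hww, hwv, hvv]
    · have hγ' : γ = 1 / 2 := by
        apply mul_left_cancel₀ hγ
        rw [r2]; ring
      subst hγ'
      have hβ : β = δ := by
        have : δ - β = 2 * (δ * (1 / 2) - β / 2) := by field_simp
        rw [r1, sub_self, mul_zero] at this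
        exact (sub_eq_zero.1 this).symm
      subst hβ
      by_cases hδ : β = 0
      · subst hδ
        apply h.isListedAlgebra_three hd .T10 (hasTable_ofTable _ _ _ _ _) hli <;>
          simp [bv, he, hew, hev, hww, hvw, hvv]
      · obtain ⟨s, hs⟩ := IsAlgClosed.exists_eq_mul_self β
        have hs0 : s ≠ 0 := by rintro rfl; exact hδ (by rw [hs, mul_zero])
        have hww' : m (s⁻¹ • w) (s⁻¹ • w) = e + v := by
          simp only [map_smul, LinearMap.smul_apply, hww, hs, smul_smul, smul_add]
          have : s⁻¹ * (s⁻¹ * (s * s)) = 1 := by field_simp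
          rw [this, one_smul, one_smul]
        have hew' : m e (s⁻¹ • w) = (1 / 2 : k) • s⁻¹ • w := by rw [map_smul, hew, smul_comm]
        have hvw' : m v (s⁻¹ • w) = (1 / 2 : k) • s⁻¹ • w := by rw [map_smul, hvw, smul_comm]
        replace hli := hli.smul (inv_ne_zero hs0)
        generalize s⁻¹ • w = w' at *
        apply h.isListedAlgebra_three hd .T5 (hasTable_ofTable _ _ _ _ _) hli <;>
          simp [bv, he, hev, hww', hvv, hew', hvw']
  · have hγ : γ = 0 := by simpa using r2
    subst hγ
    have hβ : β = 0 := by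
      rw [mul_zero] at r1
      simpa [h2] using r1.symm
    subst hβ
    rw [zero_smul] at hvv hvw hwv
    rw [zero_smul, zero_add] at hww
    by_cases hδ : δ = 0
    · subst hδ
      apply h.isListedAlgebra_three hd .B2_U2 hasTable_B2_U2 hli.swap <;>
        simp [bv, he, hew, hev, hww, hwv, hvv]
    · apply h.isListedAlgebra_three hd .T8 (hasTable_ofTable _ _ _ _ _) (hli.swap.smul hδ) <;>
        simp [bv, he, hew, hev, hww, hwv, hvv]

include hd in
/-- `V_{1/2}` is two-dimensional. -/
lemma isListedAlgebra_of_half_half (h : IsJordanProduct m) (h2 : (2 : k) ≠ 0)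
    (he : m e e = e) (hli : Indep k e v w) (hev : m e v = (1 / 2 : k) • v)
    (hew : m e w = (1 / 2 : k) • w) : IsListedAlgebra 3 m := by
  -- All squares in `V_{1/2}` vanish, hence so do all products.
  have hsq : ∀ c, m e c = (1 / 2 : k) • c → m c c = 0 := by
    intro c hc
    obtain ⟨p, q, r, hcc⟩ := hli.exists_eq hd (m c c)
    have h1 := h.peirce_half he hc hc
    simp only [hcc, map_add, map_smul, he, hev, hew] at h1
    obtain ⟨-, h5, h6⟩ := hli 0 (q * (1 / 2) * (1 / 2) - q * (1 / 2))
      (r * (1 / 2) * (1 / 2) - r * (1 / 2)) (by linear_combination (norm := module) h1)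
    have hq := eq_zero_of_quarter_eq_half h2 h5
    have hr := eq_zero_of_quarter_eq_half h2 h6
    exact h.half_sq_eq_zero h2 hc he (α := p) (by rw [hcc, hq, hr]; module)
  have hvv := hsq v hev
  have hww := hsq w hew
  have hvw : m v w = 0 := by
    have := hsq (v + w) (by rw [map_add, hev, hew, smul_add])
    simp only [map_add, LinearMap.add_apply, hvv, hww, h.comm w v, zero_add, add_zero] at this
    rw [← two_smul k] at this
    exact (smul_eq_zero.1 this).resolve_left h2
  apply h.isListedAlgebra_three hd .T7 (hasTable_ofTable _ _ _ _ _) hli <;>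
    simp [bv, he, hew, hev, hww, hvw, hvv]

end Peirce

end IsJordanProduct
end Classification

/-! ### Jordan algebras of dimension three: the general case -/

section Classification

open Module Superalgebra JordanList

variable {k : Type u} [Field k] {V : Type*} [AddCommGroup V] [Module k V]

namespace IsJordanProduct

variable {m : V →ₗ[k] V →ₗ[k] V}

section Unital

variable {e v w : V}

/-- If no nonzero idempotent annihilates a nonzero vector, then the vectors `v` of `V₁` whose
square lies on the line through `e` satisfy `v² = 0`, since otherwise `e` would be the sum of two
orthogonal idempotents. -/
lemma sq_eq_zero_of_forall_idempotent [IsAlgClosed k] (h : IsJordanProduct m) (h2 : (2 : k) ≠ 0)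
    (hno : ∀ f u, m f f = f → m f u = 0 → f = 0 ∨ u = 0) (he : m e e = e)
    (hli : ∀ a b : k, a • e + b • v = 0 → a = 0 ∧ b = 0) (hev : m e v = v) {δ : k}
    (hv : m v v = δ • e) : m v v = 0 := by
  by_contra hδ
  obtain ⟨s, hs⟩ := IsAlgClosed.exists_eq_mul_self δ
  rw [hs] at hv
  have hs0 : s ≠ 0 := by rintro rfl; exact hδ (by rw [hv, mul_zero, zero_smul])
  obtain ⟨hf, hg, hfg⟩ := h.split_idempotent h2 he hev hs0 hv
  rcases hno _ _ hf hfg with h0 | h0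
  · exact one_div_ne_zero h2 (hli _ _ h0).1
  · exact one_div_ne_zero h2 (hli _ _ h0).1

variable [FiniteDimensional k V] (hd : finrank k V = 3)

include hd in
/-- Algebras with a nonzero idempotent `e` for which `V₀` is not zero. -/
lemma isListedAlgebra_of_zero [IsAlgClosed k] (h : IsJordanProduct m) (h2 : (2 : k) ≠ 0)
    (he : m e e = e) (he0 : e ≠ 0) (hv0 : v ≠ 0) (hev : m e v = 0) : IsListedAlgebra 3 m := by
  obtain ⟨w, hw, hew⟩ := h.exists_eigenvector_notMem h2 he (span_pair_ne_top hd.ge e v)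
  have hv : v ∉ Submodule.span k {e} := by
    rw [Submodule.mem_span_singleton]
    rintro ⟨a, rfl⟩
    rw [map_smul, he] at hev
    exact hv0 hev
  have hli := indep_of_notMem he0 hv hw
  rcases hew with hew | hew | hew
  · exact h.isListedAlgebra_of_zero_zero hd h2 he hli hev hew
  · exact h.isListedAlgebra_of_zero_half hd h2 he hli hev hew
  · exact h.isListedAlgebra_of_zero_one hd h2 he hli hev hew

include hd in
/-- `V₁` is two-dimensional and `V_{1/2}` is a line. -/
lemma isListedAlgebra_of_one_half [IsAlgClosed k] (h : IsJordanProduct m) (h2 : (2 : k) ≠ 0)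
    (hno : ∀ f u, m f f = f → m f u = 0 → f = 0 ∨ u = 0) (he : m e e = e)
    (hli : Indep k e w v) (hev : m e v = v) (hew : m e w = (1 / 2 : k) • w) :
    IsListedAlgebra 3 m := by
  obtain ⟨v, hli, hev, hvv⟩ : ∃ v', Indep k e w v' ∧ m e v' = v' ∧ m v' v' = 0 := by
    obtain ⟨a, b, c, hvv⟩ := hli.exists_eq hd (m v v)
    have h1 := h.peirce (γ := 1) (δ := 1) he (by rw [hev, one_smul]) (by rw [hev, one_smul])
    simp only [hvv, map_add, map_smul, he, hev, hew] at h1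
    have hb := (hli 0 (b / 2) 0 (by
      linear_combination (norm := skip) h1
      match_scalars <;> field_simp <;> ring)).2.1
    have hb : b = 0 := by simpa [h2] using hb
    obtain ⟨p, q⟩ := h.complete_square h2 he hev
      (show m v v = a • e + c • v by rw [hvv, hb]; module)
    have hli' := hli.add_smul (-(c / 2))
    refine ⟨_, hli', p, h.sq_eq_zero_of_forall_idempotent h2 hno he (fun x y hxy => ?_) p q⟩
    obtain ⟨h3, -, h4⟩ := hli' x 0 y (by rw [← hxy]; module)
    exact ⟨h3, h4⟩
  have hve : m v e = v := by rw [h.comm, hev]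
  have hwe : m w e = (1 / 2 : k) • w := by rw [h.comm, hew]
  obtain ⟨γ, hwv⟩ : ∃ γ : k, m w v = γ • w := by
    obtain ⟨p, q, r, hwv⟩ := hli.exists_eq hd (m w v)
    have h1 := h.peirce he hew (d := v) (δ := 1) (by rw [hev, one_smul])
    simp only [hwv, map_add, map_smul, he, hev, hew] at h1
    obtain ⟨h3, -, h4⟩ := hli (p / 2) 0 (r / 2) (by
      linear_combination (norm := skip) -h1
      match_scalars <;> field_simp <;> ring)
    have hp : p = 0 := by simpa [h2] using h3
    have hr : r = 0 := by simpa [h2] using h4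
    exact ⟨q, by rw [hwv, hp, hr]; module⟩
  have hvw : m v w = γ • w := by rw [h.comm, hwv]
  have hγ : γ = 0 := by
    have h1 := h.linearized v v v w
    simp only [hvv, hvw, hwv, map_smul, LinearMap.smul_apply, map_zero, LinearMap.zero_apply,
      smul_zero, add_zero, zero_add] at h1
    have h3 := (hli 0 (2 * γ ^ 3) 0 (by linear_combination (norm := module) -h1)).2.1
    simpa [h2] using h3
  rw [hγ, zero_smul] at hvw hwv
  obtain ⟨α, β, hww⟩ : ∃ α β : k, m w w = α • e + β • v := by
    obtain ⟨p, q, r, hww⟩ := hli.exists_eq hd (m w w)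
    have h1 := h.peirce_half he hew hew
    simp only [hww, map_add, map_smul, he, hev, hew] at h1
    have hq := eq_zero_of_quarter_eq_half h2 (hli 0 (q * (1 / 2) * (1 / 2) - q * (1 / 2)) 0
      (by linear_combination (norm := module) h1)).2.1
    exact ⟨p, r, by rw [hww, hq]; module⟩
  have hα : α = 0 := by
    have h1 := h.jordan w e
    simp only [hww, hew, hve, hvw, he, map_add, map_smul, LinearMap.add_apply,
      LinearMap.smul_apply, smul_zero, add_zero] at h1
    refine eq_zero_of_quarter_eq_half h2
      (hli 0 (α * (1 / 2) * (1 / 2) - α * (1 / 2)) 0 ?_).2.1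
    linear_combination (norm := module) h1
  rw [hα, zero_smul, zero_add] at hww
  by_cases hβ : β = 0
  · rw [hβ, zero_smul] at hww
    apply h.isListedAlgebra_three hd .T6 (hasTable_ofTable _ _ _ _ _) hli <;>
      simp [bv, he, hew, hev, hww, hwv, hvv]
  · apply h.isListedAlgebra_three hd .T9 (hasTable_ofTable _ _ _ _ _) (hli.smul hβ) <;>
      simp [bv, he, hew, hev, hww, hwv, hvv]

open Polynomial in
/-- If no nonzero idempotent annihilates a nonzero vector, then in a unital algebra each element
is the sum of a multiple of the unit and a nilpotent element: subtract an eigenvalue of the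
multiplication operator on the subalgebra that the element generates. -/
lemma exists_sub_smul_pow_eq_zero [IsAlgClosed k] (h : IsJordanProduct m)
    (hno : ∀ f u, m f f = f → m f u = 0 → f = 0 ∨ u = 0) (he : ∀ x, m e x = x) (he0 : e ≠ 0)
    (x : V) : ∃ t : k, (m (x - t • e) ^ finrank k V) (x - t • e) = 0 := by
  -- The range of `φ` is the subalgebra generated by `e` and `x`.
  let φ : k[X] →ₗ[k] V := (LinearMap.applyₗ e) ∘ₗ (aeval (m x)).toLinearMap
  have hφ : ∀ p, φ p = aeval (m x) p e := fun p => rfl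
  have hinv : ∀ z ∈ LinearMap.range φ, m x z ∈ LinearMap.range φ := by
    rintro _ ⟨p, rfl⟩
    exact ⟨X * p, by simp [hφ]⟩
  have : Nontrivial (LinearMap.range φ) :=
    ⟨⟨φ 1, 1, rfl⟩, 0, fun h0 => he0 (by simpa [hφ] using congrArg Subtype.val h0)⟩
  obtain ⟨t, ht⟩ := Module.End.exists_eigenvalue ((m x).restrict hinv)
  obtain ⟨⟨_, q, rfl⟩, hu, hu0⟩ := ht.exists_hasEigenvector
  have hu' : m x (φ q) = t • φ q := congrArg Subtype.val (Module.End.mem_eigenspace_iff.1 hu)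
  replace hu0 : φ q ≠ 0 := fun h0 => hu0 (Subtype.ext h0)
  refine ⟨t, ?_⟩
  have hmx : m x = aeval (m (x - t • e)) (X + C t) := by
    ext z
    simp [he, Module.algebraMap_end_apply]
  have hy : x - t • e = m (x - t • e) e := by rw [h.comm, he]
  have hxu : m (x - t • e) (φ q) = 0 := by
    rw [map_sub, LinearMap.sub_apply, hu', map_smul, LinearMap.smul_apply, he, sub_self]
  rw [hφ, hmx, ← aeval_comp] at hxu hu0
  generalize x - t • e = y at hy hxu hu0
  generalize q.comp (X + C t) = q' at hxu hu0
  by_cases hn : ∀ n, (m y ^ n) y ≠ 0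
  · obtain ⟨p, hp0, hp⟩ := h.exists_idempotent_of_pow_ne_zero y hn
    refine absurd ((hno _ (aeval (m y) q' e) hp ?_).resolve_left hp0) hu0
    -- The idempotent `p(y)y` annihilates the eigenvector, as its multiplication operator commutes
    -- with that of `y`.
    have hc : Commute (m (aeval (m y) p y)) (aeval (m y) q') :=
      Polynomial.induction_on' q' (fun p q hp hq => by simpa using hp.add_right hq)
        (fun n a => by
          simpa [aeval_monomial, ← Algebra.smul_def] using
            ((h.commute_aeval y p).pow_right n).smul_right a)
    have h1 := LinearMap.congr_fun hc.eq e
    rw [Module.End.mul_apply, Module.End.mul_apply, h.comm _ e, he] at h1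
    have h3 : aeval (m y) q' (aeval (m y) p y) = aeval (m y) p (m y (aeval (m y) q' e)) := by
      have h4 : aeval (m y) (q' * (p * X)) = aeval (m y) (p * (X * q')) := by congr 1; ring
      have h5 := LinearMap.congr_fun h4 e
      simp only [map_mul, Module.End.mul_apply, aeval_X] at h5
      rwa [← hy] at h5
    rw [h1, h3, hxu, map_zero]
  · push Not at hn
    obtain ⟨n, hn⟩ := hn
    exact Module.End.ker_pow_le_ker_pow_finrank (m y) n hn

include hd in
/-- The idempotent `e` is a unit. -/
lemma isListedAlgebra_of_unit [IsAlgClosed k] (h : IsJordanProduct m) (h2 : (2 : k) ≠ 0)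
    (hno : ∀ f u, m f f = f → m f u = 0 → f = 0 ∨ u = 0) (he : ∀ x, m e x = x)
    (hli : Indep k e v w) : IsListedAlgebra 3 m := by
  have he' : ∀ x, m x e = x := fun x => by rw [h.comm, he]
  have hnil := h.exists_sub_smul_pow_eq_zero hno he hli.ne_zero.1
  rw [hd] at hnil
  -- Either there is a nilpotent `n` with `n² ≠ 0`, and then `e`, `n`, `n²` is a basis, or all
  -- nilpotent elements square to zero.
  by_cases hsq : ∃ n, (m n ^ 3) n = 0 ∧ m n n ≠ 0
  · obtain ⟨n, hn, hnn⟩ := hsq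
    have h4 : m n (m n (m n n)) = 0 := hn
    have hli' : Indep k e n (m n n) := by
      intro a b c h0
      have h1 : a • n + b • m n n + c • m n (m n n) = 0 := by
        simpa [he'] using congrArg (m n) h0
      have h3 : a • m n n + b • m n (m n n) = 0 := by
        simpa [h4] using congrArg (m n) h1
      have h5 : a • m n (m n n) = 0 := by simpa [h4] using congrArg (m n) h3
      have ha : a = 0 := by
        by_contra ha
        rw [(smul_eq_zero.1 h5).resolve_left ha, smul_zero, add_zero] at h3
        exact hnn ((smul_eq_zero.1 h3).resolve_left ha)
      simp only [ha, zero_smul, zero_add] at h0 h1 h3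
      have hb : b = 0 := by
        by_contra hb
        rw [(smul_eq_zero.1 h3).resolve_left hb, smul_zero, add_zero] at h1
        exact hnn ((smul_eq_zero.1 h1).resolve_left hb)
      rw [hb, zero_smul, zero_add] at h0
      exact ⟨ha, hb, (smul_eq_zero.1 h0).resolve_right hnn⟩
    -- Multiplication by `n` maps `n³ = a e + b n + c n²` to zero, whence `c⁴ = 0`.
    have h3 : m n (m n n) = 0 := by
      obtain ⟨a, b, c, h3⟩ := hli'.exists_eq hd (m n (m n n))
      have h5 := h4
      rw [h3] at h5
      simp only [map_add, map_smul, he', h3] at h5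
      obtain ⟨h6, h7, h8⟩ := hli' (c * a) (a + c * b) (b + c * c)
        (by linear_combination (norm := module) h5)
      have hc : c ^ 4 = 0 := by linear_combination h6 - c * h7 + c ^ 2 * h8
      have hc : c = 0 := by simpa using hc
      subst hc
      have ha : a = 0 := by simpa using h7
      have hb : b = 0 := by simpa using h8
      rw [h3, ha, hb]; module
    have h5 : m (m n n) (m n n) = 0 := by
      have := h.mul_pow n 1 1
      simpa [pow_succ, h3] using this
    apply h.isListedAlgebra_three hd .T1 (hasTable_ofTable _ _ _ _ _) hli' <;>
      simp [bv, he, h3, h5]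
  · push Not at hsq
    obtain ⟨t, ht⟩ := hnil v
    obtain ⟨s, hs⟩ := hnil w
    have hli' : Indep k e (v - t • e) (w - s • e) := by
      convert ((hli.add_smul (-s)).swap.add_smul (-t)).swap using 1 <;> module
    replace ht := hsq _ ht
    replace hs := hsq _ hs
    generalize v - t • e = v at *
    generalize w - s • e = w at *
    -- The nilpotent elements `v + w - r e` and `v - w - q e` square to zero, which forces `r = 0`.
    have hvw : m v w = 0 := by
      obtain ⟨r, hr⟩ := hnil (v + w)
      obtain ⟨q, hq⟩ := hnil (v - w)
      replace hr := hsq _ hr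
      replace hq := hsq _ hq
      simp only [map_add, map_sub, map_smul, LinearMap.add_apply, LinearMap.sub_apply,
        LinearMap.smul_apply, he, he', ht, hs, h.comm w v] at hr hq
      obtain ⟨-, h3, h4⟩ := hli' (r ^ 2 + q ^ 2) (-(2 * r) - 2 * q) (-(2 * r) + 2 * q)
        (by linear_combination (norm := module) hr + hq)
      have h5 : 2 * (2 * r) = 0 := by linear_combination -h3 - h4
      have h6 : r = 0 := by simpa [h2] using h5
      have h7 : (2 : k) • m v w = 0 := by
        rw [h6] at hr
        linear_combination (norm := module) hr
      exact (smul_eq_zero.1 h7).resolve_left h2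
    apply h.isListedAlgebra_three hd .T2 (hasTable_ofTable _ _ _ _ _) hli' <;>
      simp [bv, he, ht, hs, hvw]

include hd in
/-- Algebras without nonzero idempotents. -/
lemma isListedAlgebra_of_pow_eq_zero [IsAlgClosed k] (h : IsJordanProduct m) (h2 : (2 : k) ≠ 0)
    (hnil : ∀ x, m x (m x (m x x)) = 0) : IsListedAlgebra 3 m := by
  by_cases hcube : ∃ x, m x (m x x) ≠ 0
  · obtain ⟨x, hx⟩ := hcube
    have h4 := hnil x
    have h22 : m (m x x) (m x x) = 0 := by simpa [pow_succ, h4] using h.mul_pow x 1 1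
    have h23 : m (m x x) (m x (m x x)) = 0 := by simpa [pow_succ, h4] using h.mul_pow x 1 2
    have h33 : m (m x (m x x)) (m x (m x x)) = 0 := by
      simpa [pow_succ, h4] using h.mul_pow x 2 2
    have hli : Indep k x (m x x) (m x (m x x)) := by
      intro a b c h0
      have h1 : a • m x x + b • m x (m x x) = 0 := by simpa [h4] using congrArg (m x) h0
      have h3 : a • m x (m x x) = 0 := by simpa [h4] using congrArg (m x) h1
      have ha := (smul_eq_zero.1 h3).resolve_right hx
      simp only [ha, zero_smul, zero_add] at h0 h1
      have hb := (smul_eq_zero.1 h1).resolve_right hx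
      rw [hb, zero_smul, zero_add] at h0
      exact ⟨ha, hb, (smul_eq_zero.1 h0).resolve_right hx⟩
    apply h.isListedAlgebra_three hd .T3 (hasTable_ofTable _ _ _ _ _) hli <;>
      simp [bv, h4, h22, h23, h33]
  push Not at hcube
  by_cases hsq : ∃ x, m x x ≠ 0
  swap
  · push Not at hsq
    have b := finBasisOfFinrankEq k V hd
    have hli : Indep k (b 0) (b 1) (b 2) := by
      rw [Indep, ← linearIndependent_triple_iff]
      convert b.linearIndependent using 1
      ext i; fin_cases i <;> rfl
    apply h.isListedAlgebra_three hd .U2_U2_U2 hasTable_U2_U2_U2 hli <;>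
      simp [h.mul_eq_zero_of_sq h2 hsq]
  obtain ⟨x, hx⟩ := hsq
  -- From here on `a³ = 0` for all `a`; this is its linearization.
  have C1 : ∀ a b, m (m a a) b = -(2 : k) • m a (m a b) := by
    intro a b
    have h1 := hcube (a + b)
    have h3 := hcube (a - b)
    simp only [map_add, map_sub, LinearMap.add_apply, LinearMap.sub_apply, hcube, h.comm b a,
      h.comm b (m a a)] at h1 h3
    have : (2 : k) • (m (m a a) b + (2 : k) • m a (m a b)) = 0 := by
      linear_combination (norm := module) h1 - h3
    have := (smul_eq_zero.1 this).resolve_left h2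
    linear_combination (norm := module) this
  have hL : ∀ a b, m a (m a (m a b)) = 0 := by
    intro a b
    have h1 := h.linearized a a a b
    rw [h.comm (m a b) (m a a), h.comm (m a a) a, hcube, h.comm (m (m a b) a) a, h.comm (m a b) a,
      C1 a (m a b)] at h1
    simp only [map_zero, LinearMap.zero_apply, zero_add] at h1
    have : (2 * (2 * 2) : k) • m a (m a (m a b)) = 0 := by
      linear_combination (norm := module) -h1
    exact (smul_eq_zero.1 this).resolve_left (mul_ne_zero h2 (mul_ne_zero h2 h2))
  obtain ⟨y, hy⟩ := SetLike.exists_of_lt (lt_top_iff_ne_top.2 (span_pair_ne_top hd.ge x (m x x)))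
  have hx0 : x ≠ 0 := by rintro rfl; exact hx (by simp)
  have hli : Indep k x (m x x) y := by
    refine indep_of_notMem hx0 ?_ hy.2
    rw [Submodule.mem_span_singleton]
    rintro ⟨a, ha⟩
    have h1 := hcube x
    rw [← ha, map_smul] at h1
    rcases smul_eq_zero.1 h1 with h3 | h3
    · exact hx (by rw [← ha, h3, zero_smul])
    · exact hx h3
  -- Add a multiple of `x` to `y` so that `x y` becomes a multiple of `x`.
  obtain ⟨y, hli, α, hxy⟩ : ∃ y', Indep k x (m x x) y' ∧ ∃ α : k, m x y' = α • x := by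
    obtain ⟨α, β, γ, hxy⟩ := hli.exists_eq hd (m x y)
    have h1 := hL x y
    simp only [hxy, map_add, map_smul, hcube, smul_zero, add_zero] at h1
    have h3 := (hli (γ * γ * α) (γ * α + γ * γ * β) (γ * γ * γ) (by
      linear_combination (norm := module) h1)).2.2
    have hγ : γ = 0 := by simpa using h3
    refine ⟨_, hli.add_smul (-β), α, ?_⟩
    rw [map_add, map_smul, hxy, hγ]; module
  have hyx : m y x = α • x := by rw [h.comm, hxy]
  have hα : α = 0 := by
    have h1 := hL y x
    simp only [hyx, map_smul, smul_smul] at h1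
    simpa [hx0] using h1
  rw [hα, zero_smul] at hxy hyx
  have hny : m (m x x) y = 0 := by rw [C1, hxy, map_zero, smul_zero]
  have hnn : m (m x x) (m x x) = 0 := by rw [C1, hcube, map_zero, smul_zero]
  have hxn := hcube x
  obtain ⟨b, hyy⟩ : ∃ b : k, m y y = b • m x x := by
    obtain ⟨a, b, c, hyy⟩ := hli.exists_eq hd (m y y)
    have ha : a = 0 := by
      have h1 := C1 y x
      simp only [hyy, map_add, map_smul, LinearMap.add_apply, LinearMap.smul_apply, hyx, map_zero,
        smul_zero, add_zero, h.comm (m x x) x, hxn] at h1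
      exact (smul_eq_zero.1 h1).resolve_right hx
    have hc : c = 0 := by
      have h1 := hcube y
      rw [hyy] at h1
      simp only [map_add, map_smul, h.comm y (m x x), hyx, hny, smul_zero, zero_add, hyy] at h1
      have h3 := (hli (c * a) (c * b) (c * c) (by rw [← h1]; module)).2.2
      simpa using h3
    exact ⟨b, by rw [hyy, ha, hc]; module⟩
  by_cases hb : b = 0
  · rw [hb, zero_smul] at hyy
    apply h.isListedAlgebra_three hd .B3_U2 hasTable_B3_U2 hli <;>
      simp [bv, hxn, hxy, hny, hnn, hyy]
  · -- If `t² b = -1`, then `x + t y` squares to zero.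
    obtain ⟨t, ht⟩ := IsAlgClosed.exists_eq_mul_self (-b⁻¹)
    have ht0 : t ≠ 0 := by
      rintro rfl
      exact inv_ne_zero hb (by simpa using ht)
    have htb : t * (t * b) = -1 := by
      rw [← mul_assoc, ← ht]; field_simp
    apply h.isListedAlgebra_three hd .T4 (hasTable_ofTable _ _ _ _ _)
      ((hli.smul ht0).add_smul 1) <;>
      simp [bv, hxn, hxy, hyx, hny, hnn, hyy, h.comm (m x x) x, smul_smul, htb]

end Unital

lemma isListedAlgebra_of_finrank_one (hd : finrank k V = 1) (m : V →ₗ[k] V →ₗ[k] V) :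
    IsListedAlgebra 1 m := by
  obtain ⟨x, hx, hxx⟩ := exists_of_finrank_one hd m
  have hb : ∀ t : Fin 1 → Fin 1 → Fin 1 → k, m x x = t 0 0 0 • x → HasMulTable m t := by
    intro t ht
    refine ⟨basisOfLinearIndependentOfCardEqFinrank (b := ![x]) (by simpa) (by simp [hd]),
      fun i j => ?_⟩
    rw [coe_basisOfLinearIndependentOfCardEqFinrank]
    fin_cases i; fin_cases j; simpa using ht
  rcases hxx with hxx | hxx
  · exact ⟨_, _, _, _, .U1, hasTable_U1, hb _ (by simp [bv, hxx])⟩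
  · exact ⟨_, _, _, _, .U2, hasTable_U2, hb _ (by simp [hxx])⟩

lemma isListedAlgebra_of_finrank_two [IsAlgClosed k] [FiniteDimensional k V]
    (h : IsJordanProduct m) (h2 : (2 : k) ≠ 0) (hd : finrank k V = 2) : IsListedAlgebra 2 m := by
  obtain ⟨x, y, hli, hcases⟩ := h.exists_of_finrank_two h2 hd
  rcases hcases with ⟨xx, xy, yy⟩ | ⟨xx, xy, yy⟩ | ⟨xx, xy, yy⟩ | ⟨xx, xy, yy⟩ |
    ⟨xx, xy, yy⟩ | ⟨xx, xy, yy⟩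
  · refine ⟨_, _, _, _, .B1, hasTable_B1, hasMulTable_two h.comm hd hli ?_ ?_ ?_ ?_⟩ <;>
      simp [bv, xx, xy, yy]
  · refine ⟨_, _, _, _, .B2, hasTable_B2, hasMulTable_two h.comm hd hli ?_ ?_ ?_ ?_⟩ <;>
      simp [bv, xx, xy, yy]
  · refine ⟨_, _, _, _, .B3, hasTable_B3, hasMulTable_two h.comm hd hli ?_ ?_ ?_ ?_⟩ <;>
      simp [bv, xx, xy, yy]
  · refine ⟨_, _, _, _, .U1_U1, hasTable_U1_U1, hasMulTable_two h.comm hd hli ?_ ?_ ?_ ?_⟩ <;>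
      simp [bv, xx, xy, yy]
  · refine ⟨_, _, _, _, .U1_U2, hasTable_U1_U2, hasMulTable_two h.comm hd hli ?_ ?_ ?_ ?_⟩ <;>
      simp [bv, xx, xy, yy]
  · refine ⟨_, _, _, _, .U2_U2, hasTable_U2_U2, hasMulTable_two h.comm hd hli ?_ ?_ ?_ ?_⟩ <;>
      simp [xx, xy, yy]

/-- Jordan algebras of dimension three. -/
lemma isListedAlgebra_of_finrank_three [IsAlgClosed k] [FiniteDimensional k V]
    (h : IsJordanProduct m) (h2 : (2 : k) ≠ 0) (hd : finrank k V = 3) : IsListedAlgebra 3 m := by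
  by_cases hno : ∀ f u, m f f = f → m f u = 0 → f = 0 ∨ u = 0
  swap
  · push Not at hno
    obtain ⟨f, u, hf, hfu, hf0, hu0⟩ := hno
    exact h.isListedAlgebra_of_zero hd h2 hf hf0 hu0 hfu
  by_cases hid : ∀ e, m e e = e → e = 0
  · have hnil := h.pow_finrank_eq_zero hid
    rw [hd] at hnil
    exact h.isListedAlgebra_of_pow_eq_zero hd h2 hnil
  push Not at hid
  obtain ⟨e, he, he0⟩ := hid
  obtain ⟨v, hv, hev⟩ := h.exists_eigenvector_notMem h2 he
    (span_singleton_ne_top (by omega) e)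
  obtain ⟨w, hw, hew⟩ := h.exists_eigenvector_notMem h2 he (span_pair_ne_top hd.ge e v)
  have hli := indep_of_notMem he0 hv hw
  have hzero : ∀ u, m e u = 0 → u = 0 := fun u hu => (hno e u he hu).resolve_left he0
  replace hev := hev.resolve_left fun h0 => hli.ne_zero.2.1 (hzero v h0)
  replace hew := hew.resolve_left fun h0 => hli.ne_zero.2.2 (hzero w h0)
  rcases hev with hev | hev <;> rcases hew with hew | hew
  · exact h.isListedAlgebra_of_half_half hd h2 he hli hev hew
  · exact h.isListedAlgebra_of_one_half hd h2 hno he hli hew hev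
  · exact h.isListedAlgebra_of_one_half hd h2 hno he hli.swap hev hew
  · refine h.isListedAlgebra_of_unit hd h2 hno (fun x => ?_) hli
    obtain ⟨a, b, c, rfl⟩ := hli.exists_eq hd x
    simp only [map_add, map_smul, he, hev, hew]

end IsJordanProduct
end Classification

/-! ### The even and the odd part of a Jordan superalgebra -/

namespace Superalgebra

open Module JordanList

variable {k : Type u} [Field k] {J : Superalgebra.{u, v} k}

lemma mul_even_even {a b : J.carrier} (ha : a ∈ J.part 0) (hb : b ∈ J.part 0) :
    J.mul a b ∈ J.part 0 := by
  simpa using J.mul_mem ha hb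

lemma mul_even_odd {a b : J.carrier} (ha : a ∈ J.part 0) (hb : b ∈ J.part 1) :
    J.mul a b ∈ J.part 1 := by
  simpa using J.mul_mem ha hb

lemma mul_odd_odd {a b : J.carrier} (ha : a ∈ J.part 1) (hb : b ∈ J.part 1) :
    J.mul a b ∈ J.part 0 :=
  J.mul_mem ha hb

namespace IsJordan

lemma even_comm (hJ : J.IsJordan) {a b : J.carrier} (ha : a ∈ J.part 0) (hb : b ∈ J.part 0) :
    J.mul a b = J.mul b a := by
  simpa using hJ.super_comm 0 0 a ha b hb

lemma odd_even_comm (hJ : J.IsJordan) {a b : J.carrier} (ha : a ∈ J.part 1) (hb : b ∈ J.part 0) :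
    J.mul a b = J.mul b a := by
  simpa using hJ.super_comm 1 0 a ha b hb

lemma odd_anticomm (hJ : J.IsJordan) {a b : J.carrier} (ha : a ∈ J.part 1) (hb : b ∈ J.part 1) :
    J.mul a b = -J.mul b a := by
  simpa [ZMod.val_one] using hJ.super_comm 1 1 a ha b hb

lemma odd_sq (hJ : J.IsJordan) (h2 : (2 : k) ≠ 0) {a : J.carrier} (ha : a ∈ J.part 1) :
    J.mul a a = 0 := by
  have h := hJ.odd_anticomm ha ha
  have : (2 : k) • J.mul a a = 0 := by
    rw [two_smul]; nth_rewrite 1 [h]; exact neg_add_cancel _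
  exact (smul_eq_zero.1 this).resolve_left h2

/-- The product of the even part. -/
lemma exists_evenProduct (hJ : J.IsJordan) :
    ∃ m : J.part 0 →ₗ[k] J.part 0 →ₗ[k] J.part 0,
      (∀ x y, (m x y : J.carrier) = J.mul x y) ∧ IsJordanProduct m := by
  refine ⟨LinearMap.mk₂ k (fun x y => ⟨J.mul x y, mul_even_even x.2 y.2⟩) ?_ ?_ ?_ ?_,
    fun x y => rfl, ?_⟩
  · intros; ext; simp
  · intros; ext; simp
  · intros; ext; simp
  · intros; ext; simp
  · constructor
    · intro a b; ext; exact hJ.even_comm a.2 b.2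
    · intro a b; ext; exact hJ.even_jordan _ a.2 _ b.2
    · intro a b c d; ext
      simpa using hJ.super_jordan 0 0 0 0 a a.2 b b.2 c c.2 d d.2

/-- The Jordan identity for the action of the even part on the odd part. -/
lemma action_identity (hJ : J.IsJordan) {a b c o : J.carrier} (ha : a ∈ J.part 0)
    (hb : b ∈ J.part 0) (hc : c ∈ J.part 0) (ho : o ∈ J.part 1) :
    J.mul (J.mul a b) (J.mul c o) + J.mul (J.mul a c) (J.mul b o) + J.mul (J.mul b c) (J.mul a o)
      = J.mul (J.mul (J.mul a b) c) o + J.mul b (J.mul c (J.mul a o))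
        + J.mul a (J.mul c (J.mul b o)) := by
  have h := hJ.super_jordan 0 0 0 1 a ha b hb c hc o ho
  simp only [ZMod.val_zero, ZMod.val_one, mul_one, mul_zero, add_zero, pow_zero,
    one_smul] at h
  rw [hJ.odd_even_comm (mul_even_odd ha ho) (mul_even_even hb hc),
    hJ.odd_even_comm (mul_even_odd ha ho) hc, hJ.odd_even_comm (mul_even_odd hb ho) hc,
    hJ.odd_even_comm (mul_even_odd hc (mul_even_odd ha ho)) hb,
    hJ.odd_even_comm (mul_even_odd hc (mul_even_odd hb ho)) ha] at h
  exact h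

/-- The Peirce relation for the product of two odd eigenvectors of an idempotent. -/
lemma odd_peirce (hJ : J.IsJordan) {e o o' : J.carrier} (he : e ∈ J.part 0)
    (hee : J.mul e e = e) (ho : o ∈ J.part 1) (ho' : o' ∈ J.part 1) {γ δ : k}
    (heo : J.mul e o = γ • o) (heo' : J.mul e o' = δ • o') :
    (1 - 2 * δ) • J.mul e (J.mul o o') = (γ * (1 - 2 * δ)) • J.mul o o' := by
  have h := hJ.super_jordan 0 0 1 1 e he e he o ho o' ho'
  simp only [ZMod.val_zero, ZMod.val_one, mul_one, mul_zero, add_zero, zero_add,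
    pow_zero, pow_one, one_smul, hee, heo, heo', map_smul, LinearMap.smul_apply,
    hJ.odd_anticomm ho' ho, hJ.even_comm (mul_odd_odd ho ho') he, LinearMap.neg_apply,
    map_neg] at h
  linear_combination (norm := module) h

end IsJordan

/-- `J` is isomorphic to one of the superalgebras of type `(n, m)` in the list. -/
def IsListed (J : Superalgebra.{u, v} k) (n m : ℕ) : Prop :=
  ∃ S : Superalgebra.{u, u} k, Listed k n m S ∧ J.Isomorphic S

lemma isListed_of_isListedAlgebra {n : ℕ} {p : J.part 0 →ₗ[k] J.part 0 →ₗ[k] J.part 0}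
    (hp : ∀ x y, (p x y : J.carrier) = J.mul x y) [FiniteDimensional k J.carrier]
    (h1 : finrank k (J.part 1) = 0) (h : IsListedAlgebra n p) : J.IsListed n 0 := by
  obtain ⟨S, t, eo, oo, hS, hT, b, hb⟩ := h
  refine ⟨S, hS, HasTable.isomorphic
    (hasTable_of_bases b (finBasisOfFinrankEq k _ h1) (fun i j => ?_) (fun i j => j.elim0)
      (fun i j => j.elim0) (fun i j => i.elim0)) hT⟩
  rw [← hp, hb]
  simp

section Mixed

variable {S : Superalgebra.{u, u} k}

/-- If the even part is zero, then all products are zero. -/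
lemma isListed_zero_of_finrank [FiniteDimensional k J.carrier] {n : ℕ} (h0 : finrank k (J.part 0) = 0)
    (h1 : finrank k (J.part 1) = n) (hS : Listed k 0 n S) (hT : S.HasTable 0 n 0 0 0) :
    J.IsListed 0 n := by
  have hz : J.part 0 = ⊥ := Submodule.finrank_eq_zero.1 h0
  refine ⟨S, hS, HasTable.isomorphic
    (hasTable_of_bases (finBasisOfFinrankEq k _ h0) (finBasisOfFinrankEq k _ h1)
      (fun i j => i.elim0) (fun i j => i.elim0) (fun i j => i.elim0) (fun i j => ?_)) hT⟩
  have := mul_odd_odd (finBasisOfFinrankEq k _ h1 i).2 (finBasisOfFinrankEq k _ h1 j).2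
  rw [hz, Submodule.mem_bot] at this
  simpa using this

lemma IsJordan.isListed_one_one_of_table (hJ : J.IsJordan) (h2 : (2 : k) ≠ 0)
    (h0 : finrank k (J.part 0) = 1) (h1 : finrank k (J.part 1) = 1)
    {ee : Fin 1 → Fin 1 → Fin 1 → k} {eo : Fin 1 → Fin 1 → Fin 1 → k} (hS : Listed k 1 1 S)
    (hT : S.HasTable 1 1 ee eo 0) {e : J.part 0} {o : J.part 1} (he : e ≠ 0) (ho : o ≠ 0)
    (hee : J.mul e e = ee 0 0 0 • (e : J.carrier))
    (heo : J.mul e o = eo 0 0 0 • (o : J.carrier)) : J.IsListed 1 1 := by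
  refine ⟨S, hS, HasTable.isomorphic
    (hasTable_of_bases
      (basisOfLinearIndependentOfCardEqFinrank (b := ![e]) (by simpa) (by simp [h0]))
      (basisOfLinearIndependentOfCardEqFinrank (b := ![o]) (by simpa) (by simp [h1]))
      ?_ ?_ ?_ ?_) hT⟩ <;> intro i j <;>
    rw [coe_basisOfLinearIndependentOfCardEqFinrank] <;>
    try rw [coe_basisOfLinearIndependentOfCardEqFinrank]
  all_goals fin_cases i; fin_cases j
  · simpa using hee
  · simpa using heo
  · simpa [hJ.odd_even_comm o.2 e.2] using heo
  · simpa using hJ.odd_sq h2 o.2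

lemma IsJordan.isListed_two_one_of_table (hJ : J.IsJordan) (h2 : (2 : k) ≠ 0)
    (h0 : finrank k (J.part 0) = 2) (h1 : finrank k (J.part 1) = 1)
    {ee : Fin 2 → Fin 2 → Fin 2 → k} {eo : Fin 2 → Fin 1 → Fin 1 → k} (hS : Listed k 2 1 S)
    (hT : S.HasTable 2 1 ee eo 0) {x y : J.part 0} {o : J.part 1}
    (hli : LinearIndependent k ![x, y]) (ho : o ≠ 0)
    (xx : J.mul x x = ee 0 0 0 • (x : J.carrier) + ee 0 0 1 • (y : J.carrier))
    (xy : J.mul x y = ee 0 1 0 • (x : J.carrier) + ee 0 1 1 • (y : J.carrier))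
    (yy : J.mul y y = ee 1 1 0 • (x : J.carrier) + ee 1 1 1 • (y : J.carrier))
    (xo : J.mul x o = eo 0 0 0 • (o : J.carrier)) (yo : J.mul y o = eo 1 0 0 • (o : J.carrier))
    (hsymm : ee 1 0 = ee 0 1) : J.IsListed 2 1 := by
  refine ⟨S, hS, HasTable.isomorphic
    (hasTable_of_bases (basisOfLinearIndependentOfCardEqFinrank hli (by simp [h0]))
      (basisOfLinearIndependentOfCardEqFinrank (b := ![o]) (by simpa) (by simp [h1]))
      ?_ ?_ ?_ ?_) hT⟩ <;> intro i j <;>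
    rw [coe_basisOfLinearIndependentOfCardEqFinrank] <;>
    try rw [coe_basisOfLinearIndependentOfCardEqFinrank]
  · fin_cases i <;> fin_cases j <;>
      simp [xx, xy, yy, hJ.even_comm y.2 x.2, hsymm]
  · fin_cases i <;> fin_cases j <;> simp [xo, yo]
  · fin_cases i <;> fin_cases j <;>
      simp [xo, yo, hJ.odd_even_comm o.2 x.2, hJ.odd_even_comm o.2 y.2]
  · fin_cases i; fin_cases j; simpa using hJ.odd_sq h2 o.2

lemma IsJordan.isListed_one_two_of_table (hJ : J.IsJordan) (h2 : (2 : k) ≠ 0)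
    (h0 : finrank k (J.part 0) = 1) (h1 : finrank k (J.part 1) = 2)
    {ee : Fin 1 → Fin 1 → Fin 1 → k} {eo : Fin 1 → Fin 2 → Fin 2 → k}
    {oo : Fin 2 → Fin 2 → Fin 1 → k} (hS : Listed k 1 2 S)
    (hT : S.HasTable 1 2 ee eo oo) {e : J.part 0} {a b : J.part 1}
    (he : e ≠ 0) (hli : LinearIndependent k ![a, b])
    (hee : J.mul e e = ee 0 0 0 • (e : J.carrier))
    (ea : J.mul e a = eo 0 0 0 • (a : J.carrier) + eo 0 0 1 • (b : J.carrier))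
    (eb : J.mul e b = eo 0 1 0 • (a : J.carrier) + eo 0 1 1 • (b : J.carrier))
    (ab : J.mul a b = oo 0 1 0 • (e : J.carrier))
    (oo0 : oo 0 0 0 = 0) (oo1 : oo 1 1 0 = 0) (hanti : oo 1 0 0 = -oo 0 1 0) :
    J.IsListed 1 2 := by
  refine ⟨S, hS, HasTable.isomorphic
    (hasTable_of_bases
      (basisOfLinearIndependentOfCardEqFinrank (b := ![e]) (by simpa) (by simp [h0]))
      (basisOfLinearIndependentOfCardEqFinrank hli (by simp [h1]))
      ?_ ?_ ?_ ?_) hT⟩ <;> intro i j <;>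
    rw [coe_basisOfLinearIndependentOfCardEqFinrank] <;>
    try rw [coe_basisOfLinearIndependentOfCardEqFinrank]
  · fin_cases i; fin_cases j; simpa using hee
  · fin_cases i; fin_cases j <;> simp [ea, eb]
  · fin_cases i; fin_cases j <;>
      simp [ea, eb, hJ.odd_even_comm a.2 e.2, hJ.odd_even_comm b.2 e.2]
  · fin_cases i <;> fin_cases j <;>
      simp [hJ.odd_sq h2 a.2, hJ.odd_sq h2 b.2, ab, hJ.odd_anticomm b.2 a.2, oo0, oo1, hanti]

/-- If the odd part is a line spanned by `o`, then `a o = wt(a) o` for even `a`, and the identity for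
the action becomes a cubic equation for the weight `wt`. The value of `wt` matters only on the even
part. -/
lemma IsJordan.exists_weight (hJ : J.IsJordan) (h1 : finrank k (J.part 1) = 1) :
    ∃ (o : J.part 1) (wt : J.carrier → k), o ≠ 0 ∧ wt 0 = 0 ∧
      (∀ a ∈ J.part 0, J.mul a o = wt a • (o : J.carrier)) ∧
      ∀ a ∈ J.part 0, ∀ b ∈ J.part 0, ∀ c ∈ J.part 0,
        wt (J.mul a b) * wt c + wt (J.mul a c) * wt b + wt (J.mul b c) * wt a
          = wt (J.mul (J.mul a b) c) + 2 * wt a * wt b * wt c := by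
  obtain ⟨o, ho, hs⟩ := finrank_eq_one_iff'.1 h1
  have hex : ∀ a : J.carrier, ∃ t : k, a ∈ J.part 0 → J.mul a o = t • (o : J.carrier) := by
    intro a
    by_cases ha : a ∈ J.part 0
    · obtain ⟨t, ht⟩ := hs ⟨J.mul a o, mul_even_odd ha o.2⟩
      exact ⟨t, fun _ => (congrArg Subtype.val ht).symm⟩
    · exact ⟨0, fun h => absurd h ha⟩
  choose wt hwt using hex
  have ho' : (o : J.carrier) ≠ 0 := fun h0 => ho (Subtype.ext h0)
  have h0 : wt 0 = 0 := by
    have := hwt 0 (zero_mem _)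
    rw [map_zero, LinearMap.zero_apply] at this
    exact (smul_eq_zero.1 this.symm).resolve_right ho'
  refine ⟨o, wt, ho, h0, hwt, fun a ha b hb c hc => ?_⟩
  have h := hJ.action_identity ha hb hc o.2
  simp only [hwt a ha, hwt b hb, hwt c hc, map_smul, hwt _ (mul_even_even ha hb),
    hwt _ (mul_even_even ha hc), hwt _ (mul_even_even hb hc),
    hwt _ (mul_even_even (mul_even_even ha hb) hc)] at h
  apply smul_left_injective k ho'
  linear_combination (norm := module) h

/-- The possible weights of an idempotent. -/
lemma weight_idempotent (h2 : (2 : k) ≠ 0) {t : k} (h : t * t + t * t + t * t = t + 2 * t * t * t) :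
    t = 0 ∨ t = 1 / 2 ∨ t = 1 := by
  have : t * ((2 * t - 1) * (t - 1)) = 0 := by linear_combination -h
  rcases mul_eq_zero.1 this with h0 | h0
  · exact Or.inl h0
  rcases mul_eq_zero.1 h0 with h0 | h0
  · exact Or.inr (Or.inl (by field_simp; linear_combination h0))
  · exact Or.inr (Or.inr (sub_eq_zero.1 h0))

end Mixed

end Superalgebra

/-! ### Jordan superalgebras of mixed type -/

namespace Superalgebra

open Module JordanList

variable {k : Type u} [Field k] {J : Superalgebra.{u, v} k}

lemma IsJordan.isListed_one_one (hJ : J.IsJordan) (h2 : (2 : k) ≠ 0)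
    (h0 : finrank k (J.part 0) = 1) (h1 : finrank k (J.part 1) = 1) : J.IsListed 1 1 := by
  obtain ⟨m, hm, h⟩ := hJ.exists_evenProduct
  obtain ⟨o, wt, ho, wt0, hwt, hid⟩ := hJ.exists_weight h1
  obtain ⟨x, hx, hxx⟩ := IsJordanProduct.exists_of_finrank_one h0 m
  simp only [Subtype.ext_iff, hm, Submodule.coe_zero] at hxx
  have hxo := hwt x x.2
  have h3 := hid x x.2 x x.2 x x.2
  rcases hxx with hxx | hxx
  · simp only [hxx] at h3
    rcases weight_idempotent h2 h3 with ht | ht | ht <;> rw [ht] at hxo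
    · apply hJ.isListed_one_one_of_table h2 h0 h1 .U1_S hasTable_U1_S hx ho <;>
        simp [bv, hxx, hxo]
    · apply hJ.isListed_one_one_of_table h2 h0 h1 .S2_1 hasTable_S2_1 hx ho <;>
        simp [bv, hxx, hxo]
    · apply hJ.isListed_one_one_of_table h2 h0 h1 .S2_2 hasTable_S2_2 hx ho <;>
        simp [bv, hxx, hxo]
  · have ht : wt x = 0 := by simpa [hxx, wt0, h2] using h3
    rw [ht] at hxo
    apply hJ.isListed_one_one_of_table h2 h0 h1 .U2_S hasTable_U2_S hx ho <;>
      simp [hxx, hxo]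

/-- Type `(2, 1)`: the two-dimensional even part is known, and it remains to find its weights on the
odd line. -/
lemma IsJordan.isListed_two_one [IsAlgClosed k] [FiniteDimensional k J.carrier]
    (hJ : J.IsJordan) (h2 : (2 : k) ≠ 0)
    (h0 : finrank k (J.part 0) = 2) (h1 : finrank k (J.part 1) = 1) : J.IsListed 2 1 := by
  obtain ⟨m, hm, h⟩ := hJ.exists_evenProduct
  obtain ⟨o, wt, ho, wt0, hwt, hid⟩ := hJ.exists_weight h1
  obtain ⟨x, y, hli, hcases⟩ := h.exists_of_finrank_two h2 h0
  have hli' : LinearIndependent k ![y, x] := LinearIndependent.pair_symm_iff.1 hli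
  simp only [Subtype.ext_iff, hm, Submodule.coe_zero, Submodule.coe_smul] at hcases
  have hxo := hwt x x.2
  have hyo := hwt y y.2
  have hwx := hid x x.2 x x.2 x x.2
  have hwy := hid y y.2 y y.2 y y.2
  rcases hcases with ⟨xx, xy, yy⟩ | ⟨xx, xy, yy⟩ | ⟨xx, xy, yy⟩ | ⟨xx, xy, yy⟩ |
    ⟨xx, xy, yy⟩ | ⟨xx, xy, yy⟩
  · have hy : wt y = 0 := by simpa [yy, wt0, h2] using hwy
    simp only [xx] at hwx
    rw [hy] at hyo
    rcases weight_idempotent h2 hwx with ht | ht | ht <;> rw [ht] at hxo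
    · apply hJ.isListed_two_one_of_table h2 h0 h1 .B1_S hasTable_B1_S hli ho <;>
        simp [bv, xx, xy, yy, hxo, hyo]
    · apply hJ.isListed_two_one_of_table h2 h0 h1 .S3_9 (hasTable_ofTable _ _ _ _ _) hli ho <;>
        simp [bv, xx, xy, yy, hxo, hyo]
    · apply hJ.isListed_two_one_of_table h2 h0 h1 .S3_10 (hasTable_ofTable _ _ _ _ _) hli ho <;>
        simp [bv, xx, xy, yy, hxo, hyo]
  · have hy : wt y = 0 := by simpa [yy, wt0, h2] using hwy
    simp only [xx] at hwx
    rw [hy] at hyo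
    rcases weight_idempotent h2 hwx with ht | ht | ht <;> rw [ht] at hxo
    · apply hJ.isListed_two_one_of_table h2 h0 h1 .B2_S hasTable_B2_S hli ho <;>
        simp [bv, xx, xy, yy, hxo, hyo]
    · apply hJ.isListed_two_one_of_table h2 h0 h1 .S3_11 (hasTable_ofTable _ _ _ _ _) hli ho <;>
        simp [bv, xx, xy, yy, hxo, hyo]
    · apply hJ.isListed_two_one_of_table h2 h0 h1 .S3_12 (hasTable_ofTable _ _ _ _ _) hli ho <;>
        simp [bv, xx, xy, yy, hxo, hyo]
  · have hy : wt y = 0 := by simpa [yy, wt0, h2] using hwy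
    have hx : wt x = 0 := by
      simpa [xx, hJ.even_comm y.2 x.2, xy, hy, wt0, h2] using hwx
    rw [hx] at hxo
    rw [hy] at hyo
    apply hJ.isListed_two_one_of_table h2 h0 h1 .B3_S hasTable_B3_S hli ho <;>
      simp [bv, xx, xy, yy, hxo, hyo]
  · simp only [xx] at hwx
    simp only [yy] at hwy
    have yx : J.mul y x = 0 := by rw [hJ.even_comm y.2 x.2, xy]
    have h3 := hid x x.2 x x.2 y y.2
    have h4 := hid y y.2 y y.2 x x.2
    simp only [xx, xy, wt0, zero_mul, add_zero, zero_add] at h3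
    simp only [yy, yx, wt0, zero_mul, add_zero, zero_add] at h4
    rcases weight_idempotent h2 hwx with ht | ht | ht <;>
      rcases weight_idempotent h2 hwy with hs | hs | hs <;>
      rw [ht] at hxo h3 h4 <;> rw [hs] at hyo h3 h4
    · apply hJ.isListed_two_one_of_table h2 h0 h1 .U1_U1_S hasTable_U1_U1_S hli ho <;>
        simp [bv, xx, xy, yy, hxo, hyo]
    · apply hJ.isListed_two_one_of_table h2 h0 h1 .S2_1_U1 hasTable_S2_1_U1 hli' ho <;>
        simp [bv, xx, yx, yy, hxo, hyo]
    · apply hJ.isListed_two_one_of_table h2 h0 h1 .S2_2_U1 hasTable_S2_2_U1 hli' ho <;>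
        simp [bv, xx, yx, yy, hxo, hyo]
    · apply hJ.isListed_two_one_of_table h2 h0 h1 .S2_1_U1 hasTable_S2_1_U1 hli ho <;>
        simp [bv, xx, xy, yy, hxo, hyo]
    · apply hJ.isListed_two_one_of_table h2 h0 h1 .S3_13 (hasTable_ofTable _ _ _ _ _) hli ho <;>
        simp [bv, xx, xy, yy, hxo, hyo]
    · exact absurd (by linear_combination -h4) (one_div_ne_zero h2)
    · apply hJ.isListed_two_one_of_table h2 h0 h1 .S2_2_U1 hasTable_S2_2_U1 hli ho <;>
        simp [bv, xx, xy, yy, hxo, hyo]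
    · exact absurd (by linear_combination -h3) (one_div_ne_zero h2)
    · exact absurd (by linear_combination -h3) (one_ne_zero (α := k))
  · have hy : wt y = 0 := by simpa [yy, wt0, h2] using hwy
    simp only [xx] at hwx
    rw [hy] at hyo
    rcases weight_idempotent h2 hwx with ht | ht | ht <;> rw [ht] at hxo
    · apply hJ.isListed_two_one_of_table h2 h0 h1 .U1_U2_S hasTable_U1_U2_S hli ho <;>
        simp [bv, xx, xy, yy, hxo, hyo]
    · apply hJ.isListed_two_one_of_table h2 h0 h1 .S2_1_U2 hasTable_S2_1_U2 hli ho <;>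
        simp [bv, xx, xy, yy, hxo, hyo]
    · apply hJ.isListed_two_one_of_table h2 h0 h1 .S2_2_U2 hasTable_S2_2_U2 hli ho <;>
        simp [bv, xx, xy, yy, hxo, hyo]
  · have hy : wt y = 0 := by simpa [yy, wt0, h2] using hwy
    have hx : wt x = 0 := by simpa [xx, wt0, h2] using hwx
    rw [hx] at hxo
    rw [hy] at hyo
    apply hJ.isListed_two_one_of_table h2 h0 h1 .U2_U2_S hasTable_U2_U2_S hli ho <;>
      simp [xx, xy, yy, hxo, hyo]

/-- Type `(1, 2)` with an idempotent `e` in the even part. The action of `e` on the odd part is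
diagonalizable; the product of the two eigenvectors can be nonzero only if both eigenvalues are `1`
or both are `1/2`. -/
lemma IsJordan.isListed_one_two_of_idempotent [FiniteDimensional k J.carrier]
    (hJ : J.IsJordan) (h2 : (2 : k) ≠ 0)
    (h0 : finrank k (J.part 0) = 1) (h1 : finrank k (J.part 1) = 2) {e : J.part 0} (he : e ≠ 0)
    (hee : J.mul e e = e) : J.IsListed 1 2 := by
  let L : Module.End k (J.part 1) :=
    (J.mul e).restrict (fun o ho => mul_even_odd e.2 ho)
  have hL : ∀ o, (L o : J.carrier) = J.mul e o := fun o => rfl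
  have hcubic : ∀ o, (2 : k) • L (L (L o)) - (3 : k) • L (L o) + L o = 0 := by
    intro o
    have h := hJ.action_identity e.2 e.2 e.2 o.2
    simp only [hee] at h
    apply Subtype.ext
    simp only [Submodule.coe_add, Submodule.coe_sub, Submodule.coe_smul, hL, Submodule.coe_zero]
    linear_combination (norm := module) -h
  have : Nontrivial (J.part 1) := Module.nontrivial_of_finrank_pos (R := k) (by omega)
  obtain ⟨a, ha, hea⟩ := exists_eigenvector_notMem_of_cubic h2 hcubic
    (bot_ne_top : (⊥ : Submodule k (J.part 1)) ≠ ⊤)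
  rw [Submodule.mem_bot] at ha
  obtain ⟨b, hb, heb⟩ := exists_eigenvector_notMem_of_cubic h2 hcubic
    (span_singleton_ne_top h1.ge a)
  have hli : LinearIndependent k ![a, b] := by
    rw [LinearIndependent.pair_iff' ha]
    intro t ht
    exact hb (Submodule.mem_span_singleton.2 ⟨t, ht⟩)
  obtain ⟨μ, hab⟩ : ∃ μ : k, J.mul a b = μ • (e : J.carrier) := by
    obtain ⟨μ, hμ⟩ := (finrank_eq_one_iff_of_nonzero' e he).1 h0 ⟨_, mul_odd_odd a.2 b.2⟩
    exact ⟨μ, (congrArg Subtype.val hμ).symm⟩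
  have hba : J.mul b a = (-μ) • (e : J.carrier) := by
    rw [hJ.odd_anticomm b.2 a.2, hab, neg_smul]
  have hli' : LinearIndependent k ![b, a] := LinearIndependent.pair_symm_iff.1 hli
  have he' : (e : J.carrier) ≠ 0 := fun h0 => he (Subtype.ext h0)
  -- The Peirce relation for `a b` and for `b a` restricts the eigenvalues unless `a b = 0`.
  have hμ : ∀ γ δ : k, J.mul e a = γ • (a : J.carrier) → J.mul e b = δ • (b : J.carrier) →
      (1 - 2 * δ) * (1 - γ) * μ = 0 ∧ (1 - 2 * γ) * (1 - δ) * μ = 0 := by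
    intro γ δ hγ hδ
    have p1 := hJ.odd_peirce e.2 hee a.2 b.2 hγ hδ
    have p2 := hJ.odd_peirce e.2 hee b.2 a.2 hδ hγ
    simp only [hab, hba, map_smul, hee] at p1 p2
    constructor
    · apply (smul_eq_zero.1 (_ : _ • (e : J.carrier) = 0)).resolve_right he'
      linear_combination (norm := module) p1
    · apply (smul_eq_zero.1 (_ : _ • (e : J.carrier) = 0)).resolve_right he'
      linear_combination (norm := module) -p2
  simp only [Subtype.ext_iff, hL, Submodule.coe_smul, Submodule.coe_zero] at hea heb
  have hhalf : (1 - 2⁻¹ : k) ≠ 0 := fun h0 =>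
    inv_ne_zero h2 (by linear_combination mul_inv_cancel₀ h2 + h0)
  have hone : (1 - 2 : k) ≠ 0 := by norm_num
  -- If `a b ≠ 0`, then `b` can be rescaled so that `a b = e`.
  have hrescale : μ ≠ 0 → LinearIndependent k ![a, μ⁻¹ • b] ∧
      J.mul a (μ⁻¹ • b : J.part 1) = e := by
    intro hμ0
    refine ⟨?_, by simp [hab, smul_smul, hμ0]⟩
    rw [LinearIndependent.pair_iff] at hli ⊢
    intro s t hst
    obtain ⟨p, q⟩ := hli s (t * μ⁻¹) (by rw [← hst, smul_smul])
    exact ⟨p, (mul_eq_zero.1 q).resolve_right (inv_ne_zero hμ0)⟩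
  rcases hea with hea | hea | hea <;> rcases heb with heb | heb | heb
  · have hm : μ = 0 := by simpa using (hμ 0 0 (by simp [hea]) (by simp [heb])).1
    apply hJ.isListed_one_two_of_table h2 h0 h1 .U1_S_S hasTable_U1_S_S he hli <;>
      simp [bv, hee, hea, heb, hab, hm]
  · have hm : μ = 0 := by simpa [hhalf, h2] using (hμ 0 _ (by simp [hea]) heb).2
    apply hJ.isListed_one_two_of_table h2 h0 h1 .S2_1_S hasTable_S2_1_S he hli' <;>
      simp [bv, hee, hea, heb, hba, hm]
  · have hm : μ = 0 := by simpa [hone] using (hμ 0 1 (by simp [hea]) (by simp [heb])).1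
    apply hJ.isListed_one_two_of_table h2 h0 h1 .S2_2_S hasTable_S2_2_S he hli' <;>
      simp [bv, hee, hea, heb, hba, hm]
  · have hm : μ = 0 := by simpa [hhalf, h2] using (hμ _ 0 hea (by simp [heb])).1
    apply hJ.isListed_one_two_of_table h2 h0 h1 .S2_1_S hasTable_S2_1_S he hli <;>
      simp [bv, hee, hea, heb, hab, hm]
  · by_cases hm : μ = 0
    · apply hJ.isListed_one_two_of_table h2 h0 h1 .S3_5 (hasTable_ofTable _ _ _ _ _) he hli <;>
        simp [bv, hee, hea, heb, hab, hm]
    · obtain ⟨hli'', hab'⟩ := hrescale hm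
      have heb' : J.mul e (μ⁻¹ • b : J.part 1) =
          (1 / 2 : k) • ((μ⁻¹ • b : J.part 1) : J.carrier) := by
        rw [Submodule.coe_smul, map_smul, heb, smul_comm]
      generalize μ⁻¹ • b = c at hli'' hab' heb'
      apply hJ.isListed_one_two_of_table h2 h0 h1 .S3_7 (hasTable_ofTable _ _ _ _ _) he hli'' <;>
        simp [bv, hee, hea, heb', hab']
  · have hm : μ = 0 := by simpa [hhalf, hone, h2] using (hμ _ 1 hea (by simp [heb])).1
    apply hJ.isListed_one_two_of_table h2 h0 h1 .S3_4 (hasTable_ofTable _ _ _ _ _) he hli' <;>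
      simp [bv, hee, hea, heb, hba, hm]
  · have hm : μ = 0 := by simpa [hone] using (hμ 1 0 (by simp [hea]) (by simp [heb])).2
    apply hJ.isListed_one_two_of_table h2 h0 h1 .S2_2_S hasTable_S2_2_S he hli <;>
      simp [bv, hee, hea, heb, hab, hm]
  · have hm : μ = 0 := by simpa [hhalf, hone, h2] using (hμ 1 _ (by simp [hea]) heb).2
    apply hJ.isListed_one_two_of_table h2 h0 h1 .S3_4 (hasTable_ofTable _ _ _ _ _) he hli <;>
      simp [bv, hee, hea, heb, hab, hm]
  · by_cases hm : μ = 0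
    · apply hJ.isListed_one_two_of_table h2 h0 h1 .S3_6 (hasTable_ofTable _ _ _ _ _) he hli <;>
        simp [bv, hee, hea, heb, hab, hm]
    · obtain ⟨hli'', hab'⟩ := hrescale hm
      have heb' : J.mul e (μ⁻¹ • b : J.part 1) = ((μ⁻¹ • b : J.part 1) : J.carrier) := by
        rw [Submodule.coe_smul, map_smul, heb]
      generalize μ⁻¹ • b = c at hli'' hab' heb'
      apply hJ.isListed_one_two_of_table h2 h0 h1 .S3_8 (hasTable_ofTable _ _ _ _ _) he hli'' <;>
        simp [bv, hee, hea, heb', hab']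

/-- Type `(1, 2)`. If the even part squares to zero, then its action on the odd part is nilpotent. -/
lemma IsJordan.isListed_one_two [IsAlgClosed k] [FiniteDimensional k J.carrier]
    (hJ : J.IsJordan) (h2 : (2 : k) ≠ 0)
    (h0 : finrank k (J.part 0) = 1) (h1 : finrank k (J.part 1) = 2) : J.IsListed 1 2 := by
  obtain ⟨m, hm, -⟩ := hJ.exists_evenProduct
  obtain ⟨e, he, hee⟩ := IsJordanProduct.exists_of_finrank_one h0 m
  simp only [Subtype.ext_iff, hm, Submodule.coe_zero] at hee
  rcases hee with hee | hee
  · exact hJ.isListed_one_two_of_idempotent h2 h0 h1 he hee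
  have hmul : ∀ a b : J.part 1, ∃ μ : k, J.mul a b = μ • (e : J.carrier) := by
    intro a b
    obtain ⟨μ, hμ⟩ := (finrank_eq_one_iff_of_nonzero' e he).1 h0 ⟨_, mul_odd_odd a.2 b.2⟩
    exact ⟨μ, (congrArg Subtype.val hμ).symm⟩
  let L : Module.End k (J.part 1) :=
    (J.mul e).restrict (fun o ho => mul_even_odd e.2 ho)
  have hL : ∀ o, (L o : J.carrier) = J.mul e o := fun o => rfl
  have hsq : ∀ o, L (L o) = 0 := by
    intro o
    have h3 : (L ^ 3) o = 0 := by
      have h := hJ.action_identity e.2 e.2 e.2 o.2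
      simp only [hee, map_zero, LinearMap.zero_apply, add_zero, zero_add] at h
      rw [← two_smul k] at h
      exact Subtype.ext ((smul_eq_zero.1 h.symm).resolve_left h2)
    have := Module.End.ker_pow_le_ker_pow_finrank L 3 h3
    rw [h1] at this
    exact this
  by_cases hL0 : ∃ a, L a ≠ 0
  · obtain ⟨a, ha⟩ := hL0
    obtain ⟨μ, hab⟩ := hmul a (L a)
    have hlin : ∀ s : k, s ≠ 0 → LinearIndependent k ![s • a, s • L a] := by
      intro s hs
      rw [LinearIndependent.pair_iff]
      intro p q hpq
      have h3 := congrArg L hpq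
      simp only [map_add, map_smul, hsq, smul_zero, add_zero, map_zero] at h3
      have hp : p = 0 := by simpa [hs, ha] using h3
      rw [hp, zero_smul, zero_add] at hpq
      exact ⟨hp, by simpa [hs, ha] using hpq⟩
    have heb : J.mul e (L a) = 0 := by rw [← hL, hsq, Submodule.coe_zero]
    by_cases hm : μ = 0
    · have hli := hlin 1 one_ne_zero
      rw [one_smul, one_smul] at hli
      apply hJ.isListed_one_two_of_table h2 h0 h1 .S3_3 (hasTable_ofTable _ _ _ _ _) he hli <;>
        simp [bv, hee, heb, hab, hm, ← hL]
    · -- Rescaling the odd basis by `s` multiplies `μ` by `s²`.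
      obtain ⟨s, hs⟩ := IsAlgClosed.exists_eq_mul_self μ⁻¹
      have hs0 : s ≠ 0 := by rintro rfl; exact inv_ne_zero hm (by rw [hs, mul_zero])
      have hsm : s * (s * μ) = 1 := by rw [← mul_assoc, ← hs, inv_mul_cancel₀ hm]
      apply hJ.isListed_one_two_of_table h2 h0 h1 .S3_1 (hasTable_ofTable _ _ _ _ _) he
        (hlin s hs0) <;>
        simp [bv, hee, heb, hab, smul_smul, hsm, ← hL]
  · push Not at hL0
    have heo : ∀ o : J.part 1, J.mul e o = 0 := fun o => by rw [← hL, hL0, Submodule.coe_zero]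
    let c := finBasisOfFinrankEq k _ h1
    obtain ⟨μ, hab⟩ := hmul (c 0) (c 1)
    have hli : LinearIndependent k ![c 0, c 1] := by
      convert c.linearIndependent using 1
      ext i; fin_cases i <;> rfl
    by_cases hm : μ = 0
    · apply hJ.isListed_one_two_of_table h2 h0 h1 .U2_S_S hasTable_U2_S_S he hli <;>
        simp [hee, heo, hab, hm]
    · -- The even basis vector is `a b = μ e`.
      apply hJ.isListed_one_two_of_table h2 h0 h1 .S3_2 (hasTable_ofTable _ _ _ _ _)
        (smul_ne_zero hm he) hli <;>
        simp [bv, hee, heo, hab]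

lemma IsJordan.isListed [IsAlgClosed k] (hJ : J.IsJordan) (h2 : (2 : k) ≠ 0) {n m : ℕ}
    (hnm : n + m ≤ 3) (hT : J.HasType n m) : J.IsListed n m := by
  obtain ⟨hfin, h0, h1⟩ := hT
  rcases Nat.eq_zero_or_pos n with rfl | hn
  · have : m ≤ 3 := by omega
    interval_cases m
    · exact isListed_zero_of_finrank h0 h1 .zero (hasTable_ofTable _ _ _ _ _)
    · exact isListed_zero_of_finrank h0 h1 .S1_1 hasTable_S1_1
    · exact isListed_zero_of_finrank h0 h1 .S_S hasTable_S_S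
    · exact isListed_zero_of_finrank h0 h1 .S_S_S hasTable_S_S_S
  obtain ⟨p, hp, h⟩ := hJ.exists_evenProduct
  rcases Nat.eq_zero_or_pos m with rfl | hm
  · refine isListed_of_isListedAlgebra hp h1 ?_
    have : n ≤ 3 := hnm
    interval_cases n
    · exact IsJordanProduct.isListedAlgebra_of_finrank_one h0 p
    · exact h.isListedAlgebra_of_finrank_two h2 h0
    · exact h.isListedAlgebra_of_finrank_three h2 h0
  have : n ≤ 2 := by omega
  have : m ≤ 2 := by omega
  interval_cases n <;> interval_cases m
  · exact hJ.isListed_one_one h2 h0 h1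
  · exact hJ.isListed_one_two h2 h0 h1
  · exact hJ.isListed_two_one h2 h0 h1
  · omega

end Superalgebra

/-! ### The classification -/

namespace JordanList

open Superalgebra

variable {k : Type u} [Field k]

lemma Listed.isJordan_and_hasType (h2 : (2 : k) ≠ 0) {n m : ℕ} {S : Superalgebra.{u, u} k}
    (h : Listed k n m S) : S.IsJordan ∧ S.HasType n m := by
  cases h
  · exact ⟨isJordan_zero, (hasTable_ofTable _ _ _ _ _).hasType⟩
  · exact ⟨isJordan_U1, hasTable_U1.hasType⟩
  · exact ⟨isJordan_U2, hasTable_U2.hasType⟩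
  · exact ⟨isJordan_S1_1, hasTable_S1_1.hasType⟩
  · exact ⟨isJordan_B1, hasTable_B1.hasType⟩
  · exact ⟨isJordan_B2 h2, hasTable_B2.hasType⟩
  · exact ⟨isJordan_B3, hasTable_B3.hasType⟩
  · exact ⟨isJordan_U1.dsum isJordan_U1, hasTable_U1_U1.hasType⟩
  · exact ⟨isJordan_U1.dsum isJordan_U2, hasTable_U1_U2.hasType⟩
  · exact ⟨isJordan_U2.dsum isJordan_U2, hasTable_U2_U2.hasType⟩
  · exact ⟨isJordan_S2_1 h2, hasTable_S2_1.hasType⟩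
  · exact ⟨isJordan_S2_2, hasTable_S2_2.hasType⟩
  · exact ⟨isJordan_U1.dsum isJordan_S1_1, hasTable_U1_S.hasType⟩
  · exact ⟨isJordan_U2.dsum isJordan_S1_1, hasTable_U2_S.hasType⟩
  · exact ⟨isJordan_S1_1.dsum isJordan_S1_1, hasTable_S_S.hasType⟩
  · exact ⟨isJordan_T1, (hasTable_ofTable _ _ _ _ _).hasType⟩
  · exact ⟨isJordan_T2, (hasTable_ofTable _ _ _ _ _).hasType⟩
  · exact ⟨isJordan_T3, (hasTable_ofTable _ _ _ _ _).hasType⟩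
  · exact ⟨isJordan_T4, (hasTable_ofTable _ _ _ _ _).hasType⟩
  · exact ⟨isJordan_T5 h2, (hasTable_ofTable _ _ _ _ _).hasType⟩
  · exact ⟨isJordan_T6 h2, (hasTable_ofTable _ _ _ _ _).hasType⟩
  · exact ⟨isJordan_T7 h2, (hasTable_ofTable _ _ _ _ _).hasType⟩
  · exact ⟨isJordan_T8 h2, (hasTable_ofTable _ _ _ _ _).hasType⟩
  · exact ⟨isJordan_T9 h2, (hasTable_ofTable _ _ _ _ _).hasType⟩
  · exact ⟨isJordan_T10 h2, (hasTable_ofTable _ _ _ _ _).hasType⟩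
  · exact ⟨isJordan_B1.dsum isJordan_U1, hasTable_B1_U1.hasType⟩
  · exact ⟨isJordan_B1.dsum isJordan_U2, hasTable_B1_U2.hasType⟩
  · exact ⟨(isJordan_B2 h2).dsum isJordan_U1, hasTable_B2_U1.hasType⟩
  · exact ⟨(isJordan_B2 h2).dsum isJordan_U2, hasTable_B2_U2.hasType⟩
  · exact ⟨isJordan_B3.dsum isJordan_U1, hasTable_B3_U1.hasType⟩
  · exact ⟨isJordan_B3.dsum isJordan_U2, hasTable_B3_U2.hasType⟩
  · exact ⟨isJordan_U1.dsum (isJordan_U1.dsum isJordan_U1), hasTable_U1_U1_U1.hasType⟩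
  · exact ⟨isJordan_U1.dsum (isJordan_U1.dsum isJordan_U2), hasTable_U1_U1_U2.hasType⟩
  · exact ⟨isJordan_U1.dsum (isJordan_U2.dsum isJordan_U2), hasTable_U1_U2_U2.hasType⟩
  · exact ⟨isJordan_U2.dsum (isJordan_U2.dsum isJordan_U2), hasTable_U2_U2_U2.hasType⟩
  · exact ⟨isJordan_S3_1 h2, (hasTable_ofTable _ _ _ _ _).hasType⟩
  · exact ⟨isJordan_S3_2 h2, (hasTable_ofTable _ _ _ _ _).hasType⟩
  · exact ⟨isJordan_S3_3 h2, (hasTable_ofTable _ _ _ _ _).hasType⟩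
  · exact ⟨isJordan_S3_4 h2, (hasTable_ofTable _ _ _ _ _).hasType⟩
  · exact ⟨isJordan_S3_5 h2, (hasTable_ofTable _ _ _ _ _).hasType⟩
  · exact ⟨isJordan_S3_6 h2, (hasTable_ofTable _ _ _ _ _).hasType⟩
  · exact ⟨isJordan_S3_7 h2, (hasTable_ofTable _ _ _ _ _).hasType⟩
  · exact ⟨isJordan_S3_8 h2, (hasTable_ofTable _ _ _ _ _).hasType⟩
  · exact ⟨(isJordan_S2_1 h2).dsum isJordan_S1_1, hasTable_S2_1_S.hasType⟩
  · exact ⟨isJordan_S2_2.dsum isJordan_S1_1, hasTable_S2_2_S.hasType⟩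
  · exact ⟨isJordan_U1.dsum (isJordan_S1_1.dsum isJordan_S1_1), hasTable_U1_S_S.hasType⟩
  · exact ⟨isJordan_U2.dsum (isJordan_S1_1.dsum isJordan_S1_1), hasTable_U2_S_S.hasType⟩
  · exact ⟨isJordan_S3_9 h2, (hasTable_ofTable _ _ _ _ _).hasType⟩
  · exact ⟨isJordan_S3_10, (hasTable_ofTable _ _ _ _ _).hasType⟩
  · exact ⟨isJordan_S3_11 h2, (hasTable_ofTable _ _ _ _ _).hasType⟩
  · exact ⟨isJordan_S3_12 h2, (hasTable_ofTable _ _ _ _ _).hasType⟩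
  · exact ⟨isJordan_S3_13 h2, (hasTable_ofTable _ _ _ _ _).hasType⟩
  · exact ⟨isJordan_B1.dsum isJordan_S1_1, hasTable_B1_S.hasType⟩
  · exact ⟨(isJordan_B2 h2).dsum isJordan_S1_1, hasTable_B2_S.hasType⟩
  · exact ⟨isJordan_B3.dsum isJordan_S1_1, hasTable_B3_S.hasType⟩
  · exact ⟨(isJordan_S2_1 h2).dsum isJordan_U1, hasTable_S2_1_U1.hasType⟩
  · exact ⟨(isJordan_S2_1 h2).dsum isJordan_U2, hasTable_S2_1_U2.hasType⟩
  · exact ⟨isJordan_S2_2.dsum isJordan_U1, hasTable_S2_2_U1.hasType⟩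
  · exact ⟨isJordan_S2_2.dsum isJordan_U2, hasTable_S2_2_U2.hasType⟩
  · exact ⟨isJordan_U1.dsum (isJordan_U1.dsum isJordan_S1_1), hasTable_U1_U1_S.hasType⟩
  · exact ⟨isJordan_U1.dsum (isJordan_U2.dsum isJordan_S1_1), hasTable_U1_U2_S.hasType⟩
  · exact ⟨isJordan_U2.dsum (isJordan_U2.dsum isJordan_S1_1), hasTable_U2_U2_S.hasType⟩
  · exact ⟨isJordan_S1_1.dsum (isJordan_S1_1.dsum isJordan_S1_1), hasTable_S_S_S.hasType⟩

end JordanList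

theorem mainTheorem1 {k : Type u} [Field k] [IsAlgClosed k] (hchar : ringChar k ≠ 2) :
    (∀ (J : Superalgebra.{u, v} k), J.IsJordan →
      ∀ n m : ℕ, n + m ≤ 3 → J.HasType n m →
        ∃ S : Superalgebra.{u, u} k, JordanList.Listed k n m S ∧ J.Isomorphic S) ∧
    (∀ (n m : ℕ) (S : Superalgebra.{u, u} k), JordanList.Listed k n m S →
      S.IsJordan ∧ S.HasType n m) := by
  have h2 : (2 : k) ≠ 0 := Ring.two_ne_zero hchar
  exact ⟨fun J hJ n m hnm hT => hJ.isListed h2 hnm hT, fun n m S h => h.isJordan_and_hasType h2⟩
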